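/- **Setting.** Let $d\ge 1$, $T>0$. *Potential.* $W\in C^1(\mathbb R;[0,\infty))$ vanishes exactly at $0$ and $1$, and $\int_0^1\sqrt{2W(z)}\,dz=1$. Put $\phi(s)=\int_0^s\sqrt{2W(z)}\,dz$. *Nonlocal Allen–Cahn equation.* For $\varepsilon>0$, a solution is a function $u_\varepsilon:\mathbb R^d\times[0,T)\to[0,1]$, continuous, with $\partial_tu_\varepsilon,\nabla u_\varepsilon,\nabla^2u_\varepsilon$ existing and continuous on $\mathbb R^d\times(0,T)$, which satisfies there $$\partial_t u_\varepsilon=\Delta u_\varepsilon-\tfrac1{\varepsilon^2}W'(u_\varepsilon)+\lambda_\varepsilon(t)\sqrt{2W(u_\varepsilon)},\qquad \lambda_\varepsilon(t)=-\frac{\int_{\mathbb R^d}(\Delta u_\varepsilon-\frac1{\varepsilon^2}W'(u_\varepsilon))\sqrt{2W(u_\varepsilon)}\,dx}{\int_{\mathbb R^d}2W(u_\varepsilon)\,dx},$$ and has finite mass, energy and dissipation: with $\psi_\varepsilon=\phi\circ u_\varepsilon$ and $E_\varepsilon[u]=\int_{\mathbb R^d}\big(\frac\varepsilon2|\nabla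 u|^2+\frac1\varepsilon W(u)\big)dx$, one has $\psi_\varepsilon(\cdot,t)\in L^1(\mathbb R^d)$ for $t\in[0,T)$, $\sup_{0<t<T}E_\varepsilon[u_\varepsilon(\cdot,t)]<\infty$, $(\Delta u_\varepsilon-\frac1{\varepsilon^2}W'(u_\varepsilon))(\cdot,t)\in L^2(\mathbb R^d)$ for $t\in(0,T)$, and $\partial_tu_\varepsilon\in L^2(\mathbb R^d\times(0,T))$. *Calibrated flow.* Let $\Sigma(t)=\partial\Omega(t)$, $t\in[0,T]$, be closed hypersurfaces of class $C^1$ enclosing nonempty bounded open sets $\Omega(t)\subset\mathbb R^d$ with constant volume, $|\Omega(t)|=|\Omega(0)|$ for all $t$. Suppose $\Sigma$ is calibrated by $(\xi,B,\vartheta,\lambda)$, where $\xi,B:\mathbb R^d\times[0,T]\to\mathbb R^d$, $\vartheta:\mathbb R^d\times[0,T]\to\mathbb R$, $\lambda:[0,T]\to\mathbb R$. This means the following, where $\mathrm{dist}=\mathrm{dist}(x,\Sigma(t))$, the relation $a=O(b)$ means $|a|\le C|b|$ with $C$ independent of $(x,t)$, and relations containing derivatives of Lipschitz functions hold almost everywhere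 (in $x$, for each $t\in[0,T]$, in (iii) and (v); in $(x,t)$ in (iv)): 1. (i) $\xi,\vartheta$ are Lipschitz on $\mathbb R^d\times[0,T]$; $B(\cdot,t)$ is bounded and Lipschitz on $\mathbb R^d$, with bounds uniform in $t\in[0,T]$. 2. (ii) $\xi(\cdot,t)=\nu(\cdot,t)$, the exterior unit normal, on $\Sigma(t)$, and for some $c>0$, $|\xi|\le(1-c\,\mathrm{dist}^2)_+$. 3. (iii) For some bounded function $c(t)$, $\nabla\cdot B-c(t)=O(\mathrm{dist})$; and $\xi\otimes\xi:\nabla B=O(\mathrm{dist})$. 4. (iv) $\partial_t\vartheta+(B\cdot\nabla)\vartheta=O(\mathrm{dist})$, $\ \partial_t|\xi|^2+(B\cdot\nabla)|\xi|^2=O(\mathrm{dist}^2)$, $\ \partial_t\xi+(B\cdot\nabla)\xi+(\nabla B)^{\mathsf T}\xi=O(\mathrm{dist})$. 5. (v) $B\cdot\xi+\nabla\cdot\xi-\lambda(t)=O(\mathrm{dist})$. 6. (vi) $\vartheta(\cdot,t)>0$ on $\mathbb R^d\setminus\overline{\Omega(t)}$, $\vartheta(\cdot,t)<0$ in $\Omega(t)$,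 $\vartheta$ is bounded, and there are $0<c,C<\infty$ such that for all $t$: $c\,\mathrm{dist}\le|\vartheta(\cdot,t)|\le C\,\mathrm{dist}$ on $\operatorname{supp}\xi(\cdot,t)$, and $|\vartheta(\cdot,t)|\ge c$ outside $\operatorname{supp}\xi(\cdot,t)$. Define $$\mathcal E_\varepsilon(t)=E_\varepsilon[u_\varepsilon(\cdot,t)]+\int_{\mathbb R^d}\xi\cdot\nabla\psi_\varepsilon\,dx,\qquad \mathcal F_\varepsilon(t)=\int_{\mathbb R^d}|\psi_\varepsilon-\chi_{\Omega(t)}|\,|\vartheta|\,dx .$$ **Claim.** There is a constant $C$ depending only on $d$, $T$ and the calibrated flow (that is, on $\Sigma$ and its calibration), but not on $W$, $\varepsilon$ or $u_\varepsilon$, such that for all $W$, $\varepsilon$ and solutions $u_\varepsilon$ as above with $\int_{\mathbb R^d}\psi_\varepsilon(x,0)\,dx=|\Omega(0)|$ the function $\mathcal E_\varepsilon+\mathcal F_\varepsilon$ is locally absolutely continuous on $(0,T)$ (hence differentiable at almost every time), and for all $t\in(0,T)$ $$\frac{d}{dt}\big(\mathcal E_\varepsilon+\mathcal F_\varepsilon\big)(t)\le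 C\big(\mathcal E_\varepsilon(t)+\mathcal F_\varepsilon(t)\big),$$ where the left-hand side is the derivative whenever it exists and, at every $t\in(0,T)$, may be replaced by the two-sided upper Dini derivative $\limsup_{s\to t}\frac{(\mathcal E_\varepsilon+\mathcal F_\varepsilon)(s)-(\mathcal E_\varepsilon+\mathcal F_\varepsilon)(t)}{s-t}$. -/

import Mathlib

open Set Filter Topology MeasureTheory

noncomputable section

/-- The Euclidean space `ℝ^d`. -/
abbrev Rd (d : ℕ) : Type := EuclideanSpace ℝ (Fin d)

/-! ### The nonlocal Allen-Cahn equation -/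

/-- A double-well potential with wells `0` and `1`, normalized so that the induced surface tension
`∫₀¹ √(2 W(z)) dz` equals `1`. -/
structure IsDoubleWell (W : ℝ → ℝ) : Prop where
  contDiff : ContDiff ℝ 1 W
  nonneg : ∀ z, 0 ≤ W z
  zero_iff : ∀ z, W z = 0 ↔ z = 0 ∨ z = 1
  surfaceTension : ∫ z in (0 : ℝ)..1, Real.sqrt (2 * W z) = 1

/-- `φ(s) = ∫₀ˢ √(2 W(z)) dz`. -/
def phi (W : ℝ → ℝ) (s : ℝ) : ℝ := ∫ z in (0 : ℝ)..s, Real.sqrt (2 * W z)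

/-- `ψ = φ ∘ v` for a function `v` of the space variable. -/
def psi {d : ℕ} (W : ℝ → ℝ) (v : Rd d → ℝ) (x : Rd d) : ℝ := phi W (v x)

/-- The energy density `ε/2 |∇v|² + W(v)/ε`. -/
def energyDensity {d : ℕ} (W : ℝ → ℝ) (ε : ℝ) (v : Rd d → ℝ) (x : Rd d) : ℝ :=
  ε / 2 * ‖gradient v x‖ ^ 2 + 1 / ε * W (v x)

/-- The Cahn-Hilliard energy `E_ε[v]`. -/
def cahnHilliard {d : ℕ} (W : ℝ → ℝ) (ε : ℝ) (v : Rd d → ℝ) : ℝ :=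
  ∫ x, energyDensity W ε v x

/-- The expression `Δv - W'(v)/ε²`. -/
def localForce {d : ℕ} (W : ℝ → ℝ) (ε : ℝ) (v : Rd d → ℝ) (x : Rd d) : ℝ :=
  Laplacian.laplacian v x - 1 / ε ^ 2 * deriv W (v x)

/-- The Lagrange multiplier
`λ_ε = - (∫ (Δv - W'(v)/ε²) √(2 W(v)) dx) / (∫ 2 W(v) dx)`. -/
def lagrangeMultiplier {d : ℕ} (W : ℝ → ℝ) (ε : ℝ) (v : Rd d → ℝ) : ℝ :=
  -(∫ x, localForce W ε v x * Real.sqrt (2 * W (v x))) / ∫ x, 2 * W (v x)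

/-- `u` (time first, space second) is a classical solution, of finite mass, energy and dissipation
and with values between the two wells, of the nonlocal Allen-Cahn equation
`∂ₜu = Δu - W'(u)/ε² + λ_ε √(2 W(u))` on `ℝ^d × (0,T)`, continuous up to the initial time. -/
structure IsNonlocalAllenCahnSolution {d : ℕ} (W : ℝ → ℝ) (ε T : ℝ) (u : ℝ → Rd d → ℝ) :
    Prop where
  continuousOn : ContinuousOn (fun p : ℝ × Rd d => u p.1 p.2) (Ico 0 T ×ˢ univ)
  mem_Icc : ∀ t ∈ Ico 0 T, ∀ x, u t x ∈ Icc (0 : ℝ) 1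
  differentiable_time : ∀ t ∈ Ioo 0 T, ∀ x, DifferentiableAt ℝ (fun s => u s x) t
  continuousOn_deriv :
    ContinuousOn (fun p : ℝ × Rd d => deriv (fun s => u s p.2) p.1) (Ioo 0 T ×ˢ univ)
  contDiff_space : ∀ t ∈ Ioo 0 T, ContDiff ℝ 2 (u t)
  continuousOn_fderiv :
    ContinuousOn (fun p : ℝ × Rd d => fderiv ℝ (u p.1) p.2) (Ioo 0 T ×ˢ univ)
  continuousOn_iteratedFDeriv :
    ContinuousOn (fun p : ℝ × Rd d => iteratedFDeriv ℝ 2 (u p.1) p.2) (Ioo 0 T ×ˢ univ)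
  /-- the equation, pointwise -/
  equation : ∀ t ∈ Ioo 0 T, ∀ x,
    deriv (fun s => u s x) t =
      Laplacian.laplacian (u t) x - 1 / ε ^ 2 * deriv W (u t x)
        + lagrangeMultiplier W ε (u t) * Real.sqrt (2 * W (u t x))
  /-- finite mass -/
  integrable_psi : ∀ t ∈ Ico 0 T, Integrable (psi W (u t))
  /-- finite and bounded energy -/
  integrable_gradient : ∀ t ∈ Ioo 0 T, Integrable (fun x => ‖gradient (u t) x‖ ^ 2)
  integrable_potential : ∀ t ∈ Ioo 0 T, Integrable (fun x => W (u t x))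
  energy_bounded : ∃ M, ∀ t ∈ Ioo 0 T, cahnHilliard W ε (u t) ≤ M
  /-- the integrals in the Lagrange multiplier are meaningful -/
  memLp_force : ∀ t ∈ Ioo 0 T, MemLp (localForce W ε (u t)) 2
  /-- finite dissipation -/
  integrable_dissipation :
    IntegrableOn (fun p : ℝ × Rd d => (deriv (fun s => u s p.2) p.1) ^ 2) (Ioo 0 T ×ˢ univ)

/-! ### Families of closed surfaces and gradient-flow calibrations -/

/-- `n` is the exterior unit normal of the open set `Ω` at the boundary point `x`: near `x`, the
set `Ω` is the sublevel set `{f < 0}` of a `C¹` function `f` with `∇f(x) ≠ 0`, and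
`n = ∇f(x) / |∇f(x)|`. -/
def IsOuterUnitNormal {d : ℕ} (Ω : Set (Rd d)) (x n : Rd d) : Prop :=
  ∃ (U : Set (Rd d)) (f : Rd d → ℝ), IsOpen U ∧ x ∈ U ∧ ContDiffOn ℝ 1 f U ∧
    gradient f x ≠ 0 ∧ Ω ∩ U = {y ∈ U | f y < 0} ∧
    n = ‖gradient f x‖⁻¹ • gradient f x

/-- The sets `Ω t`, `t ∈ [0,T]`, are the nonempty bounded open regions enclosed by closed
hypersurfaces `Σ(t) = ∂Ω(t)` of class `C¹`. -/
structure IsClosedSurfaceFamily {d : ℕ} (T : ℝ) (Ω : ℝ → Set (Rd d)) : Prop where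
  isOpen : ∀ t ∈ Icc 0 T, IsOpen (Ω t)
  isBounded : ∀ t ∈ Icc 0 T, Bornology.IsBounded (Ω t)
  nonempty : ∀ t ∈ Icc 0 T, (Ω t).Nonempty
  surface : ∀ t ∈ Icc 0 T, ∀ x ∈ frontier (Ω t), ∃ n, IsOuterUnitNormal (Ω t) x n

/-- The distance of `x` to `Σ(t) = ∂Ω(t)`. -/
def surfDist {d : ℕ} (Ω : ℝ → Set (Rd d)) (t : ℝ) (x : Rd d) : ℝ :=
  Metric.infDist x (frontier (Ω t))

/-- The divergence of a vector field on `ℝ^d`, the trace of its Jacobian. -/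
def divergence {d : ℕ} (F : Rd d → Rd d) (x : Rd d) : ℝ :=
  ∑ i, (fderiv ℝ F x (EuclideanSpace.single i 1)) i

/-- The tuple `(ξ, B, θ, lam)` is a gradient-flow calibration for volume-preserving mean curvature
flow of `Σ(t) = ∂Ω(t)`, `t ∈ [0,T]`. All constants are uniform in time and space. Derivatives of
Lipschitz functions exist, and relations between them are imposed, almost everywhere. -/
structure IsGradientFlowCalibration {d : ℕ} (T : ℝ) (Ω : ℝ → Set (Rd d))
    (ξ B : ℝ → Rd d → Rd d) (θ : ℝ → Rd d → ℝ) (lam : ℝ → ℝ) : Prop where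
  /-- regularity -/
  lipschitz_xi : ∃ L, LipschitzOnWith L (fun p : ℝ × Rd d => ξ p.1 p.2) (Icc 0 T ×ˢ univ)
  lipschitz_theta : ∃ L, LipschitzOnWith L (fun p : ℝ × Rd d => θ p.1 p.2) (Icc 0 T ×ˢ univ)
  lipschitz_B : ∃ L, ∀ t ∈ Icc 0 T, LipschitzWith L (B t)
  bounded_B : ∃ K, ∀ t ∈ Icc 0 T, ∀ x, ‖B t x‖ ≤ K
  /-- normal extension -/
  normal : ∀ t ∈ Icc 0 T, ∀ x ∈ frontier (Ω t), IsOuterUnitNormal (Ω t) x (ξ t x)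
  /-- shortness: `|ξ| ≤ (1 - c dist²)₊` -/
  short : ∃ c > 0, ∀ t ∈ Icc 0 T, ∀ x, ‖ξ t x‖ ≤ max (1 - c * surfDist Ω t x ^ 2) 0
  /-- divergence constraint: `∇ · B - c(t) = O(dist)` for a bounded function `c` of time -/
  div_B : ∃ c : ℝ → ℝ, (∃ K, ∀ t ∈ Icc 0 T, |c t| ≤ K) ∧
    ∃ C, ∀ t ∈ Icc 0 T, ∀ᵐ x, |divergence (B t) x - c t| ≤ C * surfDist Ω t x
  /-- `ξ ⊗ ξ : ∇B = O(dist)` -/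
  xi_xi_B : ∃ C, ∀ t ∈ Icc 0 T, ∀ᵐ x,
    |inner ℝ (ξ t x) (fderiv ℝ (B t) x (ξ t x))| ≤ C * surfDist Ω t x
  /-- `∂ₜθ + (B · ∇)θ = O(dist)` -/
  transport_theta : ∃ C, ∀ᵐ p : ℝ × Rd d ∂(volume.restrict (Ioo 0 T ×ˢ univ)),
    |deriv (fun s => θ s p.2) p.1 + fderiv ℝ (θ p.1) p.2 (B p.1 p.2)| ≤ C * surfDist Ω p.1 p.2
  /-- `∂ₜ|ξ|² + (B · ∇)|ξ|² = O(dist²)` -/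
  transport_length : ∃ C, ∀ᵐ p : ℝ × Rd d ∂(volume.restrict (Ioo 0 T ×ˢ univ)),
    |deriv (fun s => ‖ξ s p.2‖ ^ 2) p.1 + fderiv ℝ (fun y => ‖ξ p.1 y‖ ^ 2) p.2 (B p.1 p.2)|
      ≤ C * surfDist Ω p.1 p.2 ^ 2
  /-- `∂ₜξ + (B · ∇)ξ + (∇B)ᵀ ξ = O(dist)` -/
  transport_xi : ∃ C, ∀ᵐ p : ℝ × Rd d ∂(volume.restrict (Ioo 0 T ×ˢ univ)),
    ‖deriv (fun s => ξ s p.2) p.1 + fderiv ℝ (ξ p.1) p.2 (B p.1 p.2)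
        + ContinuousLinearMap.adjoint (fderiv ℝ (B p.1) p.2) (ξ p.1 p.2)‖
      ≤ C * surfDist Ω p.1 p.2
  /-- geometric evolution equation: `B · ξ + ∇ · ξ - lam = O(dist)` -/
  evolution : ∃ C, ∀ t ∈ Icc 0 T, ∀ᵐ x,
    |inner ℝ (B t x) (ξ t x) + divergence (ξ t) x - lam t| ≤ C * surfDist Ω t x
  /-- sign and coercivity of the weight -/
  theta_pos : ∀ t ∈ Icc 0 T, ∀ x, x ∉ closure (Ω t) → 0 < θ t x
  theta_neg : ∀ t ∈ Icc 0 T, ∀ x ∈ Ω t, θ t x < 0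
  theta_bounded : ∃ K, ∀ t ∈ Icc 0 T, ∀ x, |θ t x| ≤ K
  theta_dist : ∃ c > 0, ∃ C, ∀ t ∈ Icc 0 T, ∀ x ∈ tsupport (ξ t),
    c * surfDist Ω t x ≤ |θ t x| ∧ |θ t x| ≤ C * surfDist Ω t x
  /-- away from `supp ξ`, i.e. away from the surfaces, the weight does not degenerate -/
  theta_far : ∃ c > 0, ∀ t ∈ Icc 0 T, ∀ x, x ∉ tsupport (ξ t) → c ≤ |θ t x|

/-! ### Relative energy and volume error -/

/-- The relative energy `E_ε[u(·,t)] + ∫ ξ · ∇ψ_ε dx`. -/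
def relativeEnergy {d : ℕ} (W : ℝ → ℝ) (ε : ℝ) (ξ : ℝ → Rd d → Rd d) (u : ℝ → Rd d → ℝ)
    (t : ℝ) : ℝ :=
  cahnHilliard W ε (u t) + ∫ x, inner ℝ (ξ t x) (gradient (psi W (u t)) x)

/-- The weighted volume error `∫ |ψ_ε - χ_Ω| |θ| dx`. -/
def volumeError {d : ℕ} (W : ℝ → ℝ) (Ω : ℝ → Set (Rd d)) (θ : ℝ → Rd d → ℝ)
    (u : ℝ → Rd d → ℝ) (t : ℝ) : ℝ :=
  ∫ x, |psi W (u t) x - (Ω t).indicator (fun _ => (1 : ℝ)) x| * |θ t x|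

end

noncomputable section

variable {d : ℕ}

/-! ### Coordinates -/

/-! Write `V = ∂ₜu`, `R` for the relative energy and `F` for the volume error. The Lagrange
multiplier is the one for which `∫ √(2W(u)) V = 0`, so mass is conserved and the energy dissipates
at the rate `∫ ε V²`; formally the time derivative of `R + F` is the integral of `rateDensity`. To
bound it by `R + F`, one first adds integrals that vanish or are known: `λ ∫ √(2W) V`, the
distributional identity `∇·(∇·(B⊗ξ − ξ⊗B)) = 0` tested with `ψ` (`integral_fderiv_commutator`), the
transport of `(ψ − χ)θ` along `B` (`integral_phaseError_transport`), and the energy-stress identity,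
that is the equation tested with `B·∇u` (`integral_localForce_mul_fderiv`). In the variables
`√ε|∇u|`, `√(2W/ε)`, `√ε V` the resulting integrand is estimated pointwise: two squares are
completed, and the calibration conditions bound what remains by the densities of `R` and `F`
(`pointwise_dissipation_le`). Neither `ε` nor `W` enters the constants.

The obstruction is the term `ε λ_ε ∫ B·∇ψ` left by the stress identity, since `λ_ε` has no uniform
bound. It is removed by testing with `B − αX` instead, where `X` is `arctanField` and `α` is chosen
so that this field has zero flux through the diffuse interface. The flux of `B` is `O(F)`: `∇·B` is
constant in space up to `O(dist)`, `ψ` and `χ` have equal mass, and `∫_Ω ∇·B = 0` by constancy of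
the volume (`abs_integral_flux_le`). The flux of `X` stays away from zero while `F` is small,
because `∇·X > 0` (`le_abs_integral_arctan_flux`). Hence `α = O(F)`, and the correction costs `(|α|
+ α²) E_ε` with `E_ε ≤ R + C|Ω|`, which is admissible as `F` is bounded. When `F` is not small,
`|Ω|` itself is dominated by `F` and a crude estimate of the rate suffices. Together this is
`exists_integral_rate_le`.

The other half is the differentiation in time. Mixed space-time derivatives of `u` need not exist,
so increments of the localized energy and flux are integrated by parts in space until only
increments of `u` itself remain. With cut-offs in space each quantity is absolutely continuous, and
its rate is dominated by energy plus dissipation; passing to the limit shows that `R + F` is the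
integral of its rate (`integral_totalRate`). The constants of the calibration, and the vanishing of
`∫_Ω ∇·B` at almost every time, are collected in `exists_sliceControl`. The Dini form follows
because `R + F` is continuous. -/

lemma sum_smul_single (y : Rd d) : ∑ i, y i • (EuclideanSpace.single i 1 : Rd d) = y := by
  simpa using (EuclideanSpace.basisFun (Fin d) ℝ).sum_repr y

lemma clm_apply_eq_sum {F : Type*} [NormedAddCommGroup F] [NormedSpace ℝ F]
    (L : Rd d →L[ℝ] F) (y : Rd d) :
    L y = ∑ i, y i • L (EuclideanSpace.single i 1) := by
  conv_lhs => rw [← sum_smul_single y]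
  simp

lemma clm_apply_eq_sum_mul (L : Rd d →L[ℝ] ℝ) (y : Rd d) :
    L y = ∑ i, y i * L (EuclideanSpace.single i 1) := by
  simpa using clm_apply_eq_sum L y

lemma fderiv_coord {F : Rd d → Rd d} {x : Rd d} (h : DifferentiableAt ℝ F x) (i : Fin d)
    (v : Rd d) : fderiv ℝ (fun y => F y i) x v = (fderiv ℝ F x v) i := by
  have := ((EuclideanSpace.proj (𝕜 := ℝ) i).hasFDerivAt.comp x h.hasFDerivAt).fderiv
  have e : (fun y => F y i) = (EuclideanSpace.proj (𝕜 := ℝ) i) ∘ F := rfl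
  rw [e, this]; rfl

lemma lipschitzWith_coord {F : Rd d → Rd d} {L : NNReal} (h : LipschitzWith L F) (i : Fin d) :
    LipschitzWith L (fun y => F y i) := by
  refine LipschitzWith.of_dist_le_mul fun x y => ?_
  refine le_trans ?_ (h.dist_le_mul x y)
  rw [dist_eq_norm, dist_eq_norm]
  exact PiLp.norm_apply_le (F x - F y) i

lemma measurable_divergence (F : Rd d → Rd d) : Measurable (divergence F) := by
  unfold divergence
  refine Finset.measurable_sum _ fun i _ => ?_
  have h : Measurable fun x => fderiv ℝ F x (EuclideanSpace.single i 1) :=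
    measurable_fderiv_apply_const ℝ F _
  exact (EuclideanSpace.proj (𝕜 := ℝ) i).continuous.measurable.comp h

lemma abs_divergence_le {F : Rd d → Rd d} {L : NNReal} (h : LipschitzWith L F) (x : Rd d) :
    |divergence F x| ≤ d * L := by
  unfold divergence
  refine (Finset.abs_sum_le_sum_abs _ _).trans ?_
  have : ∀ i ∈ Finset.univ, |(fderiv ℝ F x (EuclideanSpace.single i (1:ℝ))) i| ≤ (L : ℝ) := by
    intro i _
    refine (PiLp.norm_apply_le (fderiv ℝ F x (EuclideanSpace.single i (1:ℝ))) i).trans ?_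
    refine ((fderiv ℝ F x).le_opNorm _).trans ?_
    simpa using norm_fderiv_le_of_lipschitz ℝ h
  refine (Finset.sum_le_sum this).trans ?_
  simp

/-! ### Cut-off functions -/

/-- A sequence of compactly supported functions of class `C²` exhausting the space. -/
structure IsCutoffSeq (η : ℕ → Rd d → ℝ) (C : ℝ) : Prop where
  contDiff : ∀ n, ContDiff ℝ 2 (η n)
  compact : ∀ n, HasCompactSupport (η n)
  nonneg : ∀ n x, 0 ≤ η n x
  le_one : ∀ n x, η n x ≤ 1
  norm_fderiv_le : ∀ n x, ‖fderiv ℝ (η n) x‖ ≤ C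
  eventually_one : ∀ x, ∀ᶠ n in atTop, η n =ᶠ[𝓝 x] fun _ => 1

lemma exists_cutoffSeq (d : ℕ) : ∃ (η : ℕ → Rd d → ℝ) (C : ℝ), IsCutoffSeq η C := by
  -- The cut-offs are dilates of one bump. Dilation by a factor of at least 1 does not increase the
  -- Lipschitz constant, so one gradient bound serves all `n`.
  let f : ContDiffBump (0 : Rd d) := ⟨1, 2, by norm_num, by norm_num⟩
  have hf : ContDiff ℝ 2 f := f.contDiff
  obtain ⟨L, hL⟩ := hf.lipschitzWith_of_hasCompactSupport f.hasCompactSupport (by norm_num)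
  have hc : ∀ n : ℕ, (0:ℝ) < ((n:ℝ) + 1)⁻¹ := fun n => by positivity
  refine ⟨fun n x => f (((n:ℝ) + 1)⁻¹ • x), L, ?_, ?_, ?_, ?_, ?_, ?_⟩
  · intro n
    exact hf.comp (contDiff_const_smul _)
  · intro n
    exact f.hasCompactSupport.comp_smul (hc n).ne'
  · intro n x; exact f.nonneg
  · intro n x; exact f.le_one
  · intro n x
    refine norm_fderiv_le_of_lipschitz ℝ (C := L) ?_
    refine LipschitzWith.of_dist_le_mul fun x y => ?_
    refine (hL.dist_le_mul _ _).trans ?_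
    rw [dist_smul₀]
    have h1 : ‖((n:ℝ) + 1)⁻¹‖ ≤ 1 := by
      rw [Real.norm_of_nonneg (hc n).le]
      exact inv_le_one_of_one_le₀ (by linarith [Nat.cast_nonneg (α := ℝ) n])
    have := mul_le_mul_of_nonneg_right h1 (dist_nonneg (x := x) (y := y))
    rw [one_mul] at this
    exact mul_le_mul_of_nonneg_left this L.2
  · intro x
    obtain ⟨N, hN⟩ := exists_nat_gt ‖x‖
    filter_upwards [eventually_ge_atTop N] with n hn
    have hxn : ‖x‖ < n + 1 := by
      have : (N:ℝ) ≤ n := by exact_mod_cast hn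
      linarith
    have : ∀ᶠ y in 𝓝 x, ‖y‖ < n + 1 := continuous_norm.continuousAt.eventually_lt
      continuousAt_const hxn
    filter_upwards [this] with y hy
    apply f.one_of_mem_closedBall
    simp only [mem_closedBall_zero_iff, norm_smul]
    rw [Real.norm_of_nonneg (hc n).le, inv_mul_le_iff₀ (by positivity)]
    show ‖y‖ ≤ _ * 1
    linarith

namespace IsCutoffSeq

variable {η : ℕ → Rd d → ℝ} {C : ℝ}

lemma C_nonneg (h : IsCutoffSeq η C) : 0 ≤ C :=
  (norm_nonneg _).trans (h.norm_fderiv_le 0 0)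

lemma eventually_eq_one (h : IsCutoffSeq η C) (x : Rd d) : ∀ᶠ n in atTop, η n x = 1 := by
  filter_upwards [h.eventually_one x] with n hn using hn.self_of_nhds

lemma eventually_fderiv (h : IsCutoffSeq η C) (x : Rd d) :
    ∀ᶠ n in atTop, fderiv ℝ (η n) x = 0 := by
  filter_upwards [h.eventually_one x] with n hn
  rw [hn.fderiv_eq]; simp

lemma continuous (h : IsCutoffSeq η C) (n : ℕ) : Continuous (η n) := (h.contDiff n).continuous

lemma differentiable (h : IsCutoffSeq η C) (n : ℕ) : Differentiable ℝ (η n) :=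
  (h.contDiff n).differentiable (by norm_num)

lemma continuous_fderiv (h : IsCutoffSeq η C) (n : ℕ) : Continuous (fderiv ℝ (η n)) :=
  (h.contDiff n).continuous_fderiv (by norm_num)

lemma lipschitz (h : IsCutoffSeq η C) (n : ℕ) : ∃ L, LipschitzWith L (η n) :=
  (h.contDiff n).lipschitzWith_of_hasCompactSupport (h.compact n) (by norm_num)

lemma abs_le_one (h : IsCutoffSeq η C) (n : ℕ) (x : Rd d) : |η n x| ≤ 1 := by
  rw [abs_of_nonneg (h.nonneg n x)]; exact h.le_one n x

lemma tendsto_integral_mul (h : IsCutoffSeq η C) {F : Rd d → ℝ} (hF : Integrable F) :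
    Tendsto (fun n => ∫ x, η n x * F x) atTop (𝓝 (∫ x, F x)) := by
  refine tendsto_integral_of_dominated_convergence (fun x => ‖F x‖) ?_ hF.norm ?_ ?_
  · intro n
    exact (h.continuous n).aestronglyMeasurable.mul hF.aestronglyMeasurable
  · intro n
    refine .of_forall fun x => ?_
    rw [norm_mul, Real.norm_eq_abs (η n x)]
    exact mul_le_of_le_one_left (norm_nonneg _) (h.abs_le_one n x)
  · refine .of_forall fun x => ?_
    refine tendsto_const_nhds.congr' ?_
    filter_upwards [h.eventually_eq_one x] with n hn
    rw [hn, one_mul]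

/-- The gradients of the cut-offs are uniformly bounded and eventually vanish at each point. Thus
boundary terms at infinity disappear for every integrable field, with no decay assumption. -/
lemma tendsto_integral_fderiv (h : IsCutoffSeq η C) {Y : Rd d → Rd d} (hY : Integrable Y) :
    Tendsto (fun n => ∫ x, fderiv ℝ (η n) x (Y x)) atTop (𝓝 0) := by
  have : Tendsto (fun n => ∫ x, fderiv ℝ (η n) x (Y x)) atTop (𝓝 (∫ x : Rd d, (0:ℝ))) := by
    refine tendsto_integral_of_dominated_convergence (fun x => C * ‖Y x‖) ?_
      (hY.norm.const_mul C) ?_ ?_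
    · intro n
      exact isBoundedBilinearMap_apply.continuous.comp_aestronglyMeasurable₂
        (h.continuous_fderiv n).aestronglyMeasurable hY.aestronglyMeasurable
    · intro n
      refine .of_forall fun x => ?_
      exact ((fderiv ℝ (η n) x).le_opNorm _).trans
        (mul_le_mul_of_nonneg_right (h.norm_fderiv_le n x) (norm_nonneg _))
    · refine .of_forall fun x => ?_
      refine tendsto_const_nhds.congr' ?_
      filter_upwards [h.eventually_fderiv x] with n hn
      rw [hn]; rfl
  simpa using this

lemma fderiv_mul_apply {F : Rd d → ℝ} (h : IsCutoffSeq η C) (n : ℕ) {x : Rd d}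
    (hF : DifferentiableAt ℝ F x) (v : Rd d) :
    fderiv ℝ (fun y => η n y * F y) x v = η n x * fderiv ℝ F x v + F x * fderiv ℝ (η n) x v := by
  rw [fderiv_fun_mul (h.differentiable n x) hF]
  simp

end IsCutoffSeq

/-- A continuous function of compact support is locally dominated by a cut-off. -/
lemma exists_contDiff_one_on_compact {K : Set (Rd d)} (hK : IsCompact K) :
    ∃ χ : Rd d → ℝ, ContDiff ℝ 2 χ ∧ HasCompactSupport χ ∧ ∀ x ∈ K, χ =ᶠ[𝓝 x] fun _ => 1 := by
  obtain ⟨R, hR⟩ := hK.isBounded.subset_ball (0 : Rd d)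
  let f : ContDiffBump (0 : Rd d) := ⟨max R 1, max R 1 + 1, by positivity, by linarith⟩
  refine ⟨f, f.contDiff, f.hasCompactSupport, fun x hx => ?_⟩
  have : x ∈ Metric.ball (0 : Rd d) (max R 1) :=
    Metric.ball_subset_ball (le_max_left _ _) (hR hx)
  filter_upwards [Metric.isOpen_ball.mem_nhds this] with y hy
  exact f.one_of_mem_closedBall (Metric.ball_subset_closedBall hy)

/-! ### Integration by parts for Lipschitz functions -/

lemma integral_mul_fderiv_of_lipschitz {f g : Rd d → ℝ} {L M : NNReal} (hf : LipschitzWith L f)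
    (hg : LipschitzWith M g) (hgc : HasCompactSupport g) (v : Rd d) :
    ∫ x, f x * fderiv ℝ g x v = -∫ x, fderiv ℝ f x v * g x := by
  have h := hf.integral_lineDeriv_mul_eq (μ := volume) hg hgc v
  have h1 : ∫ x, lineDeriv ℝ f x v * g x = ∫ x, fderiv ℝ f x v * g x := by
    refine integral_congr_ae ?_
    filter_upwards [hf.ae_differentiableAt (μ := volume)] with x hx
    rw [hx.lineDeriv_eq_fderiv]
  have h2 : ∫ x, lineDeriv ℝ g x (-v) * f x = -∫ x, f x * fderiv ℝ g x v := by
    rw [← integral_neg]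
    refine integral_congr_ae ?_
    filter_upwards [hg.ae_differentiableAt (μ := volume)] with x hx
    rw [hx.lineDeriv_eq_fderiv]
    simp [mul_comm]
  rw [← h1, h, h2, neg_neg]

lemma tendsto_integral_diffquot_mul {f g : Rd d → ℝ} {L : NNReal} (hf : LipschitzWith L f)
    (hg : Integrable g) (v : Rd d) :
    Tendsto (fun t : ℝ => ∫ x, (t⁻¹ • (f (x + t • v) - f x)) * g x) (𝓝[>] 0)
      (𝓝 (∫ x, fderiv ℝ f x v * g x)) := by
  have h := hf.integral_inv_smul_sub_mul_tendsto_integral_lineDeriv_mul hg v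
  have h1 : ∫ x, lineDeriv ℝ f x v * g x = ∫ x, fderiv ℝ f x v * g x := by
    refine integral_congr_ae ?_
    filter_upwards [hf.ae_differentiableAt (μ := volume)] with x hx
    rw [hx.lineDeriv_eq_fderiv]
  rwa [h1] at h

lemma integrable_of_bounded_of_compact {E : Type*} [NormedAddCommGroup E] {K : Set (Rd d)}
    (hK : IsCompact K) {F : Rd d → E} (hm : AEStronglyMeasurable F) (C : ℝ)
    (hb : ∀ᵐ x, x ∈ K → ‖F x‖ ≤ C) (h0 : ∀ x ∉ K, F x = 0) : Integrable F := by
  refine (integrableOn_iff_integrable_of_support_subset (s := K) ?_).1 ?_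
  · intro x hx
    by_contra h
    exact hx (h0 x h)
  · exact Measure.integrableOn_of_bounded (M := C) hK.measure_lt_top.ne hm
      ((ae_restrict_iff' hK.measurableSet).2 hb)

lemma fderiv_eq_zero_of_notMem_tsupport {g : Rd d → ℝ} {x : Rd d} (hx : x ∉ tsupport g) :
    fderiv ℝ g x = 0 := by
  by_contra h
  exact hx (support_fderiv_subset ℝ h)

lemma integrable_mul_fderiv_of_compact {f g : Rd d → ℝ} {M : NNReal} (hf : Continuous f)
    (hg : LipschitzWith M g) (hgc : HasCompactSupport g) (v : Rd d) :
    Integrable (fun x => f x * fderiv ℝ g x v) := by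
  obtain ⟨C, hC⟩ := hgc.isCompact.exists_bound_of_continuousOn hf.continuousOn
  refine integrable_of_bounded_of_compact hgc.isCompact
    (hf.aestronglyMeasurable.mul (measurable_fderiv_apply_const ℝ g v).aestronglyMeasurable)
    (C * (M * ‖v‖)) (.of_forall fun x hx => ?_) fun x hx => ?_
  · rw [norm_mul]
    exact mul_le_mul (hC x hx) (((fderiv ℝ g x).le_opNorm v).trans
      (mul_le_mul_of_nonneg_right (norm_fderiv_le_of_lipschitz ℝ hg) (norm_nonneg _)))
      (norm_nonneg _) ((norm_nonneg _).trans (hC x hx))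
  · rw [fderiv_eq_zero_of_notMem_tsupport hx]; simp

lemma integrable_fderiv_mul_of_compact {f g : Rd d → ℝ} {L : NNReal} (hf : LipschitzWith L f)
    (hg : Continuous g) (hgc : HasCompactSupport g) (v : Rd d) :
    Integrable (fun x => fderiv ℝ f x v * g x) := by
  obtain ⟨C, hC⟩ := hgc.isCompact.exists_bound_of_continuousOn hg.continuousOn
  refine integrable_of_bounded_of_compact hgc.isCompact
    ((measurable_fderiv_apply_const ℝ f v).aestronglyMeasurable.mul hg.aestronglyMeasurable)
    ((L * ‖v‖) * C) (.of_forall fun x hx => ?_) fun x hx => ?_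
  · rw [norm_mul]
    exact mul_le_mul (((fderiv ℝ f x).le_opNorm v).trans
      (mul_le_mul_of_nonneg_right (norm_fderiv_le_of_lipschitz ℝ hf) (norm_nonneg _)))
      (hC x hx) (norm_nonneg _) (by positivity)
  · rw [image_eq_zero_of_notMem_tsupport hx]; simp

/-- Weak second derivatives commute. -/
lemma integral_fderiv_mul_fderiv_comm {f g : Rd d → ℝ} {L M : NNReal} (hf : LipschitzWith L f)
    (hg : LipschitzWith M g) (hgc : HasCompactSupport g) (v w : Rd d) :
    ∫ x, fderiv ℝ f x v * fderiv ℝ g x w = ∫ x, fderiv ℝ f x w * fderiv ℝ g x v := by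
  -- The difference quotient of `f` along `v`, tested with `∂_w g`, is integrated by parts in `w`
  -- and then translated, so that the quotient falls on `g`. `K` contains the supports of all
  -- translates of `g` by `tv`, `|t| ≤ 1`; truncating `∂_w f` to `K` makes it integrable, as the
  -- limit `t → 0` requires.
  let K := Metric.cthickening ‖v‖ (tsupport g)
  have hK : IsCompact K := hgc.isCompact.cthickening
  let h : Rd d → ℝ := K.indicator fun x => fderiv ℝ f x w
  have hh : Integrable h := by
    refine integrable_of_bounded_of_compact hK
      ((measurable_fderiv_apply_const ℝ f w).indicator hK.measurableSet).aestronglyMeasurable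
      (L * ‖w‖) (.of_forall fun x hx => ?_) fun x hx => indicator_of_notMem hx _
    rw [show h x = fderiv ℝ f x w from indicator_of_mem hx _]
    exact ((fderiv ℝ f x).le_opNorm w).trans
      (mul_le_mul_of_nonneg_right (norm_fderiv_le_of_lipschitz ℝ hf) (norm_nonneg _))
  have key : ∀ᶠ t : ℝ in 𝓝[>] 0, ∫ x, (t⁻¹ • (f (x + t • v) - f x)) * fderiv ℝ g x w
      = -∫ x, (t⁻¹ • (g (x + t • (-v)) - g x)) * h x := by
    filter_upwards [Ioc_mem_nhdsGT (zero_lt_one (α := ℝ))] with t ht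
    have hf' : LipschitzWith L (fun x => f (x + t • v)) := by
      refine LipschitzWith.of_dist_le_mul fun x y => ?_
      simpa using hf.dist_le_mul (x + t • v) (y + t • v)
    have hg' : Continuous (fun x => g (x + t • (-v))) := hg.continuous.comp (by fun_prop)
    have hgc' : HasCompactSupport (fun x => g (x + t • (-v))) :=
      hgc.comp_homeomorph (Homeomorph.addRight (t • (-v)))
    have e1 := integral_mul_fderiv_of_lipschitz hf' hg hgc w
    have e2 := integral_mul_fderiv_of_lipschitz hf hg hgc w
    have e3 : ∫ x, fderiv ℝ (fun x => f (x + t • v)) x w * g x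
        = ∫ x, fderiv ℝ f x w * g (x + t • (-v)) := by
      simp_rw [fderiv_comp_add_right]
      rw [← integral_add_right_eq_self (fun x => fderiv ℝ f x w * g (x + t • (-v))) (t • v)]
      refine integral_congr_ae (.of_forall fun x => ?_)
      simp
    have i1 := integrable_mul_fderiv_of_compact hf'.continuous hg hgc w
    have i2 := integrable_mul_fderiv_of_compact hf.continuous hg hgc w
    have i3 := integrable_fderiv_mul_of_compact hf hg' hgc' w
    have i4 := integrable_fderiv_mul_of_compact hf hg.continuous hgc w
    have l1 : ∫ x, (t⁻¹ • (f (x + t • v) - f x)) * fderiv ℝ g x w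
        = t⁻¹ * ((∫ x, f (x + t • v) * fderiv ℝ g x w) - ∫ x, f x * fderiv ℝ g x w) := by
      rw [← integral_sub i1 i2, ← integral_const_mul]
      refine integral_congr_ae (.of_forall fun x => ?_)
      simp only [smul_eq_mul]; ring
    have l2 : ∫ x, (t⁻¹ • (g (x + t • (-v)) - g x)) * h x
        = t⁻¹ * ((∫ x, fderiv ℝ f x w * g (x + t • (-v))) - ∫ x, fderiv ℝ f x w * g x) := by
      rw [← integral_sub i3 i4, ← integral_const_mul]
      refine integral_congr_ae (.of_forall fun x => ?_)
      by_cases hx : x ∈ K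
      · simp only [show h x = fderiv ℝ f x w from indicator_of_mem hx _, smul_eq_mul]
        ring
      · have hx1 : g x = 0 := by
          refine image_eq_zero_of_notMem_tsupport fun h' => hx ?_
          exact Metric.self_subset_cthickening _ h'
        have hx2 : g (x + t • (-v)) = 0 := by
          refine image_eq_zero_of_notMem_tsupport fun h' => hx ?_
          refine Metric.mem_cthickening_of_dist_le _ _ _ _ h' ?_
          rw [dist_eq_norm]
          simp only [smul_neg, sub_add_cancel_left, neg_neg, norm_smul, Real.norm_eq_abs,
            abs_of_pos ht.1]
          exact mul_le_of_le_one_left (norm_nonneg _) ht.2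
        simp only [hx1, hx2]; simp
    rw [l1, l2, e1, e2, e3]; ring
  have hgi : Integrable (fun x => fderiv ℝ g x w) := by
    simpa using integrable_mul_fderiv_of_compact (f := fun _ => 1) continuous_const hg hgc w
  have t1 := tendsto_integral_diffquot_mul hf hgi v
  have t2 := (tendsto_integral_diffquot_mul hg hh (-v)).neg
  have := tendsto_nhds_unique (t1.congr' key) t2
  rw [this, ← integral_neg]
  refine integral_congr_ae (.of_forall fun x => ?_)
  by_cases hx : x ∈ K
  · simp only [show h x = fderiv ℝ f x w from indicator_of_mem hx _]
    simp [mul_comm]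
  · have : x ∉ tsupport g := fun h' => hx (Metric.self_subset_cthickening _ h')
    simp [fderiv_eq_zero_of_notMem_tsupport this]

/-- The divergence theorem for a Lipschitz vector field. -/
lemma integral_fderiv_apply_of_compact {g : Rd d → ℝ} {Y : Rd d → Rd d} {L M : NNReal}
    (hY : LipschitzWith L Y) (hg : LipschitzWith M g) (hgc : HasCompactSupport g) :
    ∫ x, fderiv ℝ g x (Y x) = -∫ x, divergence Y x * g x := by
  have h1 : ∫ x, fderiv ℝ g x (Y x)
      = ∑ i, ∫ x, Y x i * fderiv ℝ g x (EuclideanSpace.single i 1) := by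
    rw [← integral_finsetSum _ fun i _ =>
      integrable_mul_fderiv_of_compact (lipschitzWith_coord hY i).continuous hg hgc _]
    exact integral_congr_ae (.of_forall fun x => clm_apply_eq_sum_mul _ _)
  have h2 : ∫ x, divergence Y x * g x
      = ∑ i, ∫ x, fderiv ℝ (fun y => Y y i) x (EuclideanSpace.single i 1) * g x := by
    rw [← integral_finsetSum _ fun i _ =>
      integrable_fderiv_mul_of_compact (lipschitzWith_coord hY i) hg.continuous hgc _]
    refine integral_congr_ae ?_
    filter_upwards [hY.ae_differentiableAt (μ := volume)] with x hx
    simp only [divergence, fderiv_coord hx, Finset.sum_mul]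
  rw [h1, h2, ← Finset.sum_neg_distrib]
  exact Finset.sum_congr rfl fun i _ =>
    integral_mul_fderiv_of_lipschitz (lipschitzWith_coord hY i) hg hgc _

lemma LipschitzWith.exists_mul {f g : Rd d → ℝ} {L M : NNReal} {K : ℝ} (hf : LipschitzWith L f)
    (hg : LipschitzWith M g) (hfb : ∀ x, |f x| ≤ K) (hgb : ∀ x, |g x| ≤ K) :
    LipschitzWith (K.toNNReal * (L + M)) (fun x => f x * g x) := by
  have hK : 0 ≤ K := (abs_nonneg _).trans (hfb 0)
  refine LipschitzWith.of_dist_le_mul fun x y => ?_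
  rw [Real.dist_eq]
  have e : f x * g x - f y * g y = f x * (g x - g y) + (f x - f y) * g y := by ring
  have h1 := hf.dist_le_mul x y
  have h2 := hg.dist_le_mul x y
  rw [Real.dist_eq] at h1 h2
  rw [e]
  calc |f x * (g x - g y) + (f x - f y) * g y|
      ≤ |f x| * |g x - g y| + |f x - f y| * |g y| := by
        refine (abs_add_le _ _).trans ?_
        rw [abs_mul, abs_mul]
    _ ≤ K * (M * dist x y) + (L * dist x y) * K := by
        gcongr
        exacts [hfb x, hgb y]
    _ = _ := by
        simp only [NNReal.coe_mul, NNReal.coe_add, Real.coe_toNNReal K hK]; ring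

lemma abs_coord_le (y : Rd d) (i : Fin d) : |y i| ≤ ‖y‖ := PiLp.norm_apply_le y i

lemma fderiv_mul_coord {B ξ : Rd d → Rd d} {x : Rd d} (hB : DifferentiableAt ℝ B x)
    (hξ : DifferentiableAt ℝ ξ x) (i j : Fin d) (v : Rd d) :
    fderiv ℝ (fun y => B y j * ξ y i) x v
      = B x j * (fderiv ℝ ξ x v) i + ξ x i * (fderiv ℝ B x v) j := by
  have h1 : DifferentiableAt ℝ (fun y => B y j) x :=
    (EuclideanSpace.proj (𝕜 := ℝ) j).differentiableAt.comp x hB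
  have h2 : DifferentiableAt ℝ (fun y => ξ y i) x :=
    (EuclideanSpace.proj (𝕜 := ℝ) i).differentiableAt.comp x hξ
  rw [fderiv_fun_mul h1 h2]
  simp only [_root_.add_apply, _root_.smul_apply, smul_eq_mul]
  rw [fderiv_coord hB, fderiv_coord hξ]

/-- The distributional identity `∇ · (∇ · (B ⊗ ξ - ξ ⊗ B)) = 0`. -/
lemma integral_fderiv_commutator_of_compact {g : Rd d → ℝ} {B ξ : Rd d → Rd d} {L L' M : NNReal}
    {K : ℝ} (hB : LipschitzWith L B) (hξ : LipschitzWith L' ξ) (hBK : ∀ x, ‖B x‖ ≤ K)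
    (hξK : ∀ x, ‖ξ x‖ ≤ K) (hg : LipschitzWith M g) (hgc : HasCompactSupport g) :
    ∫ x, fderiv ℝ g x (fderiv ℝ ξ x (B x) + divergence B x • ξ x
      - fderiv ℝ B x (ξ x) - divergence ξ x • B x) = 0 := by
  let e : Fin d → Rd d := fun i => EuclideanSpace.single i 1
  -- The field has `i`-th component `∑ⱼ (∂ⱼ(Bⱼ ξᵢ) − ∂ⱼ(Bᵢ ξⱼ))`. After relabelling the second sum,
  -- each pair `(i, j)` contributes `∂ⱼA ∂ᵢg − ∂ᵢA ∂ⱼg` with `A = Bⱼ ξᵢ`, whose integral vanishes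
  -- because weak derivatives commute.
  let A : Fin d → Fin d → Rd d → ℝ := fun j i x => B x j * ξ x i
  have hA : ∀ j i, LipschitzWith (K.toNNReal * (L + L')) (A j i) := fun j i =>
    (lipschitzWith_coord hB j).exists_mul (lipschitzWith_coord hξ i)
      (fun x => (abs_coord_le _ _).trans (hBK x)) (fun x => (abs_coord_le _ _).trans (hξK x))
  have hint : ∀ j i k l, Integrable (fun x => fderiv ℝ (A j i) x (e k) * fderiv ℝ g x (e l)) := by
    intro j i k l
    refine integrable_of_bounded_of_compact hgc.isCompact
      ((measurable_fderiv_apply_const ℝ _ _).mul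
        (measurable_fderiv_apply_const ℝ _ _)).aestronglyMeasurable
      (((K.toNNReal * (L + L') : NNReal) * ‖e k‖) * (M * ‖e l‖))
      (.of_forall fun x _ => ?_) fun x hx => ?_
    · rw [norm_mul]
      exact mul_le_mul ((ContinuousLinearMap.le_opNorm _ _).trans
        (mul_le_mul_of_nonneg_right (norm_fderiv_le_of_lipschitz ℝ (hA j i)) (norm_nonneg _)))
        ((ContinuousLinearMap.le_opNorm _ _).trans
        (mul_le_mul_of_nonneg_right (norm_fderiv_le_of_lipschitz ℝ hg) (norm_nonneg _)))
        (norm_nonneg _) (by positivity)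
    · rw [fderiv_eq_zero_of_notMem_tsupport hx]; simp
  have h1 : ∫ x, fderiv ℝ g x (fderiv ℝ ξ x (B x) + divergence B x • ξ x
      - fderiv ℝ B x (ξ x) - divergence ξ x • B x)
      = ∫ x, ∑ i, ∑ j, (fderiv ℝ (A j i) x (e j) * fderiv ℝ g x (e i)
        - fderiv ℝ (A j i) x (e i) * fderiv ℝ g x (e j)) := by
    refine integral_congr_ae ?_
    filter_upwards [hB.ae_differentiableAt (μ := volume),
      hξ.ae_differentiableAt (μ := volume)] with x hx1 hx2
    simp only [A, fderiv_mul_coord hx1 hx2]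
    simp only [Finset.sum_sub_distrib]
    rw [Finset.sum_comm (f := fun i j => (B x j * (fderiv ℝ ξ x (e i)) i +
      ξ x i * (fderiv ℝ B x (e i)) j) * fderiv ℝ g x (e j))]
    rw [← Finset.sum_sub_distrib, clm_apply_eq_sum_mul]
    refine Finset.sum_congr rfl fun i _ => ?_
    rw [← Finset.sum_mul, ← Finset.sum_mul, ← sub_mul]
    congr 1
    rw [clm_apply_eq_sum (fderiv ℝ ξ x) (B x), clm_apply_eq_sum (fderiv ℝ B x) (ξ x)]
    simp only [divergence, PiLp.sub_apply, PiLp.add_apply, PiLp.smul_apply, smul_eq_mul,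
      WithLp.ofLp_sum, Finset.sum_apply, Finset.sum_mul, e]
    rw [← Finset.sum_add_distrib, ← Finset.sum_sub_distrib, ← Finset.sum_sub_distrib,
      ← Finset.sum_sub_distrib]
    refine Finset.sum_congr rfl fun j _ => ?_
    ring
  have hsub : ∀ i j, Integrable (fun x => fderiv ℝ (A j i) x (e j) * fderiv ℝ g x (e i)
        - fderiv ℝ (A j i) x (e i) * fderiv ℝ g x (e j)) := fun i j =>
    (hint j i j i).sub (hint j i i j)
  rw [h1, integral_finsetSum _ fun i _ => integrable_finsetSum _ fun j _ => hsub i j]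
  refine Finset.sum_eq_zero fun i _ => ?_
  rw [integral_finsetSum _ fun j _ => hsub i j]
  refine Finset.sum_eq_zero fun j _ => ?_
  rw [integral_sub (hint j i j i) (hint j i i j), sub_eq_zero]
  exact integral_fderiv_mul_fderiv_comm (hA j i) hg hgc _ _

/-- A first order identity that holds weakly holds for integrable functions of class `C¹`. -/
lemma integral_fderiv_add_eq_zero {Z : Rd d → Rd d} {s : Rd d → ℝ} {K : ℝ}
    (hZm : AEStronglyMeasurable Z) (hZ : ∀ x, ‖Z x‖ ≤ K) (hsm : AEStronglyMeasurable s)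
    (hs : ∀ x, |s x| ≤ K)
    (h : ∀ (g : Rd d → ℝ) (M : NNReal), LipschitzWith M g → HasCompactSupport g →
      ∫ x, (fderiv ℝ g x (Z x) + s x * g x) = 0)
    {g : Rd d → ℝ} (hg : ContDiff ℝ 1 g) (hgi : Integrable g) (hg' : Integrable (fderiv ℝ g)) :
    ∫ x, (fderiv ℝ g x (Z x) + s x * g x) = 0 := by
  obtain ⟨η, C, hη⟩ := exists_cutoffSeq d
  have i1 : Integrable (fun x => fderiv ℝ g x (Z x)) := by
    refine (hg'.norm.const_mul K).mono' (isBoundedBilinearMap_apply.continuous.comp_aestronglyMeasurable₂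
      hg'.aestronglyMeasurable hZm) (.of_forall fun x => ?_)
    rw [mul_comm]
    exact ((fderiv ℝ g x).le_opNorm _).trans (mul_le_mul_of_nonneg_left (hZ x) (norm_nonneg _))
  have i2 : Integrable (fun x => s x * g x) := by
    refine (hgi.norm.const_mul K).mono' (hsm.mul hgi.aestronglyMeasurable)
      (.of_forall fun x => ?_)
    rw [norm_mul]
    exact mul_le_mul_of_nonneg_right (hs x) (norm_nonneg _)
  have i3 : Integrable (fun x => g x • Z x) := by
    refine (hgi.norm.const_mul K).mono' (hgi.aestronglyMeasurable.smul hZm)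
      (.of_forall fun x => ?_)
    rw [norm_smul, mul_comm]
    exact mul_le_mul_of_nonneg_right (hZ x) (norm_nonneg _)
  -- Testing with `η g` produces `η (Z·∇g + s g)` plus the extra term `g Z·∇η`, which vanishes in
  -- the limit.
  have t := (hη.tendsto_integral_mul (i1.add i2)).add (hη.tendsto_integral_fderiv i3)
  rw [add_zero] at t
  refine tendsto_nhds_unique t (tendsto_const_nhds.congr fun n => ?_)
  have hc : ContDiff ℝ 1 (fun x => η n x * g x) := ((hη.contDiff n).of_le (by norm_num)).mul hg
  have hcc : HasCompactSupport (fun x => η n x * g x) := (hη.compact n).mul_right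
  obtain ⟨M, hM⟩ := hc.lipschitzWith_of_hasCompactSupport hcc (by norm_num)
  have j1 : Integrable (fun x => η n x * (fderiv ℝ g x (Z x) + s x * g x)) :=
    (i1.add i2).bdd_mul (c := 1) (hη.continuous n).aestronglyMeasurable
      (.of_forall fun x => hη.abs_le_one n x)
  have j2 : Integrable (fun x => fderiv ℝ (η n) x (g x • Z x)) := by
    refine (i3.norm.const_mul C).mono' (isBoundedBilinearMap_apply.continuous.comp_aestronglyMeasurable₂
      (hη.continuous_fderiv n).aestronglyMeasurable i3.aestronglyMeasurable)
      (.of_forall fun x => ?_)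
    exact ((fderiv ℝ (η n) x).le_opNorm _).trans
      (mul_le_mul_of_nonneg_right (hη.norm_fderiv_le n x) (norm_nonneg _))
  rw [← h _ M hM hcc]
  refine (integral_congr_ae (.of_forall fun x => ?_)).trans (integral_add j1 j2)
  rw [hη.fderiv_mul_apply n (hg.differentiable (by norm_num) x)]
  simp only [map_smul, smul_eq_mul, Pi.add_apply]
  ring

/-- Decay is carried by `g` alone, so fields that are merely bounded and Lipschitz are allowed. It
is applied to `g = ψ` and the fields `B`, `ξ`, `θB` and `arctanField`. -/
lemma integral_fderiv_apply_eq_neg_divergence {g : Rd d → ℝ} {Y : Rd d → Rd d} {L : NNReal} {K : ℝ}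
    (hY : LipschitzWith L Y) (hYK : ∀ x, ‖Y x‖ ≤ K) (hg : ContDiff ℝ 1 g) (hgi : Integrable g)
    (hg' : Integrable (fderiv ℝ g)) :
    ∫ x, fderiv ℝ g x (Y x) = -∫ x, divergence Y x * g x := by
  have hb : ∀ x, ‖Y x‖ ≤ max K (d * L) := fun x => (hYK x).trans (le_max_left _ _)
  have hdb : ∀ x, |divergence Y x| ≤ max K (d * L) := fun x =>
    (abs_divergence_le hY x).trans (le_max_right _ _)
  have i1 : ∀ g : Rd d → ℝ, Integrable (fderiv ℝ g) → Integrable (fun x => fderiv ℝ g x (Y x)) := by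
    intro g hg'
    refine (hg'.norm.const_mul K).mono' (isBoundedBilinearMap_apply.continuous.comp_aestronglyMeasurable₂
      hg'.aestronglyMeasurable hY.continuous.aestronglyMeasurable) (.of_forall fun x => ?_)
    rw [mul_comm]
    exact ((fderiv ℝ g x).le_opNorm _).trans (mul_le_mul_of_nonneg_left (hYK x) (norm_nonneg _))
  have i2 : ∀ g : Rd d → ℝ, Integrable g → Integrable (fun x => divergence Y x * g x) := fun g hgi =>
    hgi.bdd_mul (c := max K (d * L)) (measurable_divergence Y).aestronglyMeasurable
      (.of_forall hdb)
  have := integral_fderiv_add_eq_zero hY.continuous.aestronglyMeasurable hb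
    (measurable_divergence Y).aestronglyMeasurable hdb (fun g M hgM hgc => ?_) hg hgi hg'
  · rw [integral_add (i1 g hg') (i2 g hgi)] at this
    linarith
  · have hfi : Integrable (fderiv ℝ g) :=
      integrable_of_bounded_of_compact hgc.isCompact (measurable_fderiv ℝ g).aestronglyMeasurable
        M (.of_forall fun x _ => norm_fderiv_le_of_lipschitz ℝ hgM)
        fun x hx => fderiv_eq_zero_of_notMem_tsupport hx
    rw [integral_add (i1 g hfi) (i2 g (hgM.continuous.integrable_of_hasCompactSupport hgc)),
      integral_fderiv_apply_of_compact hY hgM hgc]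
    ring

lemma measurable_fderiv_apply_field {Y : Rd d → Rd d} {F : Rd d → Rd d} (hF : Measurable F) :
    Measurable (fun x => fderiv ℝ Y x (F x)) :=
  isBoundedBilinearMap_apply.continuous.measurable.comp ((measurable_fderiv ℝ Y).prodMk hF)

lemma integral_fderiv_commutator {g : Rd d → ℝ} {B ξ : Rd d → Rd d} {L L' : NNReal}
    {K : ℝ} (hB : LipschitzWith L B) (hξ : LipschitzWith L' ξ) (hBK : ∀ x, ‖B x‖ ≤ K)
    (hξK : ∀ x, ‖ξ x‖ ≤ K) (hg : ContDiff ℝ 1 g) (hgi : Integrable g)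
    (hg' : Integrable (fderiv ℝ g)) :
    ∫ x, fderiv ℝ g x (fderiv ℝ ξ x (B x) + divergence B x • ξ x
      - fderiv ℝ B x (ξ x) - divergence ξ x • B x) = 0 := by
  have hK : 0 ≤ K := (norm_nonneg _).trans (hBK 0)
  have := integral_fderiv_add_eq_zero (Z := fun x => fderiv ℝ ξ x (B x) + divergence B x • ξ x
      - fderiv ℝ B x (ξ x) - divergence ξ x • B x) (s := fun _ => 0)
      (K := L' * K + (d * L) * K + L * K + (d * L') * K) ?_ ?_
      aestronglyMeasurable_const (fun x => by rw [abs_zero]; positivity) ?_ hg hgi hg'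
  · simpa using this
  · exact ((((measurable_fderiv_apply_field hB.continuous.measurable).add
      ((measurable_divergence B).smul hξ.continuous.measurable)).sub
      (measurable_fderiv_apply_field hξ.continuous.measurable)).sub
      ((measurable_divergence ξ).smul hB.continuous.measurable)).aestronglyMeasurable
  · intro x
    have n1 : ‖fderiv ℝ ξ x (B x)‖ ≤ L' * K := ((fderiv ℝ ξ x).le_opNorm _).trans
      (mul_le_mul (norm_fderiv_le_of_lipschitz ℝ hξ) (hBK x) (norm_nonneg _) L'.2)
    have n2 : ‖fderiv ℝ B x (ξ x)‖ ≤ L * K := ((fderiv ℝ B x).le_opNorm _).trans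
      (mul_le_mul (norm_fderiv_le_of_lipschitz ℝ hB) (hξK x) (norm_nonneg _) L.2)
    have n3 : ‖divergence B x • ξ x‖ ≤ (d * L) * K := by
      rw [norm_smul]
      exact mul_le_mul (abs_divergence_le hB x) (hξK x) (norm_nonneg _) (by positivity)
    have n4 : ‖divergence ξ x • B x‖ ≤ (d * L') * K := by
      rw [norm_smul]
      exact mul_le_mul (abs_divergence_le hξ x) (hBK x) (norm_nonneg _) (by positivity)
    exact (norm_sub_le _ _).trans (add_le_add ((norm_sub_le _ _).trans
      (add_le_add ((norm_add_le _ _).trans (add_le_add n1 n3)) n2)) n4)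
  · intro g M hgM hgc
    simpa using integral_fderiv_commutator_of_compact hB hξ hBK hξK hgM hgc

/-! ### The energy-stress tensor -/

/-- Only values of `f` near the support of `g` matter; multiplying `f` by a smooth function equal to
1 there makes it globally Lipschitz. -/
lemma integral_mul_fderiv_of_contDiff {f g : Rd d → ℝ} {M : NNReal} (hf : ContDiff ℝ 1 f)
    (hg : LipschitzWith M g) (hgc : HasCompactSupport g) (v : Rd d) :
    ∫ x, f x * fderiv ℝ g x v = -∫ x, fderiv ℝ f x v * g x := by
  obtain ⟨χ, hχ, hχc, hχ1⟩ := exists_contDiff_one_on_compact hgc.isCompact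
  have hc : ContDiff ℝ 1 (fun x => χ x * f x) := (hχ.of_le (by norm_num)).mul hf
  obtain ⟨L, hL⟩ := hc.lipschitzWith_of_hasCompactSupport hχc.mul_right (by norm_num)
  have h := integral_mul_fderiv_of_lipschitz hL hg hgc v
  have e1 : ∫ x, f x * fderiv ℝ g x v = ∫ x, χ x * f x * fderiv ℝ g x v := by
    refine integral_congr_ae (.of_forall fun x => ?_)
    by_cases hx : x ∈ tsupport g
    · simp only [(hχ1 x hx).self_of_nhds, one_mul]
    · simp [fderiv_eq_zero_of_notMem_tsupport hx]
  have e2 : ∫ x, fderiv ℝ f x v * g x = ∫ x, fderiv ℝ (fun x => χ x * f x) x v * g x := by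
    refine integral_congr_ae (.of_forall fun x => ?_)
    by_cases hx : x ∈ tsupport g
    · have : (fun x => χ x * f x) =ᶠ[𝓝 x] f := by
        filter_upwards [hχ1 x hx] with y hy
        rw [hy, one_mul]
      simp only [this.fderiv_eq]
    · simp [image_eq_zero_of_notMem_tsupport hx]
  rw [e1, e2]
  exact h

lemma hasCompactSupport_coord {b : Rd d → Rd d} (hb : HasCompactSupport b) (i : Fin d) :
    HasCompactSupport (fun x => b x i) :=
  hb.comp_left (g := fun y : Rd d => y i) rfl

lemma integrable_mul_of_compact {f g : Rd d → ℝ} (hf : Continuous f) (hg : Continuous g)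
    (hgc : HasCompactSupport g) : Integrable (fun x => f x * g x) :=
  (hf.mul hg).integrable_of_hasCompactSupport hgc.mul_left

lemma integral_fderiv_apply_of_compact_field {f : Rd d → ℝ} {Y : Rd d → Rd d} {L : NNReal}
    (hf : ContDiff ℝ 1 f) (hY : LipschitzWith L Y) (hYc : HasCompactSupport Y) :
    ∫ x, fderiv ℝ f x (Y x) = -∫ x, f x * divergence Y x := by
  have hf' := hf.continuous_fderiv (by norm_num)
  have h1 : ∫ x, fderiv ℝ f x (Y x)
      = ∑ i, ∫ x, fderiv ℝ f x (EuclideanSpace.single i 1) * Y x i := by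
    rw [← integral_finsetSum _ fun i _ => integrable_mul_of_compact (by fun_prop)
      (lipschitzWith_coord hY i).continuous (hasCompactSupport_coord hYc i)]
    refine integral_congr_ae (.of_forall fun x => ?_)
    simp only [clm_apply_eq_sum_mul _ (Y x), mul_comm]
  have h2 : ∫ x, f x * divergence Y x
      = ∑ i, ∫ x, f x * fderiv ℝ (fun y => Y y i) x (EuclideanSpace.single i 1) := by
    rw [← integral_finsetSum _ fun i _ => integrable_mul_fderiv_of_compact hf.continuous
      (lipschitzWith_coord hY i) (hasCompactSupport_coord hYc i) _]
    refine integral_congr_ae ?_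
    filter_upwards [hY.ae_differentiableAt (μ := volume)] with x hx
    simp only [divergence, fderiv_coord hx, Finset.mul_sum]
  rw [h1, h2, ← Finset.sum_neg_distrib]
  refine Finset.sum_congr rfl fun i _ => ?_
  rw [integral_mul_fderiv_of_contDiff hf (lipschitzWith_coord hY i)
    (hasCompactSupport_coord hYc i), neg_neg]

lemma gradient_coord (v : Rd d → ℝ) (x : Rd d) (i : Fin d) :
    gradient v x i = fderiv ℝ v x (EuclideanSpace.single i 1) := by
  rw [← inner_gradient_left, EuclideanSpace.inner_single_right]
  simp

lemma norm_gradient (v : Rd d → ℝ) (x : Rd d) : ‖gradient v x‖ = ‖fderiv ℝ v x‖ := by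
  rw [← toDual_gradient, LinearIsometryEquiv.norm_map]

lemma norm_gradient_sq (v : Rd d → ℝ) (x : Rd d) :
    ‖gradient v x‖ ^ 2 = ∑ i, fderiv ℝ v x (EuclideanSpace.single i 1) ^ 2 := by
  rw [EuclideanSpace.norm_sq_eq]
  simp [gradient_coord]

lemma laplacian_eq_sum (v : Rd d → ℝ) (x : Rd d) :
    Laplacian.laplacian v x = ∑ i, fderiv ℝ (fderiv ℝ v) x (EuclideanSpace.single i 1)
      (EuclideanSpace.single i 1) := by
  rw [InnerProductSpace.laplacian_eq_iteratedFDeriv_orthonormalBasis v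
    (EuclideanSpace.basisFun (Fin d) ℝ)]
  simp [iteratedFDeriv_two_apply]

lemma contDiff_partial {v : Rd d → ℝ} (hv : ContDiff ℝ 2 v) (w : Rd d) :
    ContDiff ℝ 1 (fun x => fderiv ℝ v x w) :=
  (hv.fderiv_right (m := 1) (by norm_num)).clm_apply contDiff_const

lemma fderiv_partial {v : Rd d → ℝ} (hv : ContDiff ℝ 2 v) (x w z : Rd d) :
    fderiv ℝ (fun x => fderiv ℝ v x w) x z = fderiv ℝ (fderiv ℝ v) x z w := by
  have : DifferentiableAt ℝ (fderiv ℝ v) x :=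
    (hv.fderiv_right (m := 1) (by norm_num)).differentiable (by norm_num) x
  rw [fderiv_clm_apply this (differentiableAt_const w)]
  simp

lemma fderiv_partial_comm {v : Rd d → ℝ} (hv : ContDiff ℝ 2 v) (x w z : Rd d) :
    fderiv ℝ (fderiv ℝ v) x z w = fderiv ℝ (fderiv ℝ v) x w z :=
  ((hv.contDiffAt).isSymmSndFDerivAt (by simp)).eq z w

/-- Reason: `∂ᵢv Δv = ∑ⱼ ∂ⱼ(∂ᵢv ∂ⱼv) − ½ ∂ᵢ|∇v|²`, integrated by parts against `bᵢ`. Only products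
of first derivatives are differentiated, so `C²` suffices. -/
lemma integral_laplacian_mul_fderiv {v : Rd d → ℝ} {b : Rd d → Rd d} {L : NNReal}
    (hv : ContDiff ℝ 2 v) (hb : LipschitzWith L b) (hbc : HasCompactSupport b) :
    ∫ x, Laplacian.laplacian v x * fderiv ℝ v x (b x)
      = ∫ x, (1 / 2 * ‖gradient v x‖ ^ 2 * divergence b x
          - fderiv ℝ v x (fderiv ℝ b x (gradient v x))) := by
  let e : Fin d → Rd d := fun i => EuclideanSpace.single i 1
  let p : Fin d → Rd d → ℝ := fun i x => fderiv ℝ v x (e i)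
  have hp : ∀ i, ContDiff ℝ 1 (p i) := fun i => contDiff_partial hv _
  have hpc : ∀ i, Continuous (p i) := fun i => (hp i).continuous
  have hp' : ∀ i j, Continuous (fun x => fderiv ℝ (p i) x (e j)) := fun i j =>
    ((hp i).continuous_fderiv (by norm_num)).clm_apply continuous_const
  have hbl := fun i => lipschitzWith_coord hb i
  have hbcc := fun i => hasCompactSupport_coord hbc i
  have hpp : ∀ i j, ContDiff ℝ 1 (fun x => p i x * p j x) := fun i j => (hp i).mul (hp j)
  have hdp : ∀ i j k x, fderiv ℝ (fun x => p i x * p j x) x (e k)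
      = p i x * fderiv ℝ (p j) x (e k) + p j x * fderiv ℝ (p i) x (e k) := by
    intro i j k x
    rw [fderiv_fun_mul ((hp i).differentiable (by norm_num) x)
      ((hp j).differentiable (by norm_num) x)]
    simp
  have hcomm : ∀ i j x, fderiv ℝ (p i) x (e j) = fderiv ℝ (p j) x (e i) := by
    intro i j x
    simp only [p]
    rw [fderiv_partial hv, fderiv_partial hv, fderiv_partial_comm hv]
  -- the two integrations by parts
  have ibp : ∀ i j k l, ∫ x, p i x * p j x * fderiv ℝ (fun y => b y k) x (e l)
      = -∫ x, (p i x * fderiv ℝ (p j) x (e l) + p j x * fderiv ℝ (p i) x (e l)) * b x k := by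
    intro i j k l
    rw [integral_mul_fderiv_of_contDiff (hpp i j) (hbl k) (hbcc k)]
    simp_rw [hdp]
  have I1 : ∀ i j k l, Integrable fun x => p i x * p j x * fderiv ℝ (fun y => b y k) x (e l) :=
    fun i j k l => integrable_mul_fderiv_of_compact ((hpc i).mul (hpc j)) (hbl k) (hbcc k) _
  have I2 : ∀ i j k l, Integrable fun x =>
      (p i x * fderiv ℝ (p j) x (e l) + p j x * fderiv ℝ (p i) x (e l)) * b x k :=
    fun i j k l => integrable_mul_of_compact
      (((hpc i).mul (hp' j l)).add ((hpc j).mul (hp' i l))) (hbl k).continuous (hbcc k)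
  have I3 : ∀ i j, Integrable fun x =>
      1 / 2 * (p j x * p j x * fderiv ℝ (fun y => b y i) x (e i))
      - p i x * p j x * fderiv ℝ (fun y => b y i) x (e j) := fun i j =>
    ((I1 j j i i).const_mul _).sub (I1 i j i j)
  have I4 : ∀ i j, Integrable fun x => fderiv ℝ (p j) x (e j) * p i x * b x i := fun i j =>
    integrable_mul_of_compact ((hp' j j).mul (hpc i)) (hbl i).continuous (hbcc i)
  have lhs : ∫ x, Laplacian.laplacian v x * fderiv ℝ v x (b x)
      = ∑ i, ∑ j, ∫ x, fderiv ℝ (p j) x (e j) * p i x * b x i := by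
    simp_rw [← integral_finsetSum _ fun j _ => I4 _ j]
    rw [← integral_finsetSum _ fun i _ => integrable_finsetSum _ fun j _ => I4 i j]
    refine integral_congr_ae (.of_forall fun x => ?_)
    simp only [laplacian_eq_sum, clm_apply_eq_sum_mul _ (b x), Finset.sum_mul, Finset.mul_sum, p,
      fderiv_partial hv]
    refine Finset.sum_congr rfl fun i _ => Finset.sum_congr rfl fun j _ => ?_
    simp only [e]; ring
  have rhs : ∫ x, (1 / 2 * ‖gradient v x‖ ^ 2 * divergence b x
          - fderiv ℝ v x (fderiv ℝ b x (gradient v x)))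
      = ∑ i, ∑ j, ∫ x, (1 / 2 * (p j x * p j x * fderiv ℝ (fun y => b y i) x (e i))
      - p i x * p j x * fderiv ℝ (fun y => b y i) x (e j)) := by
    simp_rw [← integral_finsetSum _ fun j _ => I3 _ j]
    rw [← integral_finsetSum _ fun i _ => integrable_finsetSum _ fun j _ => I3 i j]
    refine integral_congr_ae ?_
    filter_upwards [hb.ae_differentiableAt (μ := volume)] with x hx
    simp only [fderiv_coord hx, norm_gradient_sq, divergence, Finset.sum_sub_distrib]
    congr 1
    · simp only [Finset.mul_sum, Finset.sum_mul]
      refine Finset.sum_congr rfl fun i _ => Finset.sum_congr rfl fun j _ => ?_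
      simp only [e, p]; ring
    · rw [clm_apply_eq_sum_mul _ (fderiv ℝ b x (gradient v x))]
      refine Finset.sum_congr rfl fun i _ => ?_
      rw [clm_apply_eq_sum (fderiv ℝ b x) (gradient v x)]
      simp only [WithLp.ofLp_sum, Finset.sum_apply, Finset.sum_mul, PiLp.smul_apply, smul_eq_mul,
        gradient_coord]
      refine Finset.sum_congr rfl fun j _ => ?_
      simp only [e, p]; ring
  rw [lhs, rhs]
  refine Finset.sum_congr rfl fun i _ => Finset.sum_congr rfl fun j _ => ?_
  rw [integral_sub ((I1 j j i i).const_mul _) (I1 i j i j), integral_const_mul, ibp, ibp,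
    mul_neg, ← integral_const_mul, sub_neg_eq_add, neg_add_eq_sub,
    ← integral_sub (I2 i j i j) ((I2 j j i i).const_mul _)]
  refine integral_congr_ae (.of_forall fun x => ?_)
  simp only [hcomm i j x]
  ring

lemma fderiv_comp_real {W : ℝ → ℝ} {v : Rd d → ℝ} {x : Rd d} (hW : DifferentiableAt ℝ W (v x))
    (hv : DifferentiableAt ℝ v x) : fderiv ℝ (fun y => W (v y)) x = deriv W (v x) • fderiv ℝ v x :=
  (hW.hasDerivAt.comp_hasFDerivAt x hv.hasFDerivAt).fderiv

lemma continuous_laplacian {v : Rd d → ℝ} (hv : ContDiff ℝ 2 v) :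
    Continuous (Laplacian.laplacian v) := by
  have : Laplacian.laplacian v = fun x => ∑ i, fderiv ℝ (fderiv ℝ v) x (EuclideanSpace.single i 1)
      (EuclideanSpace.single i 1) := funext (laplacian_eq_sum v)
  rw [this]
  have h := (hv.fderiv_right (m := 1) (by norm_num)).continuous_fderiv (by norm_num)
  fun_prop

lemma continuous_gradient {v : Rd d → ℝ} (hv : ContDiff ℝ 1 v) : Continuous (gradient v) :=
  (InnerProductSpace.toDual ℝ (Rd d)).symm.continuous.comp (hv.continuous_fderiv (by norm_num))

lemma continuous_localForce {W : ℝ → ℝ} (hW : ContDiff ℝ 1 W) {ε : ℝ} {v : Rd d → ℝ}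
    (hv : ContDiff ℝ 2 v) : Continuous (localForce W ε v) := by
  unfold localForce
  have h1 := continuous_laplacian hv
  have h2 := hW.continuous_deriv (by norm_num)
  have h3 := hv.continuous
  fun_prop

/-- The potential part of the force is a gradient, `W'(v)∇v = ∇(W(v))`; by parts it completes
`½|∇v|²` to the energy density in the isotropic part of the stress tensor. -/
lemma integral_localForce_of_compact {W : ℝ → ℝ} (hW : ContDiff ℝ 1 W) {ε : ℝ} (hε : 0 < ε)
    {v : Rd d → ℝ} {b : Rd d → Rd d} {L : NNReal}
    (hv : ContDiff ℝ 2 v) (hb : LipschitzWith L b) (hbc : HasCompactSupport b) :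
    ∫ x, ε * localForce W ε v x * fderiv ℝ v x (b x)
      = ∫ x, (energyDensity W ε v x * divergence b x
          - ε * fderiv ℝ v x (fderiv ℝ b x (gradient v x))) := by
  have hv1 : ContDiff ℝ 1 v := hv.of_le (by norm_num)
  have hWv : ContDiff ℝ 1 (fun x => W (v x)) := hW.comp hv1
  have h1 := integral_laplacian_mul_fderiv hv hb hbc
  have h2 := integral_fderiv_apply_of_compact_field hWv hb hbc
  have hfv := hv1.continuous_fderiv (by norm_num)
  have cb := hb.continuous
  have cs : HasCompactSupport (fun x => fderiv ℝ v x (b x)) := by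
    refine hbc.mono fun x hx => ?_
    simp only [Function.mem_support] at hx ⊢
    contrapose! hx; simp [hx]
  have i1 : Integrable fun x => Laplacian.laplacian v x * fderiv ℝ v x (b x) :=
    integrable_mul_of_compact (continuous_laplacian hv) (hfv.clm_apply cb) cs
  have i2 : Integrable fun x => fderiv ℝ (fun y => W (v y)) x (b x) := by
    refine ((hWv.continuous_fderiv (by norm_num)).clm_apply cb).integrable_of_hasCompactSupport ?_
    refine hbc.mono fun x hx => ?_
    simp only [Function.mem_support] at hx ⊢
    contrapose! hx; simp [hx]
  have hdiv : ∀ F : Rd d → ℝ, Continuous F → Integrable fun x => F x * divergence b x := by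
    intro F hF
    obtain ⟨C, hC⟩ := hbc.isCompact.exists_bound_of_continuousOn hF.continuousOn
    refine integrable_of_bounded_of_compact hbc.isCompact
      (hF.aestronglyMeasurable.mul (measurable_divergence b).aestronglyMeasurable) (C * (d * L))
      (.of_forall fun x hx => ?_) fun x hx => ?_
    · rw [norm_mul]
      exact mul_le_mul (hC x hx) (abs_divergence_le hb x) (norm_nonneg _)
        ((norm_nonneg _).trans (hC x hx))
    · have : fderiv ℝ b x = 0 := by
        by_contra h
        exact hx (support_fderiv_subset ℝ h)
      simp [divergence, this]
  have i3 : Integrable fun x => W (v x) * divergence b x := hdiv _ hWv.continuous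
  have cg := continuous_gradient hv1
  have i4 : Integrable fun x => 1 / 2 * ‖gradient v x‖ ^ 2 * divergence b x :=
    hdiv (fun x => 1 / 2 * ‖gradient v x‖ ^ 2) (by fun_prop)
  have i5 : Integrable fun x => fderiv ℝ v x (fderiv ℝ b x (gradient v x)) := by
    have cc : Continuous fun x => ‖fderiv ℝ v x‖ * ‖gradient v x‖ := by fun_prop
    obtain ⟨C, hC⟩ := hbc.isCompact.exists_bound_of_continuousOn cc.continuousOn
    refine integrable_of_bounded_of_compact hbc.isCompact
      (isBoundedBilinearMap_apply.continuous.comp_aestronglyMeasurable₂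
        hfv.aestronglyMeasurable (measurable_fderiv_apply_field cg.measurable).aestronglyMeasurable)
        (C * L) (.of_forall fun x hx => ?_) fun x hx => ?_
    · refine ((fderiv ℝ v x).le_opNorm _).trans ?_
      have := (mul_le_mul_of_nonneg_left ((fderiv ℝ b x).le_opNorm (gradient v x))
        (norm_nonneg (fderiv ℝ v x))).trans (mul_le_mul_of_nonneg_left
          (mul_le_mul_of_nonneg_right (norm_fderiv_le_of_lipschitz ℝ hb) (norm_nonneg _))
          (norm_nonneg _))
      refine this.trans ?_
      have h' := hC x hx
      rw [Real.norm_of_nonneg (by positivity)] at h'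
      nlinarith [mul_le_mul_of_nonneg_right h' L.2]
    · have : fderiv ℝ b x = 0 := by
        by_contra h
        exact hx (support_fderiv_subset ℝ h)
      simp [this]
  have e1 : ∫ x, ε * localForce W ε v x * fderiv ℝ v x (b x)
      = ε * (∫ x, Laplacian.laplacian v x * fderiv ℝ v x (b x))
        - 1 / ε * ∫ x, fderiv ℝ (fun y => W (v y)) x (b x) := by
    rw [← integral_const_mul, ← integral_const_mul,
      ← integral_sub (i1.const_mul _) (i2.const_mul _)]
    refine integral_congr_ae (.of_forall fun x => ?_)
    simp only [localForce]
    rw [fderiv_comp_real ((hW.differentiable (by norm_num)) _)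
      ((hv1.differentiable (by norm_num)) x)]
    simp only [_root_.smul_apply, smul_eq_mul]
    field_simp
  have i45 : Integrable fun x => 1 / 2 * ‖gradient v x‖ ^ 2 * divergence b x
      - fderiv ℝ v x (fderiv ℝ b x (gradient v x)) := i4.sub i5
  rw [e1, h1, h2, mul_neg, sub_neg_eq_add, ← integral_const_mul, ← integral_const_mul,
    ← integral_add (i45.const_mul _) (i3.const_mul _)]
  refine integral_congr_ae (.of_forall fun x => ?_)
  simp only [energyDensity]
  ring

lemma LipschitzWith.smul_of_bounded {η : Rd d → ℝ} {B : Rd d → Rd d} {L M : NNReal} {K : ℝ}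
    (hη : LipschitzWith M η) (hB : LipschitzWith L B) (h1 : ∀ x, |η x| ≤ 1)
    (hBK : ∀ x, ‖B x‖ ≤ K) : LipschitzWith (L + M * K.toNNReal) (fun x => η x • B x) := by
  have hK : 0 ≤ K := (norm_nonneg _).trans (hBK 0)
  refine LipschitzWith.of_dist_le_mul fun x y => ?_
  have e : η x • B x - η y • B y = η x • (B x - B y) + (η x - η y) • B y := by module
  have h2 := hη.dist_le_mul x y
  have h3 := hB.dist_le_mul x y
  rw [dist_eq_norm] at h2 h3
  rw [dist_eq_norm, e]
  calc ‖η x • (B x - B y) + (η x - η y) • B y‖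
      ≤ |η x| * ‖B x - B y‖ + ‖η x - η y‖ * ‖B y‖ := by
        refine (norm_add_le _ _).trans ?_
        rw [norm_smul, norm_smul, Real.norm_eq_abs (η x)]
    _ ≤ 1 * (L * dist x y) + (M * dist x y) * K := by
        gcongr
        exacts [h1 x, hBK y]
    _ = _ := by
        simp only [NNReal.coe_mul, NNReal.coe_add, Real.coe_toNNReal K hK]; ring

lemma memLp_gradient {v : Rd d → ℝ} (hv : ContDiff ℝ 1 v)
    (hg : Integrable (fun x => ‖gradient v x‖ ^ 2)) : MemLp (gradient v) 2 :=
  (memLp_two_iff_integrable_sq_norm (continuous_gradient hv).aestronglyMeasurable).2 hg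

lemma MemLp.integrable_mul_fderiv {f v : Rd d → ℝ} {B : Rd d → Rd d} {K : ℝ} (hf : MemLp f 2)
    (hv : ContDiff ℝ 1 v) (hg : Integrable (fun x => ‖gradient v x‖ ^ 2))
    (hB : Continuous B) (hBK : ∀ x, ‖B x‖ ≤ K) :
    Integrable (fun x => f x * fderiv ℝ v x (B x)) := by
  have h1 : Integrable (fun x => ‖f x‖ * ‖gradient v x‖) :=
    hf.norm.integrable_mul (memLp_gradient hv hg).norm
  refine (h1.mul_const K).mono' (hf.aestronglyMeasurable.mul
    ((hv.continuous_fderiv (by norm_num)).clm_apply hB).aestronglyMeasurable)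
    (.of_forall fun x => ?_)
  rw [norm_mul, mul_assoc, norm_gradient]
  exact mul_le_mul_of_nonneg_left (((fderiv ℝ v x).le_opNorm _).trans
    (mul_le_mul_of_nonneg_left (hBK x) (norm_nonneg _))) (norm_nonneg _)

lemma integrable_fderiv_fderiv_gradient {v : Rd d → ℝ} {B : Rd d → Rd d} {L : NNReal}
    (hv : ContDiff ℝ 1 v) (hg : Integrable (fun x => ‖gradient v x‖ ^ 2))
    (hB : LipschitzWith L B) :
    Integrable (fun x => fderiv ℝ v x (fderiv ℝ B x (gradient v x))) := by
  refine (hg.const_mul (L : ℝ)).mono' (isBoundedBilinearMap_apply.continuous.comp_aestronglyMeasurable₂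
    (hv.continuous_fderiv (by norm_num)).aestronglyMeasurable
    (measurable_fderiv_apply_field (continuous_gradient hv).measurable).aestronglyMeasurable)
    (.of_forall fun x => ?_)
  refine ((fderiv ℝ v x).le_opNorm _).trans ?_
  rw [← norm_gradient]
  have := ((fderiv ℝ B x).le_opNorm (gradient v x)).trans
    (mul_le_mul_of_nonneg_right (norm_fderiv_le_of_lipschitz ℝ hB) (norm_nonneg _))
  nlinarith [mul_le_mul_of_nonneg_left this (norm_nonneg (gradient v x))]

lemma integrable_energyDensity {W : ℝ → ℝ} {ε : ℝ} {v : Rd d → ℝ}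
    (hg : Integrable (fun x => ‖gradient v x‖ ^ 2)) (hW : Integrable (fun x => W (v x))) :
    Integrable (energyDensity W ε v) := (hg.const_mul _).add (hW.const_mul _)

/-- Testing the force with a Lipschitz vector field gives the energy-stress tensor. -/
lemma integral_localForce_mul_fderiv {W : ℝ → ℝ} (hW : ContDiff ℝ 1 W) {ε : ℝ} (hε : 0 < ε)
    {v : Rd d → ℝ} {B : Rd d → Rd d} {L : NNReal} {K : ℝ}
    (hv : ContDiff ℝ 2 v) (hB : LipschitzWith L B) (hBK : ∀ x, ‖B x‖ ≤ K)
    (hg : Integrable (fun x => ‖gradient v x‖ ^ 2)) (hp : Integrable (fun x => W (v x)))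
    (hf : MemLp (localForce W ε v) 2) :
    ∫ x, ε * localForce W ε v x * fderiv ℝ v x (B x)
      = ∫ x, (energyDensity W ε v x * divergence B x
          - ε * fderiv ℝ v x (fderiv ℝ B x (gradient v x))) := by
  obtain ⟨η, C, hη⟩ := exists_cutoffSeq d
  have hv1 : ContDiff ℝ 1 v := hv.of_le (by norm_num)
  have ie := integrable_energyDensity (ε := ε) hg hp
  have i1 : Integrable (fun x => ε * localForce W ε v x * fderiv ℝ v x (B x)) := by
    refine ((MemLp.integrable_mul_fderiv hf hv1 hg hB.continuous hBK).const_mul ε).congr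
      (.of_forall fun x => ?_)
    simp only; ring
  have i2 : Integrable (fun x => energyDensity W ε v x * divergence B x) :=
    ie.mul_bdd (c := d * L) (measurable_divergence B).aestronglyMeasurable
      (.of_forall fun x => abs_divergence_le hB x)
  have i3 := integrable_fderiv_fderiv_gradient hv1 hg hB
  have i4 : Integrable (fun x => energyDensity W ε v x * divergence B x
          - ε * fderiv ℝ v x (fderiv ℝ B x (gradient v x))) := i2.sub (i3.const_mul ε)
  have j1 : Integrable (fun x => energyDensity W ε v x • B x) := by
    refine (ie.norm.const_mul K).mono' (ie.aestronglyMeasurable.smul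
      hB.continuous.aestronglyMeasurable) (.of_forall fun x => ?_)
    rw [norm_smul, mul_comm]
    exact mul_le_mul_of_nonneg_right (hBK x) (norm_nonneg _)
  have j2 : Integrable (fun x => fderiv ℝ v x (B x) • gradient v x) := by
    refine (hg.const_mul K).mono' (((hv1.continuous_fderiv (by norm_num)).clm_apply
      hB.continuous).smul (continuous_gradient hv1)).aestronglyMeasurable (.of_forall fun x => ?_)
    rw [norm_smul, norm_gradient]
    have := ((fderiv ℝ v x).le_opNorm (B x)).trans
      (mul_le_mul_of_nonneg_left (hBK x) (norm_nonneg _))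
    nlinarith [mul_le_mul_of_nonneg_right this (norm_nonneg (fderiv ℝ v x))]
  -- This is the stress tensor applied to `B`, the field that gets paired with `∇η` when the
  -- compactly supported identity is used for `η B`. Its integrability makes that pairing vanish in
  -- the limit.
  have j3 : Integrable (fun x => energyDensity W ε v x • B x
      - ε • (fderiv ℝ v x (B x) • gradient v x)) := j1.sub (j2.smul ε)
  have t1 := hη.tendsto_integral_mul i1
  have t2 := (hη.tendsto_integral_mul i4).add (hη.tendsto_integral_fderiv j3)
  rw [add_zero] at t2
  refine tendsto_nhds_unique t1 (t2.congr fun n => ?_)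
  obtain ⟨M, hM⟩ := hη.lipschitz n
  have hb := LipschitzWith.smul_of_bounded hM hB (hη.abs_le_one n) hBK
  have h := integral_localForce_of_compact hW hε hv hb (hη.compact n).smul_right
  have k1 : Integrable (fun x => η n x * (energyDensity W ε v x * divergence B x
          - ε * fderiv ℝ v x (fderiv ℝ B x (gradient v x)))) :=
    i4.bdd_mul (c := 1) (hη.continuous n).aestronglyMeasurable
      (.of_forall fun x => hη.abs_le_one n x)
  have k2 : Integrable (fun x => fderiv ℝ (η n) x (energyDensity W ε v x • B x
      - ε • (fderiv ℝ v x (B x) • gradient v x))) := by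
    refine (j3.norm.const_mul C).mono' (isBoundedBilinearMap_apply.continuous.comp_aestronglyMeasurable₂
      (hη.continuous_fderiv n).aestronglyMeasurable j3.aestronglyMeasurable)
      (.of_forall fun x => ?_)
    exact ((fderiv ℝ (η n) x).le_opNorm _).trans
      (mul_le_mul_of_nonneg_right (hη.norm_fderiv_le n x) (norm_nonneg _))
  rw [← integral_add k1 k2]
  refine Eq.trans ?_ (h.symm.trans ?_)
  · refine integral_congr_ae ?_
    filter_upwards [hB.ae_differentiableAt (μ := volume)] with x hx
    have hD : fderiv ℝ (fun y => η n y • B y) x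
        = η n x • fderiv ℝ B x + (fderiv ℝ (η n) x).smulRight (B x) :=
      fderiv_fun_smul (hη.differentiable n x) hx
    have hdiv : divergence (fun y => η n y • B y) x
        = η n x * divergence B x + fderiv ℝ (η n) x (B x) := by
      simp only [divergence, hD, clm_apply_eq_sum_mul (fderiv ℝ (η n) x) (B x)]
      simp only [_root_.add_apply, _root_.smul_apply, ContinuousLinearMap.smulRight_apply,
        PiLp.add_apply, PiLp.smul_apply, smul_eq_mul, Finset.sum_add_distrib, Finset.mul_sum,
        mul_comm]
    rw [hdiv, hD]
    simp only [_root_.add_apply, _root_.smul_apply, ContinuousLinearMap.smulRight_apply,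
      map_add, map_sub, map_smul, smul_eq_mul]
    ring
  · refine integral_congr_ae (.of_forall fun x => ?_)
    simp only [map_smul, smul_eq_mul]
    ring

/-! ### The potential and the function `φ` -/

namespace IsDoubleWell

variable {W : ℝ → ℝ}

lemma continuous_sqrt (hW : IsDoubleWell W) : Continuous fun s => Real.sqrt (2 * W s) :=
  (continuous_const.mul hW.contDiff.continuous).sqrt

lemma hasDerivAt_phi (hW : IsDoubleWell W) (s : ℝ) :
    HasDerivAt (phi W) (Real.sqrt (2 * W s)) s :=
  intervalIntegral.integral_hasDerivAt_right (hW.continuous_sqrt.intervalIntegrable _ _)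
    (hW.continuous_sqrt.stronglyMeasurableAtFilter _ _) hW.continuous_sqrt.continuousAt

lemma contDiff_phi (hW : IsDoubleWell W) : ContDiff ℝ 1 (phi W) := by
  rw [contDiff_one_iff_deriv]
  refine ⟨fun s => (hW.hasDerivAt_phi s).differentiableAt, ?_⟩
  have : deriv (phi W) = fun s => Real.sqrt (2 * W s) := funext fun s => (hW.hasDerivAt_phi s).deriv
  rw [this]; exact hW.continuous_sqrt

lemma monotone_phi (hW : IsDoubleWell W) : Monotone (phi W) := by
  refine monotone_of_deriv_nonneg (fun s => (hW.hasDerivAt_phi s).differentiableAt) fun s => ?_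
  rw [(hW.hasDerivAt_phi s).deriv]; exact Real.sqrt_nonneg _

lemma phi_zero : phi W 0 = 0 := by simp [phi]

lemma phi_one (hW : IsDoubleWell W) : phi W 1 = 1 := hW.surfaceTension

lemma phi_mem_Icc (hW : IsDoubleWell W) {s : ℝ} (hs : s ∈ Icc (0:ℝ) 1) : phi W s ∈ Icc (0:ℝ) 1 :=
  ⟨phi_zero (W := W) ▸ hW.monotone_phi hs.1, hW.phi_one ▸ hW.monotone_phi hs.2⟩

lemma contDiff_psi (hW : IsDoubleWell W) {v : Rd d → ℝ} (hv : ContDiff ℝ 1 v) :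
    ContDiff ℝ 1 (psi W v) := hW.contDiff_phi.comp hv

lemma fderiv_psi (hW : IsDoubleWell W) {v : Rd d → ℝ} (hv : ContDiff ℝ 1 v) (x : Rd d) :
    fderiv ℝ (psi W v) x = Real.sqrt (2 * W (v x)) • fderiv ℝ v x := by
  have := fderiv_comp_real (hW.hasDerivAt_phi (v x)).differentiableAt
    (hv.differentiable (by norm_num) x)
  rw [(hW.hasDerivAt_phi _).deriv] at this
  exact this

lemma fderiv_psi_apply (hW : IsDoubleWell W) {v : Rd d → ℝ} (hv : ContDiff ℝ 1 v) (x y : Rd d) :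
    fderiv ℝ (psi W v) x y = Real.sqrt (2 * W (v x)) * fderiv ℝ v x y := by
  rw [hW.fderiv_psi hv]; rfl

lemma memLp_sqrt (hW : IsDoubleWell W) {v : Rd d → ℝ} (hv : Continuous v)
    (hp : Integrable fun x => W (v x)) : MemLp (fun x => Real.sqrt (2 * W (v x))) 2 := by
  have hc : Continuous fun x => Real.sqrt (2 * W (v x)) := hW.continuous_sqrt.comp hv
  rw [memLp_two_iff_integrable_sq hc.aestronglyMeasurable]
  refine (hp.const_mul 2).congr (.of_forall fun x => ?_)
  simp only
  rw [Real.sq_sqrt (by have := hW.nonneg (v x); positivity)]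

lemma sqrt_sq (hW : IsDoubleWell W) (s : ℝ) : Real.sqrt (2 * W s) ^ 2 = 2 * W s :=
  Real.sq_sqrt (by have := hW.nonneg s; positivity)

lemma integrable_fderiv_psi (hW : IsDoubleWell W) {v : Rd d → ℝ} (hv : ContDiff ℝ 1 v)
    (hg : Integrable (fun x => ‖gradient v x‖ ^ 2)) (hp : Integrable fun x => W (v x)) :
    Integrable (fderiv ℝ (psi W v)) := by
  have h1 : Integrable (fun x => Real.sqrt (2 * W (v x)) * ‖gradient v x‖) :=
    (hW.memLp_sqrt hv.continuous hp).integrable_mul (memLp_gradient hv hg).norm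
  refine h1.mono' ((hW.contDiff_psi hv).continuous_fderiv (by norm_num)).aestronglyMeasurable
    (.of_forall fun x => ?_)
  rw [hW.fderiv_psi hv, norm_smul, norm_gradient, Real.norm_of_nonneg (Real.sqrt_nonneg _)]

end IsDoubleWell

/-! ### Pointwise coercivity and the pointwise estimate of the dissipation -/

section Pointwise

variable {H : Type*} [NormedAddCommGroup H] [InnerProductSpace ℝ H]

lemma norm_sub_sq_le_of_norm_le_one {n ξ : H} (hn : ‖n‖ ≤ 1) (hξ : ‖ξ‖ ≤ 1) :
    ‖n - ξ‖ ^ 2 ≤ 2 * (1 - inner ℝ ξ n) := by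
  rw [norm_sub_sq_real, real_inner_comm]
  nlinarith [norm_nonneg n, norm_nonneg ξ]

/-- Coercivity of the density of the relative energy. -/
lemma relative_density_coercive {a b δ ω K N E : ℝ} (ha : 0 ≤ a) (hb : 0 ≤ b) (hK : 1 ≤ K)
    (hδ1 : δ ^ 2 ≤ 1) (hδ : δ ^ 2 ≤ K * (1 - N)) (hω2 : ω ^ 2 ≤ 4)
    (hω : ω ^ 2 ≤ 2 * (1 - N)) (hE : E = (a - b) ^ 2 / 2 + a * b * (1 - N)) :
    a * b * δ ^ 2 ≤ K * E ∧ a * b * ω ^ 2 ≤ 2 * E ∧ (a - b) ^ 2 ≤ 2 * E ∧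
      a ^ 2 * δ ^ 2 ≤ 4 * K * E ∧ a ^ 2 * ω ^ 2 ≤ 12 * E ∧ b ^ 2 * δ ^ 2 ≤ 4 * K * E := by
  -- `N` stands for `ξ·n` and `ω` for `|n − ξ|`. The equipartition defect `(a − b)²` and the tilt
  -- `ab(1 − N)` are both contained in `E`, and `1 − N` controls `δ²` as well as `ω²`. Factors `a²`,
  -- `b²` are reduced to `ab` through `a² ≤ 2ab + (a − b)²`.
  have hab : 0 ≤ a * b := mul_nonneg ha hb
  have hN : 0 ≤ 1 - N := by nlinarith [sq_nonneg ω]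
  have hE0 : 0 ≤ a * b * (1 - N) := mul_nonneg hab hN
  have hs := sq_nonneg (a - b)
  have h1 : a * b * δ ^ 2 ≤ K * (a * b * (1 - N)) := by
    nlinarith [mul_le_mul_of_nonneg_left hδ hab]
  have h2 : a * b * ω ^ 2 ≤ 2 * (a * b * (1 - N)) := by
    nlinarith [mul_le_mul_of_nonneg_left hω hab]
  have h3 : (a - b) ^ 2 * δ ^ 2 ≤ (a - b) ^ 2 := by nlinarith [mul_le_mul_of_nonneg_left hδ1 hs]
  have h4 : (a - b) ^ 2 * ω ^ 2 ≤ 4 * (a - b) ^ 2 := by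
    nlinarith [mul_le_mul_of_nonneg_left hω2 hs]
  have ha2 : a ^ 2 ≤ 2 * (a * b) + (a - b) ^ 2 := by nlinarith [sq_nonneg b]
  have hb2 : b ^ 2 ≤ 2 * (a * b) + (a - b) ^ 2 := by nlinarith [sq_nonneg a]
  have h5 := mul_le_mul_of_nonneg_right ha2 (sq_nonneg δ)
  have h6 := mul_le_mul_of_nonneg_right ha2 (sq_nonneg ω)
  have h7 := mul_le_mul_of_nonneg_right hb2 (sq_nonneg δ)
  have hKs : (a - b) ^ 2 ≤ K * (a - b) ^ 2 := by nlinarith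
  have hKE : K * E = K * (a - b) ^ 2 / 2 + K * (a * b * (1 - N)) := by rw [hE]; ring
  have hKE0 : 0 ≤ K * (a * b * (1 - N)) := by positivity
  refine ⟨by nlinarith, by nlinarith, by nlinarith, by nlinarith, by nlinarith, by nlinarith⟩

/-- Completion of squares in the dissipation. -/
lemma dissipation_complete_squares (y p a b q q' t : ℝ) :
    -y ^ 2 - p * b * y + t * b * y + a * y * q' - t * (a * b) * q + p * (a * b) * q
      ≤ (p * b + q * a) ^ 2 / 2 + t ^ 2 * b ^ 2 / 2 + a ^ 2 * (q' ^ 2 - q ^ 2) / 2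
        + t * (a * b) * (q' - q) := by
  -- The difference of the two sides is exactly half the sum of these two squares: one compares the
  -- velocity with the curvature, the other with the velocity prescribed by the tested field and the
  -- weight.
  nlinarith [sq_nonneg (y + p * b), sq_nonneg (y - (t * b + a * q'))]

/-- Split `pb + qa = (p + q)a + p(b − a)`. In the application `p = ∇·ξ − λ` and `q = B·n`, so `p +
q` is the error in the evolution law up to replacing `ξ` by `n`, and `b − a` is the equipartition
defect. -/
lemma curvature_square_le {K p q a b δ ω E : ℝ} (hpq : |p + q| ≤ K * δ + K * ω) (hp : |p| ≤ K)
    (c3 : (a - b) ^ 2 ≤ 2 * E) (c4 : a ^ 2 * δ ^ 2 ≤ 4 * K * E) (c5 : a ^ 2 * ω ^ 2 ≤ 12 * E) :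
    (p * b + q * a) ^ 2 / 2 ≤ (8 * K ^ 3 + 26 * K ^ 2) * E := by
  have hpq2 : (p + q) ^ 2 ≤ 2 * K ^ 2 * (δ ^ 2 + ω ^ 2) := by
    have h := pow_le_pow_left₀ (abs_nonneg _) hpq 2
    rw [sq_abs] at h
    nlinarith [sq_nonneg (K * δ - K * ω)]
  have hp2 : p ^ 2 ≤ K ^ 2 := by rw [← sq_abs]; exact pow_le_pow_left₀ (abs_nonneg _) hp 2
  have h1 : (p * b + q * a) ^ 2 / 2 ≤ (p + q) ^ 2 * a ^ 2 + p ^ 2 * (a - b) ^ 2 := by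
    nlinarith [sq_nonneg ((p + q) * a + p * (a - b))]
  have h2 := mul_le_mul_of_nonneg_right hpq2 (sq_nonneg a)
  have h3 := mul_le_mul_of_nonneg_right hp2 (sq_nonneg (a - b))
  have h4 := mul_le_mul_of_nonneg_left c3 (sq_nonneg K)
  have h5 := mul_le_mul_of_nonneg_left (add_le_add c4 c5) (sq_nonneg K)
  linarith

lemma abs_inner_clm_le {K : ℝ} {L : H →L[ℝ] H} (hL : ‖L‖ ≤ K) (x w : H) :
    |inner ℝ x (L w)| ≤ K * (‖x‖ * ‖w‖) := by
  refine (abs_real_inner_le_norm _ _).trans ?_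
  have := mul_le_mul_of_nonneg_left ((L.le_opNorm w).trans
    (mul_le_mul_of_nonneg_right hL (norm_nonneg _))) (norm_nonneg x)
  linarith

lemma mul_mul_le_half_sq (a c s : ℝ) : a * c * s ≤ c ^ 2 / 2 + a ^ 2 * s ^ 2 / 2 := by
  nlinarith [sq_nonneg (c - a * s)]

/-- Replacing `a²` by `ab` costs `a(b − a) n·An`; the rest regroups around `n = ξ` as `−r·(n − ξ)`,
`−(r·ξ − ξ·Aξ)` and `−(n − ξ)·A(n − ξ)`, times `ab`. The first and third are products of two small
factors; the second is half the transport error of `|ξ|²`, hence quadratic in `δ`. In the leftover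
term `n·An` is itself of order `δ + |n − ξ|`, because `ξ·Aξ` is of order `δ`. -/
lemma transport_terms_le {K a b δ E : ℝ} (hK : 1 ≤ K) {n ξ r : H} {A : H →L[ℝ] H}
    (hab : 0 ≤ a * b) (hE0 : 0 ≤ E)
    (hn : ‖n‖ ≤ 1) (hξ : ‖ξ‖ ≤ 1) (hA : ‖A‖ ≤ K)
    (hξA : |inner ℝ ξ (A ξ)| ≤ K * δ) (hr : ‖r‖ ≤ K * δ)
    (hrξ : |inner ℝ r ξ - inner ℝ ξ (A ξ)| ≤ K * δ ^ 2)
    (c1 : a * b * δ ^ 2 ≤ K * E) (c2 : a * b * ‖n - ξ‖ ^ 2 ≤ 2 * E) (c3 : (a - b) ^ 2 ≤ 2 * E)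
    (c4 : a ^ 2 * δ ^ 2 ≤ 4 * K * E) (c5 : a ^ 2 * ‖n - ξ‖ ^ 2 ≤ 12 * E) :
    -(a * b * inner ℝ r n) - a ^ 2 * inner ℝ n (A n) + a * b * inner ℝ (A ξ) n
        + a * b * inner ℝ ξ (A n) ≤ (60 * K ^ 3) * E := by
  have hK0 : 0 ≤ K := by linarith
  have hω0 : 0 ≤ ‖n - ξ‖ := norm_nonneg _
  have e : -(a * b * inner ℝ r n) - a ^ 2 * inner ℝ n (A n) + a * b * inner ℝ (A ξ) n
      + a * b * inner ℝ ξ (A n)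
      = a * b * (-inner ℝ r (n - ξ)) + a * b * (-(inner ℝ r ξ - inner ℝ ξ (A ξ)))
        + a * b * (-inner ℝ (n - ξ) (A (n - ξ))) + a * (b - a) * inner ℝ n (A n) := by
    simp only [map_sub, inner_sub_left, inner_sub_right, real_inner_comm n (A ξ)]
    ring
  have f1 : -inner ℝ r (n - ξ) ≤ K * (δ ^ 2 + ‖n - ξ‖ ^ 2) := by
    have h1 := (abs_real_inner_le_norm r (n - ξ)).trans (mul_le_mul_of_nonneg_right hr hω0)
    have h2 := neg_abs_le (inner ℝ r (n - ξ))
    have h3 : δ * ‖n - ξ‖ ≤ δ ^ 2 + ‖n - ξ‖ ^ 2 := by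
      nlinarith [sq_nonneg (δ - ‖n - ξ‖), sq_nonneg (δ + ‖n - ξ‖)]
    have h4 := mul_le_mul_of_nonneg_left h3 hK0
    linarith
  have f2 : -(inner ℝ r ξ - inner ℝ ξ (A ξ)) ≤ K * δ ^ 2 := by
    linarith [neg_abs_le (inner ℝ r ξ - inner ℝ ξ (A ξ))]
  have f3 : -inner ℝ (n - ξ) (A (n - ξ)) ≤ K * ‖n - ξ‖ ^ 2 := by
    have := abs_inner_clm_le hA (n - ξ) (n - ξ)
    have h2 := neg_abs_le (inner ℝ (n - ξ) (A (n - ξ)))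
    rw [pow_two]; linarith
  have f4 : |inner ℝ n (A n)| ≤ K * (δ + 2 * ‖n - ξ‖) := by
    have e' : inner ℝ n (A n) = inner ℝ ξ (A ξ) + inner ℝ (n - ξ) (A ξ)
        + inner ℝ n (A (n - ξ)) := by
      simp only [map_sub, inner_sub_left, inner_sub_right]; ring
    have g1 : |inner ℝ (n - ξ) (A ξ)| ≤ K * ‖n - ξ‖ := (abs_inner_clm_le hA _ _).trans
      (mul_le_mul_of_nonneg_left (mul_le_of_le_one_right hω0 hξ) hK0)
    have g2 : |inner ℝ n (A (n - ξ))| ≤ K * ‖n - ξ‖ := (abs_inner_clm_le hA _ _).trans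
      (mul_le_mul_of_nonneg_left (mul_le_of_le_one_left hω0 hn) hK0)
    rw [e']
    have := abs_add_three (inner ℝ ξ (A ξ)) (inner ℝ (n - ξ) (A ξ)) (inner ℝ n (A (n - ξ)))
    linarith
  rw [e]
  generalize -inner ℝ r (n - ξ) = x1 at *
  generalize -(inner ℝ r ξ - inner ℝ ξ (A ξ)) = x2 at *
  generalize -inner ℝ (n - ξ) (A (n - ξ)) = x3 at *
  generalize inner ℝ n (A n) = x4 at *
  generalize ‖n - ξ‖ = ω at *
  clear hξA hr hrξ hA hξ hn e
  have f5 : a * (b - a) * x4 ≤ (a - b) ^ 2 / 2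
      + a ^ 2 * (K ^ 2 * (2 * δ ^ 2 + 8 * ω ^ 2)) / 2 := by
    have h := pow_le_pow_left₀ (abs_nonneg _) f4 2
    rw [sq_abs, mul_pow] at h
    have h1 : (δ + 2 * ω) ^ 2 ≤ 2 * δ ^ 2 + 8 * ω ^ 2 := by nlinarith [sq_nonneg (δ - 2 * ω)]
    have h2 := mul_le_mul_of_nonneg_left (h.trans (mul_le_mul_of_nonneg_left h1 (sq_nonneg K)))
      (sq_nonneg a)
    have h3 := mul_mul_le_half_sq a (b - a) x4
    have h4 : (b - a) ^ 2 = (a - b) ^ 2 := by ring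
    linarith
  have g1 := mul_le_mul_of_nonneg_left f1 hab
  have g2 := mul_le_mul_of_nonneg_left f2 hab
  have g3 := mul_le_mul_of_nonneg_left f3 hab
  have k1 := mul_le_mul_of_nonneg_left c1 hK0
  have k3 := mul_le_mul_of_nonneg_left c2 hK0
  have k2 := mul_le_mul_of_nonneg_left (add_le_add c4 (mul_le_mul_of_nonneg_left c5
    (by norm_num : (0:ℝ) ≤ 4))) (sq_nonneg K)
  have m1 : E ≤ K * E := le_mul_of_one_le_left hE0 hK
  have m2 : K * E ≤ K ^ 2 * E := by
    have := mul_le_mul_of_nonneg_left m1 hK0; linarith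
  have m3 : K ^ 2 * E ≤ K ^ 3 * E := by
    have := mul_le_mul_of_nonneg_left m2 hK0; linarith
  linarith

/-- Here `s = X·n` for the correction field `X`. Its contributions, here and in
`correction_divergence_le`, are compared with the full energy density, not the relative one: all
smallness has to come from `α`. -/
lemma correction_terms_le {K a b q s t α : ℝ} (hK0 : 0 ≤ K) (hab : 0 ≤ a * b)
    (hqK : |q| ≤ K) (hsK : |s| ≤ K) (htK : |t| ≤ K) :
    a ^ 2 * ((q - α * s) ^ 2 - q ^ 2) / 2 + t * (a * b) * ((q - α * s) - q)
      ≤ 4 * K ^ 2 * ((|α| + α ^ 2) * ((a ^ 2 + b ^ 2) / 2)) := by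
  have ha2 : a ^ 2 ≤ 2 * ((a ^ 2 + b ^ 2) / 2) := by linarith [sq_nonneg b]
  have hab2 : a * b ≤ (a ^ 2 + b ^ 2) / 2 := by linarith [sq_nonneg (a - b)]
  have hαK : 0 ≤ α ^ 2 * K ^ 2 := by positivity
  have h1 : ((q - α * s) ^ 2 - q ^ 2) / 2 ≤ K ^ 2 * (|α| + α ^ 2) := by
    have g1 : -(α * (q * s)) ≤ |α| * K ^ 2 := by
      have := neg_abs_le (α * (q * s))
      have h' : |α * (q * s)| ≤ |α| * K ^ 2 := by
        rw [abs_mul, abs_mul, pow_two]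
        exact mul_le_mul_of_nonneg_left (mul_le_mul hqK hsK (abs_nonneg _) hK0) (abs_nonneg _)
      linarith
    have g2 : α ^ 2 * s ^ 2 ≤ α ^ 2 * K ^ 2 := by
      refine mul_le_mul_of_nonneg_left ?_ (sq_nonneg _)
      rw [← sq_abs s]; exact pow_le_pow_left₀ (abs_nonneg _) hsK 2
    linarith
  have h2 : -(t * α * s) ≤ K ^ 2 * (|α| + α ^ 2) := by
    have := neg_abs_le (t * α * s)
    have h' : |t * α * s| ≤ |α| * K ^ 2 := by
      rw [abs_mul, abs_mul]
      have := mul_le_mul_of_nonneg_left (mul_le_mul htK hsK (abs_nonneg _) hK0) (abs_nonneg α)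
      linarith
    linarith
  have h3 := mul_le_mul_of_nonneg_left h1 (sq_nonneg a)
  have h4 := mul_le_mul_of_nonneg_left h2 hab
  have hc : 0 ≤ K ^ 2 * (|α| + α ^ 2) := by positivity
  have h5 := mul_le_mul_of_nonneg_right ha2 hc
  have h6 := mul_le_mul_of_nonneg_right hab2 hc
  have h7 : 0 ≤ (a ^ 2 + b ^ 2) / 2 * (K ^ 2 * (|α| + α ^ 2)) := by positivity
  linarith

lemma correction_divergence_le {K a b dX x α : ℝ} (hK0 : 0 ≤ K) (hdX : |dX| ≤ K) (hx : |x| ≤ K) :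
    -(α * dX) * ((a ^ 2 + b ^ 2) / 2) + α * (a ^ 2 * x)
      ≤ 3 * K * (|α| * ((a ^ 2 + b ^ 2) / 2)) := by
  have ha2 : a ^ 2 ≤ 2 * ((a ^ 2 + b ^ 2) / 2) := by linarith [sq_nonneg b]
  have he00 : 0 ≤ (a ^ 2 + b ^ 2) / 2 := by positivity
  have h1 : -(α * dX) ≤ |α| * K := by
    have := neg_abs_le (α * dX)
    rw [abs_mul] at this
    linarith [mul_le_mul_of_nonneg_left hdX (abs_nonneg α)]
  have h2 : α * x ≤ |α| * K := by
    have := le_abs_self (α * x)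
    rw [abs_mul] at this
    exact this.trans (mul_le_mul_of_nonneg_left hx (abs_nonneg α))
  have h3 := mul_le_mul_of_nonneg_right h1 he00
  have h4 := mul_le_mul_of_nonneg_left h2 (sq_nonneg a)
  have h5 := mul_le_mul_of_nonneg_right ha2 (by positivity : 0 ≤ |α| * K)
  linarith

/-- With `z = ψ − χ` and `t = θ`, the transport error `τ` of the weight is `O(δ)`, hence `O(|θ|)`,
so `zτ` is absorbed by the density `zθ` of the volume error. -/
lemma volume_terms_le {K z t τ dB δ : ℝ} (hK : 1 ≤ K) (hdB : |dB| ≤ K) (hτ : |τ| ≤ K * δ)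
    (hzt : |z| * |t| = z * t) (hδt : δ ≤ K * |t|) :
    z * τ + dB * (z * t) ≤ 2 * K ^ 2 * (z * t) := by
  have hK0 : 0 ≤ K := by linarith
  have hzt0 : 0 ≤ z * t := hzt ▸ by positivity
  have h1 : z * τ ≤ K ^ 2 * (z * t) := by
    have g1 := le_abs_self (z * τ)
    rw [abs_mul] at g1
    have g2 := mul_le_mul_of_nonneg_left (hτ.trans (mul_le_mul_of_nonneg_left hδt hK0))
      (abs_nonneg z)
    rw [← hzt]; linarith
  have h2 := mul_le_mul_of_nonneg_right ((le_abs_self dB).trans hdB) hzt0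
  have h3 : K * (z * t) ≤ K ^ 2 * (z * t) := mul_le_mul_of_nonneg_right (by nlinarith) hzt0
  linarith

/-- The pointwise estimate at the heart of the relative energy inequality. -/
lemma pointwise_dissipation_le {K : ℝ} (hK : 1 ≤ K) {y a b δ p t z τ dB dX α : ℝ}
    {n ξ B X r : H} {A A' : H →L[ℝ] H} (ha : 0 ≤ a) (hb : 0 ≤ b) (hδ0 : 0 ≤ δ) (hδ1 : δ ≤ 1)
    (hn : ‖n‖ ≤ 1) (hξ : ‖ξ‖ ≤ 1) (hshort : δ ^ 2 ≤ K * (1 - ‖ξ‖)) (hA : ‖A‖ ≤ K) (hA' : ‖A'‖ ≤ K)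
    (hB : ‖B‖ ≤ K) (hX : ‖X‖ ≤ K) (hξA : |inner ℝ ξ (A ξ)| ≤ K * δ) (hr : ‖r‖ ≤ K * δ)
    (hrξ : |inner ℝ r ξ - inner ℝ ξ (A ξ)| ≤ K * δ ^ 2) (hp : |p| ≤ K)
    (hpB : |p + inner ℝ B ξ| ≤ K * δ) (ht : |t| ≤ K * δ) (hdB : |dB| ≤ K) (hdX : |dX| ≤ K)
    (hτ : |τ| ≤ K * δ) (hzt : |z| * |t| = z * t) (hδt : δ ≤ K * |t|) :
    -y ^ 2 - p * b * y + t * b * y + a * y * (inner ℝ B n - α * inner ℝ X n)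
        - t * (a * b) * inner ℝ B n + p * (a * b) * inner ℝ B n
        - a * b * inner ℝ r n + (dB - α * dX) * ((a ^ 2 + b ^ 2) / 2)
        - dB * (a * b * inner ℝ ξ n) - a ^ 2 * (inner ℝ n (A n) - α * inner ℝ n (A' n))
        + a * b * inner ℝ (A ξ) n + a * b * inner ℝ ξ (A n) + z * τ + dB * (z * t)
      ≤ 100 * K ^ 3 * ((a ^ 2 + b ^ 2) / 2 - a * b * inner ℝ ξ n) + 2 * K ^ 2 * (z * t)
        + 10 * K ^ 2 * ((|α| + α ^ 2) * ((a ^ 2 + b ^ 2) / 2)) := by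
  -- Dictionary: `a = √ε|∇v|`, `b = √(2W)/√ε`, `y = √ε V`, `n = −∇v/|∇v|`, `p = ∇·ξ − λ`, `t = θ`,
  -- `z = ψ − χ`; `τ` and `r` are the transport errors of `θ` and `ξ`, the latter including
  -- `(∇B)ᵀξ`; `A`, `A'` are the derivatives and `dB`, `dX` the divergences of `B`, `X`.
  have hK0 : 0 ≤ K := by linarith
  have hNξ : inner ℝ ξ n ≤ ‖ξ‖ := (real_inner_le_norm _ _).trans
    (mul_le_of_le_one_right (norm_nonneg _) hn)
  have hω2 : ‖n - ξ‖ ≤ 2 := (norm_sub_le _ _).trans (by linarith)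
  obtain ⟨E, hE⟩ : ∃ E, E = (a ^ 2 + b ^ 2) / 2 - a * b * inner ℝ ξ n := ⟨_, rfl⟩
  have hω4 : ‖n - ξ‖ ^ 2 ≤ 4 := by
    have := pow_le_pow_left₀ (norm_nonneg _) hω2 2; linarith
  have hδ2 : δ ^ 2 ≤ 1 := pow_le_one₀ hδ0 hδ1
  obtain ⟨c1, c2, c3, c4, c5, c6⟩ := relative_density_coercive (E := E) ha hb hK
    hδ2 (hshort.trans (mul_le_mul_of_nonneg_left (by linarith) hK0))
    hω4 (norm_sub_sq_le_of_norm_le_one hn hξ) (by rw [hE]; ring)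
  have hE0 : 0 ≤ E := by linarith [sq_nonneg (a - b)]
  have hab : 0 ≤ a * b := mul_nonneg ha hb
  have hsK : |inner ℝ X n| ≤ K := (abs_real_inner_le_norm _ _).trans
    ((mul_le_of_le_one_right (norm_nonneg _) hn).trans hX)
  have hqK : |inner ℝ B n| ≤ K := (abs_real_inner_le_norm _ _).trans
    ((mul_le_of_le_one_right (norm_nonneg _) hn).trans hB)
  have htK : |t| ≤ K := ht.trans (mul_le_of_le_one_right hK0 hδ1)
  have hpq : |p + inner ℝ B n| ≤ K * δ + K * ‖n - ξ‖ := by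
    have e : p + inner ℝ B n = (p + inner ℝ B ξ) + inner ℝ B (n - ξ) := by
      rw [inner_sub_right]; ring
    rw [e]
    refine (abs_add_le _ _).trans (add_le_add hpB ?_)
    exact (abs_real_inner_le_norm _ _).trans (mul_le_mul_of_nonneg_right hB (norm_nonneg _))
  have B1 := curvature_square_le hpq hp c3 c4 c5
  have ht2 : t ^ 2 ≤ K ^ 2 * δ ^ 2 := by
    rw [← sq_abs, ← mul_pow]; exact pow_le_pow_left₀ (abs_nonneg _) ht 2
  have B2 : t ^ 2 * b ^ 2 / 2 ≤ 2 * K ^ 3 * E := by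
    have h1 := mul_le_mul_of_nonneg_right ht2 (sq_nonneg b)
    have h2 := mul_le_mul_of_nonneg_left c6 (sq_nonneg K)
    linarith
  have B3 := transport_terms_le hK hab hE0 hn hξ hA hξA hr hrξ c1 c2 c3 c4 c5
  have B4 := correction_terms_le (α := α) hK0 hab hqK hsK htK
  have hx : |inner ℝ n (A' n)| ≤ K := (abs_inner_clm_le hA' n n).trans
    (mul_le_of_le_one_right hK0 (mul_le_one₀ hn (norm_nonneg _) hn))
  have B5 := correction_divergence_le (a := a) (b := b) (α := α) hK0 hdX hx
  have B6 := volume_terms_le hK hdB hτ hzt hδt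
  have B7 : dB * E ≤ K * E := mul_le_mul_of_nonneg_right ((le_abs_self dB).trans hdB) hE0
  have B0 := dissipation_complete_squares y p a b (inner ℝ B n)
    (inner ℝ B n - α * inner ℝ X n) t
  have m1 : E ≤ K * E := le_mul_of_one_le_left hE0 hK
  have m2 : K * E ≤ K ^ 2 * E := by
    have := mul_le_mul_of_nonneg_left m1 hK0; linarith
  have m3 : K ^ 2 * E ≤ K ^ 3 * E := by
    have := mul_le_mul_of_nonneg_left m2 hK0; linarith
  have he00 : 0 ≤ (a ^ 2 + b ^ 2) / 2 := by positivity
  have m4 : K * (|α| * ((a ^ 2 + b ^ 2) / 2))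
      ≤ K ^ 2 * ((|α| + α ^ 2) * ((a ^ 2 + b ^ 2) / 2)) := by
    have h1 : |α| * ((a ^ 2 + b ^ 2) / 2) ≤ (|α| + α ^ 2) * ((a ^ 2 + b ^ 2) / 2) :=
      mul_le_mul_of_nonneg_right (le_add_of_nonneg_right (sq_nonneg α)) he00
    have h2 : K ≤ K ^ 2 := le_self_pow₀ hK (by norm_num)
    exact mul_le_mul h2 h1 (by positivity) (sq_nonneg K)
  have m5 : 0 ≤ K ^ 2 * ((|α| + α ^ 2) * ((a ^ 2 + b ^ 2) / 2)) := by positivity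
  have m6 : 0 ≤ K ^ 3 * E := by positivity
  have hEe : dB * E = dB * ((a ^ 2 + b ^ 2) / 2) - dB * (a * b * inner ℝ ξ n) := by
    rw [hE]; ring
  rw [← hE]
  linear_combination B0 + B1 + B2 + B3 + B4 + B5 + B6 + B7 - hEe + 27 * m3 + m2 + 3 * m6
    + 3 * m4 + 3 * m5

end Pointwise

/-! ### A vector field of positive divergence -/

/-- A bounded vector field with strictly positive divergence. -/
def arctanField (i : Fin d) (x : Rd d) : Rd d := Real.arctan (x i) • EuclideanSpace.single i 1

lemma lipschitzWith_arctan : LipschitzWith 1 Real.arctan := by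
  refine lipschitzWith_of_nnnorm_deriv_le Real.differentiable_arctan fun x => ?_
  rw [Real.deriv_arctan, ← NNReal.coe_le_coe, coe_nnnorm, Real.norm_eq_abs,
    abs_of_pos (by positivity)]
  exact (div_le_one (by positivity)).2 (by nlinarith [sq_nonneg x])

lemma lipschitzWith_arctanField (i : Fin d) : LipschitzWith 1 (arctanField i) := by
  refine LipschitzWith.of_dist_le_mul fun x y => ?_
  simp only [arctanField, dist_eq_norm, ← sub_smul, norm_smul]
  rw [← dist_eq_norm]
  have h := lipschitzWith_arctan.dist_le_mul (x i) (y i)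
  have h2 : dist (x i) (y i) ≤ ‖x - y‖ := by
    rw [dist_eq_norm]; exact PiLp.norm_apply_le (x - y) i
  simpa using h.trans (mul_le_mul_of_nonneg_left h2 (NNReal.coe_nonneg 1))

lemma norm_arctanField_le (i : Fin d) (x : Rd d) : ‖arctanField i x‖ ≤ 2 := by
  simp only [arctanField, norm_smul, PiLp.norm_single, norm_one, mul_one,
    Real.norm_eq_abs]
  rw [abs_le]
  constructor
  · linarith [Real.neg_pi_div_two_lt_arctan (x i), Real.pi_le_four]
  · linarith [Real.arctan_lt_pi_div_two (x i), Real.pi_le_four]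

/-- This explains the arctangent: the field is bounded and Lipschitz, so it may be tested against
`ψ` without decay, while its divergence is bounded below on every ball. -/
lemma divergence_arctanField (i : Fin d) (x : Rd d) :
    divergence (arctanField i) x = 1 / (1 + x i ^ 2) := by
  have h1 : HasFDerivAt (fun y : Rd d => y i) (EuclideanSpace.proj (𝕜 := ℝ) i) x :=
    (EuclideanSpace.proj (𝕜 := ℝ) i).hasFDerivAt
  have h2 := ((Real.hasDerivAt_arctan (x i)).comp_hasFDerivAt x h1).smul_const
    (EuclideanSpace.single i (1:ℝ))
  have h3 : fderiv ℝ (arctanField i) x = _ := h2.fderiv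
  have h4 : ∀ j, (fderiv ℝ (arctanField i) x (EuclideanSpace.single j 1)) j
      = if j = i then 1 / (1 + x i ^ 2) else 0 := by
    intro j
    rw [h3]
    by_cases hj : j = i
    · subst hj; simp
    · simp [hj, Ne.symm hj]
  simp only [divergence, h4, Finset.sum_ite_eq', Finset.mem_univ, if_true]

/-! ### Control of the calibration and of the solution at a fixed time -/

/-- Quantitative control, by a constant `K`, of a calibration at a fixed time; `δ` is the truncated
distance to the surface, `ξt` and `θt` are the time derivatives of `ξ` and `θ`. -/
structure SliceControl (K : NNReal) (m : ℝ) (Ω : Set (Rd d)) (δ θ θt : Rd d → ℝ)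
    (ξ B ξt : Rd d → Rd d) (l : ℝ) : Prop where
  two_le : 2 ≤ (K : ℝ)
  lip_xi : LipschitzWith K ξ
  lip_B : LipschitzWith K B
  lip_theta : LipschitzWith K θ
  norm_xi_le : ∀ x, ‖ξ x‖ ≤ 1
  norm_B_le : ∀ x, ‖B x‖ ≤ K
  abs_theta_le : ∀ x, |θ x| ≤ K
  abs_div_B_le : ∀ x, |divergence B x| ≤ K
  abs_div_xi_le : ∀ x, |divergence ξ x| ≤ K
  abs_div_xi_sub_le : ∀ x, |divergence ξ x - l| ≤ K
  abs_l_le : |l| ≤ K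
  delta_nonneg : ∀ x, 0 ≤ δ x
  delta_le_one : ∀ x, δ x ≤ 1
  delta_far : ∀ x, K ≤ ‖x‖ → δ x = 1
  short : ∀ x, δ x ^ 2 ≤ K * (1 - ‖ξ x‖)
  theta_le : ∀ x, |θ x| ≤ K * δ x
  le_theta : ∀ x, δ x ≤ K * |θ x|
  div_B : ∃ c, ∀ᵐ x, |divergence B x - c| ≤ K * δ x
  xi_xi_B : ∀ᵐ x, |inner ℝ (ξ x) (fderiv ℝ B x (ξ x))| ≤ K * δ x
  evolution : ∀ᵐ x, |divergence ξ x - l + inner ℝ (B x) (ξ x)| ≤ K * δ x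
  transport_theta : ∀ᵐ x, |θt x + fderiv ℝ θ x (B x)| ≤ K * δ x
  transport_length : ∀ᵐ x,
    |inner ℝ (ξt x) (ξ x) + inner ℝ (fderiv ℝ ξ x (B x)) (ξ x)| ≤ K * δ x ^ 2
  transport_xi : ∀ᵐ x, ‖ξt x + fderiv ℝ ξ x (B x)
    + ContinuousLinearMap.adjoint (fderiv ℝ B x) (ξ x)‖ ≤ K * δ x
  meas_xit : AEStronglyMeasurable ξt
  meas_thetat : AEStronglyMeasurable θt
  norm_xit_le : ∀ᵐ x, ‖ξt x‖ ≤ K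
  abs_thetat_le : ∀ᵐ x, |θt x| ≤ K
  mem_iff : ∀ x, x ∈ Ω ↔ θ x < 0
  bounded : ∀ x ∈ Ω, ‖x‖ < K
  volume_pos : 0 < m
  volume_eq : volume.real Ω = m
  integral_div : ∫ x in Ω, divergence B x = 0

/-- The properties of a solution `v`, with time derivative `V`, at a fixed time. -/
structure SolutionSlice (W : ℝ → ℝ) (ε m l : ℝ) (v V : Rd d → ℝ) : Prop where
  well : IsDoubleWell W
  pos : 0 < ε
  contDiff : ContDiff ℝ 2 v
  mem_Icc : ∀ x, v x ∈ Icc (0 : ℝ) 1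
  int_psi : Integrable (psi W v)
  int_grad : Integrable (fun x => ‖gradient v x‖ ^ 2)
  int_pot : Integrable (fun x => W (v x))
  memLp_force : MemLp (localForce W ε v) 2
  equation : ∀ x, V x = localForce W ε v x + l * Real.sqrt (2 * W (v x))
  orthogonal : ∫ x, Real.sqrt (2 * W (v x)) * V x = 0
  mass : ∫ x, psi W v x = m

/-- The difference `ψ - χ_Ω`. -/
def phaseError (W : ℝ → ℝ) (Ω : Set (Rd d)) (v : Rd d → ℝ) (x : Rd d) : ℝ :=
  psi W v x - Ω.indicator (fun _ => (1 : ℝ)) x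

/-- The density of the time derivative of the relative energy plus the volume error. -/
def rateDensity (W : ℝ → ℝ) (ε : ℝ) (Ω : Set (Rd d)) (θ θt : Rd d → ℝ) (ξ ξt : Rd d → Rd d)
    (v V : Rd d → ℝ) (x : Rd d) : ℝ :=
  -(ε * V x ^ 2) + fderiv ℝ (psi W v) x (ξt x)
    - divergence ξ x * (Real.sqrt (2 * W (v x)) * V x)
    + θ x * (Real.sqrt (2 * W (v x)) * V x) + phaseError W Ω v x * θt x

lemma integrable_clm_apply_of_bounded {L : Rd d → Rd d →L[ℝ] ℝ} {Y : Rd d → Rd d} {K : ℝ}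
    (hL : Integrable L) (hY : AEStronglyMeasurable Y) (hYK : ∀ᵐ x, ‖Y x‖ ≤ K) :
    Integrable (fun x => L x (Y x)) := by
  refine (hL.norm.const_mul K).mono' (isBoundedBilinearMap_apply.continuous.comp_aestronglyMeasurable₂
    hL.aestronglyMeasurable hY) ?_
  filter_upwards [hYK] with x hx
  rw [mul_comm]
  exact ((L x).le_opNorm _).trans (mul_le_mul_of_nonneg_left hx (norm_nonneg _))

namespace SolutionSlice

variable {W : ℝ → ℝ} {ε m lε : ℝ} {v V : Rd d → ℝ}

lemma contDiff_one (h : SolutionSlice W ε m lε v V) : ContDiff ℝ 1 v := h.contDiff.of_le (by norm_num)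

lemma contDiff_psi (h : SolutionSlice W ε m lε v V) : ContDiff ℝ 1 (psi W v) :=
  h.well.contDiff_psi h.contDiff_one

lemma int_fderiv_psi (h : SolutionSlice W ε m lε v V) : Integrable (fderiv ℝ (psi W v)) :=
  h.well.integrable_fderiv_psi h.contDiff_one h.int_grad h.int_pot

lemma memLp_sqrt (h : SolutionSlice W ε m lε v V) : MemLp (fun x => Real.sqrt (2 * W (v x))) 2 :=
  h.well.memLp_sqrt h.contDiff.continuous h.int_pot

lemma continuous_V (h : SolutionSlice W ε m lε v V) : Continuous V := by
  have : V = fun x => localForce W ε v x + lε * Real.sqrt (2 * W (v x)) := funext h.equation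
  rw [this]
  exact (continuous_localForce h.well.contDiff h.contDiff).add
    (continuous_const.mul (h.well.continuous_sqrt.comp h.contDiff.continuous))

lemma memLp_V (h : SolutionSlice W ε m lε v V) : MemLp V 2 := by
  have : V = fun x => localForce W ε v x + lε * Real.sqrt (2 * W (v x)) := funext h.equation
  rw [this]
  exact h.memLp_force.add (h.memLp_sqrt.const_mul lε)

lemma int_V_sq (h : SolutionSlice W ε m lε v V) : Integrable (fun x => V x ^ 2) :=
  h.memLp_V.integrable_sq

lemma int_sqrt_mul_V (h : SolutionSlice W ε m lε v V) :
    Integrable (fun x => Real.sqrt (2 * W (v x)) * V x) :=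
  h.memLp_sqrt.integrable_mul h.memLp_V

lemma int_energy (h : SolutionSlice W ε m lε v V) : Integrable (energyDensity W ε v) :=
  integrable_energyDensity h.int_grad h.int_pot

lemma psi_mem (h : SolutionSlice W ε m lε v V) (x : Rd d) : psi W v x ∈ Icc (0:ℝ) 1 :=
  h.well.phi_mem_Icc (h.mem_Icc x)

/-- The local force tested with a vector field, in terms of the velocity. -/
lemma integral_velocity_mul_fderiv (h : SolutionSlice W ε m lε v V) {B : Rd d → Rd d} {L : NNReal}
    {K : ℝ} (hB : LipschitzWith L B) (hBK : ∀ x, ‖B x‖ ≤ K) :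
    ∫ x, ε * V x * fderiv ℝ v x (B x)
      = (∫ x, (energyDensity W ε v x * divergence B x
          - ε * fderiv ℝ v x (fderiv ℝ B x (gradient v x))))
        + ε * lε * ∫ x, fderiv ℝ (psi W v) x (B x) := by
  rw [← integral_localForce_mul_fderiv h.well.contDiff h.pos h.contDiff hB hBK h.int_grad h.int_pot
    h.memLp_force, ← integral_const_mul, ← integral_add]
  · refine integral_congr_ae (.of_forall fun x => ?_)
    simp only [h.well.fderiv_psi_apply h.contDiff_one, h.equation x]
    ring
  · refine ((MemLp.integrable_mul_fderiv h.memLp_force h.contDiff_one h.int_grad hB.continuous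
      hBK).const_mul ε).congr (.of_forall fun x => ?_)
    simp only; ring
  · exact (integrable_clm_apply_of_bounded h.int_fderiv_psi hB.continuous.aestronglyMeasurable
      (.of_forall hBK)).const_mul _

end SolutionSlice

/-! ### Volume error and fluxes through the diffuse interface at a fixed time. -/

namespace SliceControl

variable {K : NNReal} {m : ℝ} {Ω : Set (Rd d)} {δ θ θt : Rd d → ℝ} {ξ B ξt : Rd d → Rd d} {l : ℝ}

lemma measurableSet (h : SliceControl K m Ω δ θ θt ξ B ξt l) : MeasurableSet Ω := by
  have : Ω = θ ⁻¹' Iio 0 := by ext x; simp [h.mem_iff]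
  rw [this]; exact h.lip_theta.continuous.measurable measurableSet_Iio

lemma volume_lt_top (h : SliceControl K m Ω δ θ θt ξ B ξt l) : volume Ω < ⊤ := by
  refine (measure_mono (t := Metric.closedBall 0 K) fun x hx => ?_).trans_lt
    measure_closedBall_lt_top
  simpa using (h.bounded x hx).le

lemma int_indicator (h : SliceControl K m Ω δ θ θt ξ B ξt l) :
    Integrable (Ω.indicator fun _ => (1 : ℝ)) :=
  (integrable_indicator_iff h.measurableSet).2 (integrableOn_const h.volume_lt_top.ne)

lemma integral_indicator_one (h : SliceControl K m Ω δ θ θt ξ B ξt l) :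
    ∫ x, Ω.indicator (fun _ => (1 : ℝ)) x = m := by
  rw [integral_indicator h.measurableSet]; simp [h.volume_eq]

variable {W : ℝ → ℝ} {ε lε : ℝ} {v V : Rd d → ℝ}

lemma int_phaseError (h : SliceControl K m Ω δ θ θt ξ B ξt l) (hv : SolutionSlice W ε m lε v V) :
    Integrable (phaseError W Ω v) := hv.int_psi.sub h.int_indicator

lemma integral_phaseError (h : SliceControl K m Ω δ θ θt ξ B ξt l)
    (hv : SolutionSlice W ε m lε v V) : ∫ x, phaseError W Ω v x = 0 := by
  unfold phaseError
  rw [integral_sub hv.int_psi h.int_indicator, hv.mass, h.integral_indicator_one, sub_self]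

/-- Since `0 ≤ ψ ≤ 1`, the difference `ψ − χ` is nonpositive in `Ω`, where `θ < 0`, and nonnegative
elsewhere, where `θ ≥ 0`. So the absolute values in the volume error can be dropped. -/
lemma abs_mul_abs (h : SliceControl K m Ω δ θ θt ξ B ξt l) (hv : SolutionSlice W ε m lε v V)
    (x : Rd d) : |phaseError W Ω v x| * |θ x| = phaseError W Ω v x * θ x := by
  have hp := hv.psi_mem x
  unfold phaseError
  by_cases hx : x ∈ Ω
  · have := (h.mem_iff x).1 hx
    rw [indicator_of_mem hx, abs_of_nonpos (by linarith [hp.2]), abs_of_neg this]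
    ring
  · have : 0 ≤ θ x := not_lt.1 fun h' => hx ((h.mem_iff x).2 h')
    rw [indicator_of_notMem hx, abs_of_nonneg (by linarith [hp.1]), abs_of_nonneg this]

lemma int_phaseError_mul (h : SliceControl K m Ω δ θ θt ξ B ξt l)
    (hv : SolutionSlice W ε m lε v V) : Integrable (fun x => phaseError W Ω v x * θ x) :=
  (h.int_phaseError hv).mul_bdd (c := K) h.lip_theta.continuous.aestronglyMeasurable
    (.of_forall h.abs_theta_le)

/-- `(ψ - χ) θ` is transported: integration by parts. -/
lemma integral_phaseError_transport (h : SliceControl K m Ω δ θ θt ξ B ξt l)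
    (hv : SolutionSlice W ε m lε v V) :
    ∫ x, (phaseError W Ω v x * fderiv ℝ θ x (B x) + θ x * fderiv ℝ (psi W v) x (B x)
      + divergence B x * (phaseError W Ω v x * θ x)) = 0 := by
  -- The divergence theorem is used separately for `ψ θ B` and for `χ θ B`. The latter has no
  -- boundary term on the surface because `χθ = −max(−θ, 0)` is Lipschitz with compact support.
  have hY : LipschitzWith (K * (K + K)) fun x => θ x • B x := by
    refine LipschitzWith.of_dist_le_mul fun x y => ?_
    have e : θ x • B x - θ y • B y = θ x • (B x - B y) + (θ x - θ y) • B y := by module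
    have h2 := h.lip_theta.dist_le_mul x y
    have h3 := h.lip_B.dist_le_mul x y
    rw [dist_eq_norm] at h2 h3
    rw [dist_eq_norm, e]
    calc ‖θ x • (B x - B y) + (θ x - θ y) • B y‖
        ≤ |θ x| * ‖B x - B y‖ + ‖θ x - θ y‖ * ‖B y‖ := by
          refine (norm_add_le _ _).trans ?_
          rw [norm_smul, norm_smul, Real.norm_eq_abs (θ x)]
      _ ≤ K * (K * dist x y) + (K * dist x y) * K := by
          gcongr
          exacts [h.abs_theta_le x, h.norm_B_le y]
      _ = _ := by push_cast; ring
  have hYK : ∀ x, ‖θ x • B x‖ ≤ (K:ℝ) * K := fun x => by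
    rw [norm_smul]; exact mul_le_mul (h.abs_theta_le x) (h.norm_B_le x) (norm_nonneg _) K.2
  have I1 := integral_fderiv_apply_eq_neg_divergence hY hYK hv.contDiff_psi hv.int_psi
    hv.int_fderiv_psi
  -- the negative part of the weight
  have hneg : LipschitzWith K fun x => max (-θ x) 0 := h.lip_theta.neg.max_const 0
  have hnegc : HasCompactSupport fun x => max (-θ x) 0 := by
    refine HasCompactSupport.intro (isCompact_closedBall (0 : Rd d) K) fun x hx => ?_
    refine max_eq_right ?_
    by_contra h'
    exact hx (by simpa using (h.bounded x ((h.mem_iff x).2 (by linarith))).le)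
  have I2 := integral_fderiv_apply_of_compact h.lip_B hneg hnegc
  have A1 : Integrable (fun x => fderiv ℝ (psi W v) x (θ x • B x)) :=
    integrable_clm_apply_of_bounded hv.int_fderiv_psi hY.continuous.aestronglyMeasurable
      (.of_forall hYK)
  have A2 : Integrable (fun x => divergence (fun x => θ x • B x) x * psi W v x) :=
    hv.int_psi.bdd_mul (measurable_divergence _).aestronglyMeasurable
      (.of_forall (abs_divergence_le hY))
  have hcs : ∀ x ∉ tsupport (fun x => max (-θ x) 0), fderiv ℝ (fun x => max (-θ x) 0) x = 0 :=
    fun x hx => fderiv_eq_zero_of_notMem_tsupport hx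
  have A3 : Integrable (fun x => fderiv ℝ (fun x => max (-θ x) 0) x (B x)) := by
    refine integrable_of_bounded_of_compact hnegc.isCompact
      (isBoundedBilinearMap_apply.continuous.comp_aestronglyMeasurable₂
        (measurable_fderiv ℝ _).aestronglyMeasurable h.lip_B.continuous.aestronglyMeasurable)
      (K * K) (.of_forall fun x _ => ?_) fun x hx => by rw [hcs x hx]; rfl
    exact (ContinuousLinearMap.le_opNorm _ _).trans
      (mul_le_mul (norm_fderiv_le_of_lipschitz ℝ hneg) (h.norm_B_le x) (norm_nonneg _) K.2)
  have A4 : Integrable (fun x => divergence B x * max (-θ x) 0) :=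
    (hneg.continuous.integrable_of_hasCompactSupport hnegc).bdd_mul
      (measurable_divergence _).aestronglyMeasurable (.of_forall h.abs_div_B_le)
  have key : ∫ x, (phaseError W Ω v x * fderiv ℝ θ x (B x) + θ x * fderiv ℝ (psi W v) x (B x)
      + divergence B x * (phaseError W Ω v x * θ x))
      = ∫ x, ((fderiv ℝ (psi W v) x (θ x • B x) + divergence (fun x => θ x • B x) x * psi W v x)
        + (fderiv ℝ (fun x => max (-θ x) 0) x (B x) + divergence B x * max (-θ x) 0)) := by
    refine integral_congr_ae ?_
    filter_upwards [h.lip_B.ae_differentiableAt (μ := volume),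
      h.lip_theta.ae_differentiableAt (μ := volume),
      hneg.ae_differentiableAt (μ := volume)] with x hB hθ hn
    have hdiv : divergence (fun x => θ x • B x) x = θ x * divergence B x + fderiv ℝ θ x (B x) := by
      have hD : fderiv ℝ (fun y => θ y • B y) x
          = θ x • fderiv ℝ B x + (fderiv ℝ θ x).smulRight (B x) := fderiv_fun_smul hθ hB
      simp only [divergence, hD, clm_apply_eq_sum_mul (fderiv ℝ θ x) (B x)]
      simp only [_root_.add_apply, _root_.smul_apply, ContinuousLinearMap.smulRight_apply,
        PiLp.add_apply, PiLp.smul_apply, smul_eq_mul, Finset.sum_add_distrib, Finset.mul_sum,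
        mul_comm]
    have hnd : fderiv ℝ (fun x => max (-θ x) 0) x
        = -(Ω.indicator (fun _ => (1 : ℝ)) x • fderiv ℝ θ x) := by
      -- At a zero of `θ` the function `max(−θ, 0)` has a minimum, so its derivative vanishes there,
      -- in agreement with `x ∉ Ω`.
      rcases lt_trichotomy (θ x) 0 with h0 | h0 | h0
      · have : (fun x => max (-θ x) 0) =ᶠ[𝓝 x] fun x => -θ x := by
          filter_upwards [h.lip_theta.continuous.continuousAt.eventually_lt continuousAt_const h0]
            with y hy
          exact max_eq_left (by linarith)
        rw [this.fderiv_eq, fderiv_fun_neg, indicator_of_mem ((h.mem_iff x).2 h0), one_smul]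
      · have hmin : IsLocalMin (fun x => max (-θ x) 0) x := by
          refine .of_forall fun y => ?_
          simp [h0]
        rw [hmin.fderiv_eq_zero, indicator_of_notMem fun h' => by
          have := (h.mem_iff x).1 h'; linarith]
        simp
      · have : (fun x => max (-θ x) 0) =ᶠ[𝓝 x] fun _ => 0 := by
          filter_upwards [continuousAt_const.eventually_lt h.lip_theta.continuous.continuousAt h0]
            with y hy
          exact max_eq_right (by linarith)
        rw [this.fderiv_eq, indicator_of_notMem fun h' => by
          have := (h.mem_iff x).1 h'; linarith]
        simp
    have hmax : max (-θ x) 0 = -(Ω.indicator (fun _ => (1 : ℝ)) x * θ x) := by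
      by_cases hx : x ∈ Ω
      · rw [indicator_of_mem hx, one_mul, max_eq_left]
        have := (h.mem_iff x).1 hx; linarith
      · rw [indicator_of_notMem hx, zero_mul, neg_zero, max_eq_right]
        have : 0 ≤ θ x := not_lt.1 fun h' => hx ((h.mem_iff x).2 h')
        linarith
    rw [hdiv, hnd, hmax]
    simp only [phaseError, map_smul, _root_.neg_apply, _root_.smul_apply, smul_eq_mul]
    ring
  have A12 : Integrable (fun x => fderiv ℝ (psi W v) x (θ x • B x)
    + divergence (fun x => θ x • B x) x * psi W v x) := A1.add A2
  have A34 : Integrable (fun x => fderiv ℝ (fun x => max (-θ x) 0) x (B x)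
    + divergence B x * max (-θ x) 0) := A3.add A4
  rw [key, integral_add A12 A34, integral_add A1 A2, integral_add A3 A4, I1, I2]
  ring

/-- The total normal flux of the interface is controlled by the volume error. -/
lemma abs_integral_flux_le (h : SliceControl K m Ω δ θ θt ξ B ξt l)
    (hv : SolutionSlice W ε m lε v V) :
    |∫ x, fderiv ℝ (psi W v) x (B x)| ≤ K ^ 2 * ∫ x, phaseError W Ω v x * θ x := by
  obtain ⟨c, hc⟩ := h.div_B
  have hz := h.int_phaseError hv
  have hdm := (measurable_divergence B).aestronglyMeasurable (μ := (volume : Measure (Rd d)))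
  rw [integral_fderiv_apply_eq_neg_divergence h.lip_B h.norm_B_le hv.contDiff_psi hv.int_psi
    hv.int_fderiv_psi]
  have i1 : Integrable (fun x => divergence B x * phaseError W Ω v x) :=
    hz.bdd_mul hdm (.of_forall h.abs_div_B_le)
  have i2 : Integrable (fun x => divergence B x * Ω.indicator (fun _ => (1:ℝ)) x) :=
    h.int_indicator.bdd_mul hdm (.of_forall h.abs_div_B_le)
  -- Subtracting `χ` is free since `∫_Ω ∇·B = 0`, and subtracting `c` is free since `ψ` and `χ` have
  -- equal mass. The remaining factor `∇·B − c` is `O(δ)`, and `δ ≤ K|θ|`.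
  have e1 : ∫ x, divergence B x * psi W v x = ∫ x, (divergence B x - c) * phaseError W Ω v x := by
    have e2 : ∫ x, divergence B x * Ω.indicator (fun _ => (1:ℝ)) x = 0 := by
      rw [← h.integral_div, ← integral_indicator h.measurableSet]
      refine integral_congr_ae (.of_forall fun x => ?_)
      by_cases hx : x ∈ Ω <;> simp [hx]
    have e3 : ∫ x, c * phaseError W Ω v x = 0 := by
      rw [integral_const_mul, h.integral_phaseError hv, mul_zero]
    simp_rw [sub_mul]
    rw [integral_sub i1 (hz.const_mul c), e3, sub_zero, ← add_zero (∫ x, _ * phaseError W Ω v x),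
      ← e2, ← integral_add i1 i2]
    refine integral_congr_ae (.of_forall fun x => ?_)
    simp only [phaseError]; ring
  rw [abs_neg, e1, ← integral_const_mul]
  refine (abs_integral_le_integral_abs).trans
    (integral_mono_ae ?_ ((h.int_phaseError_mul hv).const_mul _) ?_)
  · refine (Integrable.abs ?_)
    simp_rw [sub_mul]
    exact i1.sub (hz.const_mul c)
  · filter_upwards [hc] with x hx
    rw [abs_mul, ← h.abs_mul_abs hv]
    have := mul_le_mul_of_nonneg_right (hx.trans (mul_le_mul_of_nonneg_left (h.le_theta x) K.2))
      (abs_nonneg (phaseError W Ω v x))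
    nlinarith

/-- When the volume error is small, the flux of `arctanField` does not degenerate. -/
lemma le_abs_integral_arctan_flux (h : SliceControl K m Ω δ θ θt ξ B ξt l)
    (hv : SolutionSlice W ε m lε v V) (i : Fin d)
    (hF : 2 * K * ∫ x, phaseError W Ω v x * θ x ≤ m) :
    m / (2 * (1 + K ^ 2)) ≤ |∫ x, fderiv ℝ (psi W v) x (arctanField i x)| := by
  rw [integral_fderiv_apply_eq_neg_divergence (lipschitzWith_arctanField i)
    (norm_arctanField_le i) hv.contDiff_psi hv.int_psi hv.int_fderiv_psi, abs_neg]
  refine le_trans ?_ (le_abs_self _)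
  have hzθ := h.int_phaseError_mul hv
  -- Pointwise: in the ball of radius `K` the divergence is at least `1/(1 + K²)`; outside it `χ =
  -- 0` and `1 = δ ≤ K|θ|`, so `ψ ≤ K(ψ − χ)θ` and the left integrand is nonpositive. The left
  -- integral is `(m − KF)/(1 + K²)`, and `KF ≤ m/2`.
  have hle : ∫ x, 1 / (1 + (K:ℝ) ^ 2) * (psi W v x - K * (phaseError W Ω v x * θ x))
      ≤ ∫ x, divergence (arctanField i) x * psi W v x := by
    refine integral_mono ((hv.int_psi.sub (hzθ.const_mul _)).const_mul _)
      (hv.int_psi.bdd_mul (measurable_divergence _).aestronglyMeasurable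
        (.of_forall (abs_divergence_le (lipschitzWith_arctanField i)))) fun x => ?_
    have hp := (hv.psi_mem x).1
    have h0 : 0 ≤ phaseError W Ω v x * θ x := by rw [← h.abs_mul_abs hv]; positivity
    have hd : 0 ≤ divergence (arctanField i) x := by
      rw [divergence_arctanField]; positivity
    have hK := K.2
    simp only
    rcases le_or_gt (K:ℝ) ‖x‖ with hx | hx
    · have hxΩ : psi W v x ≤ K * (phaseError W Ω v x * θ x) := by
        have h1 := h.le_theta x
        rw [h.delta_far x hx] at h1
        have hn : x ∉ Ω := fun h' => absurd (h.bounded x h') (not_lt.2 hx)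
        rw [← h.abs_mul_abs hv]
        have hz : phaseError W Ω v x = psi W v x := by
          simp [phaseError, indicator_of_notMem hn]
        rw [hz, abs_of_nonneg hp]
        nlinarith
      have : 1 / (1 + (K:ℝ) ^ 2) * (psi W v x - K * (phaseError W Ω v x * θ x)) ≤ 0 :=
        mul_nonpos_of_nonneg_of_nonpos (by positivity) (by linarith)
      exact this.trans (mul_nonneg hd hp)
    · have h1 : 1 / (1 + (K:ℝ) ^ 2) ≤ divergence (arctanField i) x := by
        rw [divergence_arctanField]
        have h2 : |x i| ≤ K := (abs_coord_le x i).trans hx.le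
        have h3 : x i ^ 2 ≤ (K:ℝ) ^ 2 := by rw [← sq_abs]; exact pow_le_pow_left₀ (abs_nonneg _) h2 2
        exact one_div_le_one_div_of_le (by positivity) (by linarith)
      calc 1 / (1 + (K:ℝ) ^ 2) * (psi W v x - K * (phaseError W Ω v x * θ x))
          ≤ 1 / (1 + (K:ℝ) ^ 2) * psi W v x :=
            mul_le_mul_of_nonneg_left (by nlinarith [mul_nonneg hK h0]) (by positivity)
        _ ≤ _ := mul_le_mul_of_nonneg_right h1 hp
  refine le_trans ?_ hle
  rw [integral_const_mul, integral_sub hv.int_psi (hzθ.const_mul _), integral_const_mul, hv.mass]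
  rw [div_le_iff₀ (by positivity)]
  field_simp
  linarith

end SliceControl

/-! ### Polar variables for the gradient. -/

namespace SolutionSlice

variable {W : ℝ → ℝ} {ε m lε : ℝ} {v V : Rd d → ℝ}

/-- Polar decomposition of the gradient, in the natural scaling of the energy. -/
lemma exists_polar (h : SolutionSlice W ε m lε v V) (x : Rd d) :
    ∃ (a b y : ℝ) (n : Rd d), 0 ≤ a ∧ 0 ≤ b ∧ ‖n‖ ≤ 1 ∧
      (∀ w, fderiv ℝ (psi W v) x w = -(a * b * inner ℝ n w)) ∧
      energyDensity W ε v x = (a ^ 2 + b ^ 2) / 2 ∧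
      Real.sqrt (2 * W (v x)) * V x = b * y ∧ ε * V x ^ 2 = y ^ 2 ∧
      (∀ w, ε * V x * fderiv ℝ v x w = -(a * y * inner ℝ n w)) ∧
      ∀ A : Rd d →L[ℝ] Rd d, ε * fderiv ℝ v x (A (gradient v x)) = a ^ 2 * inner ℝ n (A n) := by
  -- The scaling by `√ε` makes the energy density `(a² + b²)/2` and `∇ψ = −ab n`, which frees the
  -- later estimates of `ε` and `W`. At a critical point `n = 0`, since `0⁻¹ = 0`; this is why only
  -- `‖n‖ ≤ 1` is claimed.
  obtain ⟨s, hs⟩ : ∃ s, s = Real.sqrt ε := ⟨_, rfl⟩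
  have hs0 : 0 < s := hs ▸ Real.sqrt_pos.2 h.pos
  have hsε : ε = s ^ 2 := by rw [hs, Real.sq_sqrt h.pos.le]
  have hg0 : 0 ≤ Real.sqrt (2 * W (v x)) := Real.sqrt_nonneg _
  have hg2 := h.well.sqrt_sq (v x)
  have hgr : gradient v x = -(‖gradient v x‖ • (-(‖gradient v x‖⁻¹ • gradient v x))) := by
    by_cases h0 : gradient v x = 0
    · simp [h0]
    · rw [smul_neg, neg_neg, smul_smul, mul_inv_cancel₀ (norm_ne_zero_iff.2 h0), one_smul]
  obtain ⟨n, hn⟩ : ∃ n, n = -(‖gradient v x‖⁻¹ • gradient v x) := ⟨_, rfl⟩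
  rw [← hn] at hgr
  have hfd : ∀ w, fderiv ℝ v x w = -(‖gradient v x‖ * inner ℝ n w) := by
    intro w
    rw [← inner_gradient_left]
    conv_lhs => rw [hgr]
    rw [inner_neg_left, real_inner_smul_left]
  refine ⟨s * ‖gradient v x‖, Real.sqrt (2 * W (v x)) / s, s * V x, n, by positivity,
    by positivity, ?_, ?_, ?_, ?_, ?_, ?_, ?_⟩
  · rw [hn, norm_neg, norm_smul, norm_inv, norm_norm]
    exact inv_mul_le_one
  · intro w
    rw [h.well.fderiv_psi_apply h.contDiff_one, hfd]
    field_simp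
  · simp only [energyDensity]
    rw [mul_pow, div_pow, hg2, hsε]
    field_simp
  · field_simp
  · rw [hsε]; ring
  · intro w
    rw [hfd, hsε]; ring
  · intro A
    rw [hfd, hsε]
    have : A (gradient v x) = -(‖gradient v x‖ • A n) := by
      conv_lhs => rw [hgr]
      simp
    rw [this, inner_neg_right, real_inner_smul_right]
    ring

end SolutionSlice

/-! ### Estimates of the rate at a fixed time. -/

namespace SliceControl

variable {K : NNReal} {m : ℝ} {Ω : Set (Rd d)} {δ θ θt : Rd d → ℝ} {ξ B ξt : Rd d → Rd d} {l : ℝ}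
  {W : ℝ → ℝ} {ε lε : ℝ} {v V : Rd d → ℝ}

lemma integrable_rateDensity (h : SliceControl K m Ω δ θ θt ξ B ξt l)
    (hv : SolutionSlice W ε m lε v V) : Integrable (rateDensity W ε Ω θ θt ξ ξt v V) := by
  have i1 := (hv.int_V_sq.const_mul ε).neg
  have i2 := integrable_clm_apply_of_bounded hv.int_fderiv_psi h.meas_xit h.norm_xit_le
  have i3 : Integrable (fun x => divergence ξ x * (Real.sqrt (2 * W (v x)) * V x)) :=
    hv.int_sqrt_mul_V.bdd_mul (measurable_divergence ξ).aestronglyMeasurable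
      (.of_forall h.abs_div_xi_le)
  have i4 : Integrable (fun x => θ x * (Real.sqrt (2 * W (v x)) * V x)) :=
    hv.int_sqrt_mul_V.bdd_mul h.lip_theta.continuous.aestronglyMeasurable
      (.of_forall h.abs_theta_le)
  have i5 : Integrable (fun x => phaseError W Ω v x * θt x) :=
    (h.int_phaseError hv).mul_bdd h.meas_thetat h.abs_thetat_le
  exact (((i1.add i2).sub i3).add i4).add i5

lemma int_relative (h : SliceControl K m Ω δ θ θt ξ B ξt l) (hv : SolutionSlice W ε m lε v V) :
    Integrable (fun x => energyDensity W ε v x + fderiv ℝ (psi W v) x (ξ x)) :=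
  hv.int_energy.add (integrable_clm_apply_of_bounded hv.int_fderiv_psi
    h.lip_xi.continuous.aestronglyMeasurable (.of_forall h.norm_xi_le))

lemma relative_nonneg (h : SliceControl K m Ω δ θ θt ξ B ξt l) (hv : SolutionSlice W ε m lε v V)
    (x : Rd d) : 0 ≤ energyDensity W ε v x + fderiv ℝ (psi W v) x (ξ x) := by
  obtain ⟨a, b, y, n, ha, hb, hn, h1, h2, -⟩ := hv.exists_polar x
  rw [h1, h2]
  have : inner ℝ n (ξ x) ≤ (1:ℝ) := (real_inner_le_norm _ _).trans
    (mul_le_one₀ hn (norm_nonneg _) (h.norm_xi_le x))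
  nlinarith [mul_le_mul_of_nonneg_left this (mul_nonneg ha hb), sq_nonneg (a - b)]

/-- The estimate of the rate in terms of the amount `α` of the correction field needed to cancel
the flux of `B`. -/
lemma integral_rate_le_of_correction (h : SliceControl K m Ω δ θ θt ξ B ξt l)
    (hv : SolutionSlice W ε m lε v V) (i : Fin d) {α : ℝ}
    (hα : α * ∫ x, fderiv ℝ (psi W v) x (arctanField i x) = ∫ x, fderiv ℝ (psi W v) x (B x)) :
    ∫ x, rateDensity W ε Ω θ θt ξ ξt v V x ≤
      -(l * ∫ x, fderiv ℝ (psi W v) x (B x))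
      + (100 * (K:ℝ) ^ 3 * ∫ x, (energyDensity W ε v x + fderiv ℝ (psi W v) x (ξ x)))
      + (2 * (K:ℝ) ^ 2 * ∫ x, phaseError W Ω v x * θ x)
      + 10 * (K:ℝ) ^ 2 * ((|α| + α ^ 2) * ∫ x, energyDensity W ε v x) := by
  have hK1 : (1:ℝ) ≤ K := by linarith [h.two_le]
  have hX1 : LipschitzWith K (arctanField i) :=
    (lipschitzWith_arctanField i).weaken (by exact_mod_cast hK1)
  have hXK : ∀ x, ‖arctanField i x‖ ≤ K := fun x => (norm_arctanField_le i x).trans h.two_le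
  have hdX : ∀ x, |divergence (arctanField i) x| ≤ K := fun x => by
    rw [divergence_arctanField, abs_of_nonneg (by positivity)]
    exact ((div_le_one (by positivity)).2 (by nlinarith [sq_nonneg (x i)])).trans hK1
  have hstress : ∀ Y : Rd d → Rd d, LipschitzWith K Y → (∀ x, ‖Y x‖ ≤ K) →
      Integrable (fun x => energyDensity W ε v x * divergence Y x
          - ε * fderiv ℝ v x (fderiv ℝ Y x (gradient v x))) := fun Y hY hYK =>
    (hv.int_energy.mul_bdd (measurable_divergence Y).aestronglyMeasurable
      (.of_forall (abs_divergence_le hY))).sub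
      ((integrable_fderiv_fderiv_gradient hv.contDiff_one hv.int_grad hY).const_mul ε)
  have hvel : ∀ Y : Rd d → Rd d, LipschitzWith K Y → (∀ x, ‖Y x‖ ≤ K) →
      Integrable (fun x => ε * V x * fderiv ℝ v x (Y x)) := fun Y hY hYK =>
    ((MemLp.integrable_mul_fderiv hv.memLp_V hv.contDiff_one hv.int_grad hY.continuous
      hYK).const_mul ε).congr (.of_forall fun x => by simp only; ring)
  have hflux : ∀ Y : Rd d → Rd d, Continuous Y → (∀ x, ‖Y x‖ ≤ K) →
      Integrable (fun x => fderiv ℝ (psi W v) x (Y x)) := fun Y hY hYK =>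
    integrable_clm_apply_of_bounded hv.int_fderiv_psi hY.aestronglyMeasurable (.of_forall hYK)
  -- the null terms
  have i0 := h.integrable_rateDensity hv
  have i1 : Integrable (fun x => l * (Real.sqrt (2 * W (v x)) * V x)) :=
    hv.int_sqrt_mul_V.const_mul l
  have z1 : ∫ x, l * (Real.sqrt (2 * W (v x)) * V x) = 0 := by
    rw [integral_const_mul, hv.orthogonal, mul_zero]
  have z2 := integral_fderiv_commutator (K := K) h.lip_B h.lip_xi h.norm_B_le
    (fun x => (h.norm_xi_le x).trans hK1) hv.contDiff_psi hv.int_psi hv.int_fderiv_psi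
  have i2 : Integrable (fun x => fderiv ℝ (psi W v) x (fderiv ℝ ξ x (B x) + divergence B x • ξ x
      - fderiv ℝ B x (ξ x) - divergence ξ x • B x)) := by
    refine integrable_clm_apply_of_bounded (K := K * K + K * 1 + K * 1 + K * K) hv.int_fderiv_psi
      ((((measurable_fderiv_apply_field h.lip_B.continuous.measurable).add
      ((measurable_divergence B).smul h.lip_xi.continuous.measurable)).sub
      (measurable_fderiv_apply_field h.lip_xi.continuous.measurable)).sub
      ((measurable_divergence ξ).smul h.lip_B.continuous.measurable)).aestronglyMeasurable
      (.of_forall fun x => ?_)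
    have n1 : ‖fderiv ℝ ξ x (B x)‖ ≤ (K:ℝ) * K := ((fderiv ℝ ξ x).le_opNorm _).trans
      (mul_le_mul (norm_fderiv_le_of_lipschitz ℝ h.lip_xi) (h.norm_B_le x) (norm_nonneg _) K.2)
    have n2 : ‖fderiv ℝ B x (ξ x)‖ ≤ (K:ℝ) * 1 := ((fderiv ℝ B x).le_opNorm _).trans
      (mul_le_mul (norm_fderiv_le_of_lipschitz ℝ h.lip_B) (h.norm_xi_le x) (norm_nonneg _) K.2)
    have n3 : ‖divergence B x • ξ x‖ ≤ (K:ℝ) * 1 := by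
      rw [norm_smul]
      exact mul_le_mul (h.abs_div_B_le x) (h.norm_xi_le x) (norm_nonneg _) K.2
    have n4 : ‖divergence ξ x • B x‖ ≤ (K:ℝ) * K := by
      rw [norm_smul]
      exact mul_le_mul (h.abs_div_xi_le x) (h.norm_B_le x) (norm_nonneg _) K.2
    exact (norm_sub_le _ _).trans (add_le_add ((norm_sub_le _ _).trans
      (add_le_add ((norm_add_le _ _).trans (add_le_add n1 n3)) n2)) n4)
  -- Unlike its neighbours this term does not integrate to zero. It is added so that, as in the term
  -- with `V`, `∇·ξ` enters only through `∇·ξ − l`, and it is paid for by the first term of the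
  -- bound.
  have i3 : Integrable (fun x => l * fderiv ℝ (psi W v) x (B x)) :=
    (hflux B h.lip_B.continuous h.norm_B_le).const_mul l
  have i4 : Integrable (fun x => (energyDensity W ε v x * divergence B x
          - ε * fderiv ℝ v x (fderiv ℝ B x (gradient v x))) - ε * V x * fderiv ℝ v x (B x)) :=
    (hstress B h.lip_B h.norm_B_le).sub (hvel B h.lip_B h.norm_B_le)
  have i5 : Integrable (fun x => α * ((energyDensity W ε v x * divergence (arctanField i) x
      - ε * fderiv ℝ v x (fderiv ℝ (arctanField i) x (gradient v x)))
      - ε * V x * fderiv ℝ v x (arctanField i x))) :=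
    ((hstress _ hX1 hXK).sub (hvel _ hX1 hXK)).const_mul α
  have z6 := h.integral_phaseError_transport hv
  have i6 : Integrable (fun x => phaseError W Ω v x * fderiv ℝ θ x (B x)
      + θ x * fderiv ℝ (psi W v) x (B x) + divergence B x * (phaseError W Ω v x * θ x)) := by
    refine (((h.int_phaseError hv).mul_bdd (c := K * K)
      (isBoundedBilinearMap_apply.continuous.comp_aestronglyMeasurable₂
        (measurable_fderiv ℝ θ).aestronglyMeasurable h.lip_B.continuous.aestronglyMeasurable)
      (.of_forall fun x => ?_)).add ((hflux B h.lip_B.continuous h.norm_B_le).bdd_mul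
        h.lip_theta.continuous.aestronglyMeasurable (.of_forall h.abs_theta_le))).add
      ((h.int_phaseError_mul hv).bdd_mul (measurable_divergence B).aestronglyMeasurable
        (.of_forall h.abs_div_B_le))
    exact (ContinuousLinearMap.le_opNorm _ _).trans (mul_le_mul
      (norm_fderiv_le_of_lipschitz ℝ h.lip_theta) (h.norm_B_le x) (norm_nonneg _) K.2)
  have z4 : ∫ x, ((energyDensity W ε v x * divergence B x
          - ε * fderiv ℝ v x (fderiv ℝ B x (gradient v x))) - ε * V x * fderiv ℝ v x (B x))
      = -(ε * lε * ∫ x, fderiv ℝ (psi W v) x (B x)) := by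
    rw [integral_sub (hstress B h.lip_B h.norm_B_le) (hvel B h.lip_B h.norm_B_le),
      hv.integral_velocity_mul_fderiv h.lip_B h.norm_B_le]
    ring
  -- By the choice of `α` this equals the value in `z4`. Subtracting the correction therefore
  -- cancels the uncontrolled multiplier `lε`.
  have z5 : ∫ x, α * ((energyDensity W ε v x * divergence (arctanField i) x
      - ε * fderiv ℝ v x (fderiv ℝ (arctanField i) x (gradient v x)))
      - ε * V x * fderiv ℝ v x (arctanField i x))
      = -(ε * lε * ∫ x, fderiv ℝ (psi W v) x (B x)) := by
    rw [integral_const_mul, integral_sub (hstress _ hX1 hXK) (hvel _ hX1 hXK),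
      hv.integral_velocity_mul_fderiv hX1 hXK, ← hα]
    ring
  -- the pointwise estimate
  have irhs : Integrable (fun x => 100 * (K:ℝ) ^ 3 * (energyDensity W ε v x
      + fderiv ℝ (psi W v) x (ξ x)) + 2 * (K:ℝ) ^ 2 * (phaseError W Ω v x * θ x)
      + 10 * (K:ℝ) ^ 2 * ((|α| + α ^ 2) * energyDensity W ε v x)) :=
    (((h.int_relative hv).const_mul _).add ((h.int_phaseError_mul hv).const_mul _)).add
      ((hv.int_energy.const_mul _).const_mul _)
  have hpt : ∀ᵐ x, rateDensity W ε Ω θ θt ξ ξt v V x + l * (Real.sqrt (2 * W (v x)) * V x)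
      + fderiv ℝ (psi W v) x (fderiv ℝ ξ x (B x) + divergence B x • ξ x
        - fderiv ℝ B x (ξ x) - divergence ξ x • B x)
      + l * fderiv ℝ (psi W v) x (B x)
      + ((energyDensity W ε v x * divergence B x
          - ε * fderiv ℝ v x (fderiv ℝ B x (gradient v x))) - ε * V x * fderiv ℝ v x (B x))
      - α * ((energyDensity W ε v x * divergence (arctanField i) x
        - ε * fderiv ℝ v x (fderiv ℝ (arctanField i) x (gradient v x)))
        - ε * V x * fderiv ℝ v x (arctanField i x))
      + (phaseError W Ω v x * fderiv ℝ θ x (B x)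
        + θ x * fderiv ℝ (psi W v) x (B x) + divergence B x * (phaseError W Ω v x * θ x))
      ≤ 100 * (K:ℝ) ^ 3 * (energyDensity W ε v x
      + fderiv ℝ (psi W v) x (ξ x)) + 2 * (K:ℝ) ^ 2 * (phaseError W Ω v x * θ x)
      + 10 * (K:ℝ) ^ 2 * ((|α| + α ^ 2) * energyDensity W ε v x) := by
    filter_upwards [h.xi_xi_B, h.evolution, h.transport_theta, h.transport_length, h.transport_xi]
      with x q1 q2 q3 q4 q5
    obtain ⟨a, b, y, n, ha, hb, hn, p1, p2, p3, p4, p5, p6⟩ := hv.exists_polar x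
    obtain ⟨r, hr⟩ : ∃ r, r = ξt x + fderiv ℝ ξ x (B x)
      + ContinuousLinearMap.adjoint (fderiv ℝ B x) (ξ x) := ⟨_, rfl⟩
    have hadj : ∀ w, inner ℝ (ContinuousLinearMap.adjoint (fderiv ℝ B x) (ξ x)) w
        = inner ℝ (ξ x) (fderiv ℝ B x w) := fun w =>
      ContinuousLinearMap.adjoint_inner_left _ _ _
    rw [← hr] at q5
    have hrξ : |inner ℝ r (ξ x) - inner ℝ (ξ x) (fderiv ℝ B x (ξ x))| ≤ K * δ x ^ 2 := by
      rw [hr, inner_add_left, inner_add_left, hadj, add_sub_cancel_right]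
      exact q4
    have key := pointwise_dissipation_le hK1 (y := y) (α := α) (X := arctanField i x)
      (A' := fderiv ℝ (arctanField i) x)
      ha hb (h.delta_nonneg x) (h.delta_le_one x) hn (h.norm_xi_le x) (h.short x)
      (norm_fderiv_le_of_lipschitz ℝ h.lip_B) (norm_fderiv_le_of_lipschitz ℝ hX1)
      (h.norm_B_le x) (hXK x) q1 q5 hrξ (h.abs_div_xi_sub_le x) q2 (h.theta_le x)
      (h.abs_div_B_le x) (hdX x) q3 (h.abs_mul_abs hv x) (h.le_theta x)
    -- This eliminates `ξt` in favour of the transport error `r`; the adjoint in `r` produces the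
    -- term `ξ·(∇B)n` of the pointwise estimate.
    have hrn : inner ℝ r n = inner ℝ n (ξt x) + inner ℝ n (fderiv ℝ ξ x (B x))
        + inner ℝ (ξ x) (fderiv ℝ B x n) := by
      rw [hr, inner_add_left, inner_add_left, hadj, real_inner_comm n, real_inner_comm n]
    rw [hrn] at key
    simp only [rateDensity]
    rw [p3, p4, p5, p5, p6, p6, p2]
    simp only [p1, inner_add_right, inner_sub_right, real_inner_smul_right]
    rw [real_inner_comm n (B x), real_inner_comm n (arctanField i x), real_inner_comm n (ξ x),
      real_inner_comm n (fderiv ℝ B x (ξ x))] at key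
    linarith
  have j12 : Integrable (fun x => 100 * (K:ℝ) ^ 3 * (energyDensity W ε v x
      + fderiv ℝ (psi W v) x (ξ x)) + 2 * (K:ℝ) ^ 2 * (phaseError W Ω v x * θ x)) :=
    ((h.int_relative hv).const_mul _).add ((h.int_phaseError_mul hv).const_mul _)
  have hint := integral_mono_ae (((((((i0.add i1).add i2).add i3).add i4).sub i5).add i6)) irhs hpt
  rw [integral_add' (((((i0.add i1).add i2).add i3).add i4).sub i5) i6,
    integral_sub' ((((i0.add i1).add i2).add i3).add i4) i5,
    integral_add' (((i0.add i1).add i2).add i3) i4, integral_add' ((i0.add i1).add i2) i3,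
    integral_add' (i0.add i1) i2, integral_add' i0 i1, z1, z2, z4, z5, z6, integral_const_mul,
    integral_add j12
      ((hv.int_energy.const_mul _).const_mul _),
    integral_add ((h.int_relative hv).const_mul _) ((h.int_phaseError_mul hv).const_mul _),
    integral_const_mul, integral_const_mul, integral_const_mul, integral_const_mul] at hint
  linarith

/-- The crude estimate of the rate by the full energy. -/
lemma integral_rate_le_energy (h : SliceControl K m Ω δ θ θt ξ B ξt l)
    (hv : SolutionSlice W ε m lε v V) :
    ∫ x, rateDensity W ε Ω θ θt ξ ξt v V x ≤
      (3 * (K:ℝ) ^ 2 * ∫ x, energyDensity W ε v x) + 2 * K * m := by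
  have hK1 : (1:ℝ) ≤ K := by linarith [h.two_le]
  have iz : Integrable (fun x => psi W v x + Ω.indicator (fun _ => (1:ℝ)) x) :=
    hv.int_psi.add h.int_indicator
  have e : (3 * (K:ℝ) ^ 2 * ∫ x, energyDensity W ε v x) + 2 * K * m
      = ∫ x, (3 * (K:ℝ) ^ 2 * energyDensity W ε v x
        + K * (psi W v x + Ω.indicator (fun _ => (1:ℝ)) x)) := by
    rw [integral_add (hv.int_energy.const_mul _) (iz.const_mul _), integral_const_mul,
      integral_const_mul, integral_add hv.int_psi h.int_indicator, hv.mass,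
      h.integral_indicator_one]
    ring
  rw [e]
  refine integral_mono_ae (h.integrable_rateDensity hv)
    ((hv.int_energy.const_mul _).add (iz.const_mul _)) ?_
  filter_upwards [h.norm_xit_le, h.abs_thetat_le] with x hx1 hx2
  obtain ⟨a, b, y, n, ha, hb, hn, p1, p2, p3, p4, p5, p6⟩ := hv.exists_polar x
  simp only [rateDensity]
  rw [p1, p2, p3, p4]
  have f1 : -(a * b * inner ℝ n (ξt x)) ≤ K * ((a ^ 2 + b ^ 2) / 2) := by
    have h1 : |inner ℝ n (ξt x)| ≤ K := (abs_real_inner_le_norm _ _).trans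
      ((mul_le_of_le_one_left (norm_nonneg _) hn).trans hx1)
    have h2 := mul_le_mul_of_nonneg_left ((neg_le_abs _).trans h1) (mul_nonneg ha hb)
    have h3 : a * b ≤ (a ^ 2 + b ^ 2) / 2 := by linarith [sq_nonneg (a - b)]
    have h4 := mul_le_mul_of_nonneg_right h3 (NNReal.coe_nonneg K)
    linarith
  -- Maximizing over `y` gives `((θ − ∇·ξ) b / 2)²`, which is at most `K² b²`; so the dissipation
  -- absorbs the terms that are linear in the velocity.
  have f2 : -y ^ 2 - divergence ξ x * (b * y) + θ x * (b * y)
      ≤ 2 * (K:ℝ) ^ 2 * ((a ^ 2 + b ^ 2) / 2) := by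
    have h1 : |θ x - divergence ξ x| ≤ 2 * K := (abs_sub _ _).trans (by
      linarith [h.abs_theta_le x, h.abs_div_xi_le x])
    have h2 := pow_le_pow_left₀ (abs_nonneg _) h1 2
    rw [sq_abs] at h2
    have h3 := mul_le_mul_of_nonneg_right h2 (sq_nonneg b)
    have h4 := sq_nonneg (y - (θ x - divergence ξ x) * b / 2)
    have h5 : 0 ≤ (K:ℝ) ^ 2 * a ^ 2 := by positivity
    linarith
  have f3 : phaseError W Ω v x * θt x ≤ K * (psi W v x + Ω.indicator (fun _ => (1:ℝ)) x) := by
    have hp := (hv.psi_mem x).1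
    have hi : 0 ≤ Ω.indicator (fun _ => (1:ℝ)) x := indicator_nonneg (fun _ _ => zero_le_one) x
    have h1 : |phaseError W Ω v x| ≤ psi W v x + Ω.indicator (fun _ => (1:ℝ)) x := by
      unfold phaseError
      rw [abs_le]; constructor <;> linarith
    have h2 := le_abs_self (phaseError W Ω v x * θt x)
    rw [abs_mul] at h2
    have h3 := mul_le_mul h1 hx2 (abs_nonneg _) (by linarith)
    linarith
  have f4 : (K:ℝ) * ((a ^ 2 + b ^ 2) / 2) ≤ (K:ℝ) ^ 2 * ((a ^ 2 + b ^ 2) / 2) :=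
    mul_le_mul_of_nonneg_right (le_self_pow₀ hK1 (by norm_num)) (by positivity)
  linarith

/-- The energy is controlled by the relative energy and the enclosed volume. -/
lemma integral_energy_le (h : SliceControl K m Ω δ θ θt ξ B ξt l)
    (hv : SolutionSlice W ε m lε v V) :
    ∫ x, energyDensity W ε v x
      ≤ (∫ x, (energyDensity W ε v x + fderiv ℝ (psi W v) x (ξ x))) + K * m := by
  have i1 := integrable_clm_apply_of_bounded hv.int_fderiv_psi
    h.lip_xi.continuous.aestronglyMeasurable (.of_forall h.norm_xi_le)
  rw [integral_add hv.int_energy i1, integral_fderiv_apply_eq_neg_divergence h.lip_xi h.norm_xi_le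
    hv.contDiff_psi hv.int_psi hv.int_fderiv_psi]
  -- By parts, minus the flux of `ξ` equals `∫ (∇·ξ)ψ`, which is at most `K m` as `ψ ≥ 0` has mass
  -- `m`.
  have : ∫ x, divergence ξ x * psi W v x ≤ ∫ x, K * psi W v x :=
    integral_mono (hv.int_psi.bdd_mul (measurable_divergence ξ).aestronglyMeasurable
      (.of_forall h.abs_div_xi_le)) (hv.int_psi.const_mul _) fun x =>
      mul_le_mul_of_nonneg_right ((le_abs_self _).trans (h.abs_div_xi_le x)) (hv.psi_mem x).1
  rw [integral_const_mul, hv.mass] at this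
  linarith

/-- Both `ψ` and `χ` have mass `m` and the weight is bounded. This a priori bound is what turns the
products `F²` and `F·R` into linear error terms. -/
lemma integral_volumeError_le (h : SliceControl K m Ω δ θ θt ξ B ξt l)
    (hv : SolutionSlice W ε m lε v V) :
    ∫ x, phaseError W Ω v x * θ x ≤ 2 * K * m := by
  have iz : Integrable (fun x => psi W v x + Ω.indicator (fun _ => (1:ℝ)) x) :=
    hv.int_psi.add h.int_indicator
  have e : 2 * (K:ℝ) * m = ∫ x, K * (psi W v x + Ω.indicator (fun _ => (1:ℝ)) x) := by
    rw [integral_const_mul, integral_add hv.int_psi h.int_indicator, hv.mass,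
      h.integral_indicator_one]
    ring
  rw [e]
  refine integral_mono (h.int_phaseError_mul hv) (iz.const_mul _) fun x => ?_
  have hp := (hv.psi_mem x).1
  have hi : 0 ≤ Ω.indicator (fun _ => (1:ℝ)) x := indicator_nonneg (fun _ _ => zero_le_one) x
  have h1 : |phaseError W Ω v x| ≤ psi W v x + Ω.indicator (fun _ => (1:ℝ)) x := by
    unfold phaseError
    rw [abs_le]; constructor <;> linarith
  simp only
  rw [← h.abs_mul_abs hv]
  have h3 := mul_le_mul h1 (h.abs_theta_le x) (abs_nonneg _) (by linarith)
  linarith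

end SliceControl

/-- The relative energy inequality at a fixed time, with a constant that depends only on the
calibration. -/
theorem exists_integral_rate_le (hd : 1 ≤ d) (K : NNReal) (m : ℝ) : ∃ C : ℝ,
    ∀ (Ω : Set (Rd d)) (δ θ θt : Rd d → ℝ) (ξ B ξt : Rd d → Rd d) (l : ℝ),
    SliceControl K m Ω δ θ θt ξ B ξt l →
    ∀ (W : ℝ → ℝ) (ε lε : ℝ) (v V : Rd d → ℝ), SolutionSlice W ε m lε v V →
      ∫ x, rateDensity W ε Ω θ θt ξ ξt v V x ≤
        C * ((∫ x, (energyDensity W ε v x + fderiv ℝ (psi W v) x (ξ x)))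
          + ∫ x, phaseError W Ω v x * θ x) := by
  -- `c0` bounds the flux of `arctanField` from below, `A` is the resulting constant in `|α| ≤ A F`,
  -- and `C1 * (F * E)` bounds the whole cost of the correction.
  obtain ⟨c0, hc0⟩ : ∃ c0, c0 = m / (2 * (1 + (K:ℝ) ^ 2)) := ⟨_, rfl⟩
  obtain ⟨A, hA⟩ : ∃ A, A = (K:ℝ) ^ 2 / c0 := ⟨_, rfl⟩
  obtain ⟨C1, hC1⟩ : ∃ C1, C1 = 10 * (K:ℝ) ^ 2 * ((1 + A * (2 * K * m)) * A) := ⟨_, rfl⟩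
  refine ⟨(K:ℝ) * K ^ 2 + 100 * (K:ℝ) ^ 3 + 2 * (K:ℝ) ^ 2 + C1 * (2 * K * m) + C1 * (K * m)
    + 3 * (K:ℝ) ^ 2 + (3 * (K:ℝ) ^ 2 * K + 2 * K) * (2 * K), ?_⟩
  intro Ω δ θ θt ξ B ξt l h W ε lε v V hv
  obtain ⟨F, hF⟩ : ∃ F, F = ∫ x, phaseError W Ω v x * θ x := ⟨_, rfl⟩
  obtain ⟨R, hR⟩ : ∃ R, R = ∫ x, (energyDensity W ε v x + fderiv ℝ (psi W v) x (ξ x)) := ⟨_, rfl⟩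
  obtain ⟨E, hE⟩ : ∃ E, E = ∫ x, energyDensity W ε v x := ⟨_, rfl⟩
  have hF0 : 0 ≤ F := hF ▸ integral_nonneg fun x => by
    show 0 ≤ phaseError W Ω v x * θ x
    rw [← h.abs_mul_abs hv]; positivity
  have hR0 : 0 ≤ R := hR ▸ integral_nonneg fun x => h.relative_nonneg hv x
  have hER := h.integral_energy_le hv
  have hFm := h.integral_volumeError_le hv
  rw [← hR, ← hE] at hER
  rw [← hF] at hFm
  rw [← hR, ← hF]
  have hm := h.volume_pos
  have hK := K.2
  have hc0' : 0 < c0 := by rw [hc0]; positivity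
  have hA0 : 0 ≤ A := by rw [hA]; positivity
  have hC10 : 0 ≤ C1 := by rw [hC1]; positivity
  have hR1 : 0 ≤ (K:ℝ) * K ^ 2 * R := by positivity
  have hR2 : 0 ≤ (K:ℝ) ^ 2 * R := by positivity
  have hR3 : 0 ≤ C1 * (K * m) * R := by positivity
  have hR4 : 0 ≤ C1 * (2 * K * m) * R := by positivity
  have hR5 : 0 ≤ (K:ℝ) ^ 3 * R := by positivity
  have hR6 : 0 ≤ (3 * (K:ℝ) ^ 2 * K + 2 * K) * (2 * K) * R := by positivity
  have hF1 : 0 ≤ (K:ℝ) * K ^ 2 * F := by positivity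
  have hF2 : 0 ≤ (K:ℝ) ^ 2 * F := by positivity
  have hF3 : 0 ≤ C1 * (K * m) * F := by positivity
  have hF4 : 0 ≤ C1 * (2 * K * m) * F := by positivity
  have hF5 : 0 ≤ (K:ℝ) ^ 3 * F := by positivity
  have hF6 : 0 ≤ (3 * (K:ℝ) ^ 2 * K + 2 * K) * (2 * K) * F := by positivity
  -- For small volume error the correction field is nondegenerate. Otherwise `m < 2KF`, so the
  -- volume `m` itself counts as an error and the crude estimate is enough.
  rcases le_or_gt (2 * K * F) m with hcase | hcase
  · have hX := h.le_abs_integral_arctan_flux hv ⟨0, hd⟩ (by rw [← hF]; exact hcase)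
    have hB := h.abs_integral_flux_le hv
    rw [← hc0] at hX
    rw [← hF] at hB
    obtain ⟨X, hXd⟩ : ∃ X, X = ∫ x, fderiv ℝ (psi W v) x (arctanField ⟨0, hd⟩ x) := ⟨_, rfl⟩
    obtain ⟨b, hbd⟩ : ∃ b, b = ∫ x, fderiv ℝ (psi W v) x (B x) := ⟨_, rfl⟩
    rw [← hXd] at hX
    rw [← hbd] at hB
    have hX0 : X ≠ 0 := by
      intro h0; rw [h0, abs_zero] at hX; linarith
    have hα : |b / X| ≤ A * F := by
      rw [abs_div, hA, div_mul_eq_mul_div]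
      exact div_le_div₀ (by positivity) hB hc0' hX
    have key := h.integral_rate_le_of_correction hv ⟨0, hd⟩ (α := b / X)
      (by rw [← hXd, ← hbd]; field_simp)
    rw [← hbd, ← hR, ← hF, ← hE] at key
    have k1 : -(l * b) ≤ K * K ^ 2 * F := by
      have := neg_le_abs (l * b)
      rw [abs_mul] at this
      have h2 := mul_le_mul h.abs_l_le hB (abs_nonneg _) hK
      linarith
    have hE0 : 0 ≤ E := by
      rw [hE]
      refine integral_nonneg fun x => ?_
      obtain ⟨a, b, y, n, ha, hb, hn, p1, p2, -⟩ := hv.exists_polar x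
      rw [p2]; positivity
    have k2 : 10 * (K:ℝ) ^ 2 * ((|b / X| + (b / X) ^ 2) * E)
        ≤ C1 * (2 * K * m) * R + C1 * (K * m) * F := by
      have g1 : |b / X| + (b / X) ^ 2 ≤ (1 + A * (2 * K * m)) * (A * F) := by
        rw [← sq_abs]
        have g2 : |b / X| ≤ A * (2 * K * m) := hα.trans (mul_le_mul_of_nonneg_left hFm hA0)
        have g3 := mul_le_mul hα g2 (abs_nonneg _) (by positivity)
        nlinarith
      have g2 : F * E ≤ 2 * K * m * R + K * m * F := by
        have g3 := mul_le_mul_of_nonneg_left hER hF0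
        have g4 := mul_le_mul_of_nonneg_right hFm hR0
        linarith
      calc 10 * (K:ℝ) ^ 2 * ((|b / X| + (b / X) ^ 2) * E)
          ≤ 10 * (K:ℝ) ^ 2 * ((1 + A * (2 * K * m)) * (A * F) * E) := by gcongr
        _ = C1 * (F * E) := by rw [hC1]; ring
        _ ≤ C1 * (2 * K * m * R + K * m * F) := mul_le_mul_of_nonneg_left g2 hC10
        _ = _ := by ring
    linarith
  · have key := h.integral_rate_le_energy hv
    rw [← hE] at key
    have k1 := mul_le_mul_of_nonneg_left hER (by positivity : 0 ≤ 3 * (K:ℝ) ^ 2)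
    have k2 := mul_le_mul_of_nonneg_left hcase.le
      (by positivity : 0 ≤ 3 * (K:ℝ) ^ 2 * K + 2 * K)
    linarith

/-! ### Passing to the limit in the fundamental theorem of calculus -/

/-- If absolutely continuous functions `G n` converge pointwise and their derivatives converge
almost everywhere, dominated by an integrable function, then the limits are related by the
fundamental theorem of calculus. -/
lemma integral_eq_sub_of_tendsto_deriv {G D : ℕ → ℝ → ℝ} {G' D' Φ : ℝ → ℝ} {a b : ℝ} (hab : a ≤ b)
    (hAC : ∀ n, AbsolutelyContinuousOnInterval (G n) a b)
    (hd : ∀ n, ∀ᵐ t, t ∈ Ioo a b → HasDerivAt (G n) (D n t) t)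
    (hb : ∀ n, ∀ᵐ t, t ∈ Ioo a b → |D n t| ≤ Φ t) (hΦ : IntervalIntegrable Φ volume a b)
    (hD : ∀ᵐ t, t ∈ Ioo a b → Tendsto (fun n => D n t) atTop (𝓝 (D' t)))
    (hG : ∀ t ∈ Icc a b, Tendsto (fun n => G n t) atTop (𝓝 (G' t))) :
    IntervalIntegrable D' volume a b ∧ ∫ t in a..b, D' t = G' b - G' a := by
  have hne : ∀ᵐ t : ℝ, t ≠ b := by simp [ae_iff, measure_singleton]
  have hI : ∀ n, ∀ᵐ t, t ∈ uIoc a b → deriv (G n) t = D n t := by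
    intro n
    filter_upwards [hd n, hne] with t h1 h2 h3
    rw [uIoc_of_le hab] at h3
    exact (h1 ⟨h3.1, lt_of_le_of_ne h3.2 h2⟩).deriv
  have hint : ∀ n, IntervalIntegrable (D n) volume a b := fun n =>
    (hAC n).intervalIntegrable_deriv.congr_ae
      ((ae_restrict_iff' measurableSet_uIoc).2 (hI n))
  have hval : ∀ n, ∫ t in a..b, D n t = G n b - G n a := fun n => by
    rw [← (hAC n).integral_deriv_eq_sub]
    exact intervalIntegral.integral_congr_ae ((hI n).mono fun t h1 h2 => (h1 h2).symm)
  have hlim : ∀ᵐ t ∂volume.restrict (uIoc a b), Tendsto (fun n => D n t) atTop (𝓝 (D' t)) := by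
    rw [ae_restrict_iff' measurableSet_uIoc, uIoc_of_le hab]
    filter_upwards [hD, hne] with t h1 h2 h3
    exact h1 ⟨h3.1, lt_of_le_of_ne h3.2 h2⟩
  have hb' : ∀ n, ∀ᵐ t ∂volume.restrict (uIoc a b), ‖D n t‖ ≤ Φ t := by
    intro n
    rw [ae_restrict_iff' measurableSet_uIoc, uIoc_of_le hab]
    filter_upwards [hb n, hne] with t h1 h2 h3
    exact h1 ⟨h3.1, lt_of_le_of_ne h3.2 h2⟩
  have hm : AEStronglyMeasurable D' (volume.restrict (uIoc a b)) :=
    aestronglyMeasurable_of_tendsto_ae atTop (fun n => (intervalIntegrable_iff.1 (hint n)).aestronglyMeasurable) hlim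
  refine ⟨hΦ.mono_fun' hm ?_, ?_⟩
  · filter_upwards [hlim, ae_all_iff.2 hb'] with t h1 h2
    exact le_of_tendsto h1.norm (.of_forall h2)
  · have h1 : Tendsto (fun n => ∫ t in a..b, D n t) atTop (𝓝 (∫ t in a..b, D' t)) :=
      intervalIntegral.tendsto_integral_filter_of_dominated_convergence Φ
        (.of_forall fun n => (intervalIntegrable_iff.1 (hint n)).aestronglyMeasurable)
        (.of_forall fun n => (ae_restrict_iff' measurableSet_uIoc).1 (hb' n)) hΦ
        ((ae_restrict_iff' measurableSet_uIoc).1 hlim)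
    simp only [hval] at h1
    exact tendsto_nhds_unique h1
      ((hG b (right_mem_Icc.2 hab)).sub (hG a (left_mem_Icc.2 hab)))

/-- Lebesgue differentiation: the primitive is identically zero and has derivative `D` almost
everywhere. -/
lemma ae_eq_zero_of_intervalIntegral_eq_zero {D : ℝ → ℝ} {a b : ℝ} (hab : a ≤ b)
    (hD : IntervalIntegrable D volume a b) (h : ∀ t ∈ Icc a b, ∫ s in a..t, D s = 0) :
    ∀ᵐ t, t ∈ Ioo a b → D t = 0 := by
  filter_upwards [hD.ae_hasDerivAt_integral] with t ht hab'
  have h1 := ht (by rw [uIcc_of_le hab]; exact Ioo_subset_Icc_self hab') a left_mem_uIcc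
  have h2 : (fun x => ∫ s in a..x, D s) =ᶠ[𝓝 t] fun _ => 0 := by
    filter_upwards [Icc_mem_nhds hab'.1 hab'.2] with x hx using h x hx
  exact (h1.congr_of_eventuallyEq h2.symm).unique (hasDerivAt_const t (0:ℝ))

/-! ### The geometry of a calibrated flow -/

lemma IsOuterUnitNormal.norm_eq_one {Ω : Set (Rd d)} {x n : Rd d} (h : IsOuterUnitNormal Ω x n) :
    ‖n‖ = 1 := by
  obtain ⟨U, f, -, -, -, h0, -, rfl⟩ := h
  exact norm_smul_inv_norm h0

lemma IsClosedSurfaceFamily.frontier_nonempty {T : ℝ} {Ω : ℝ → Set (Rd d)}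
    (hΩ : IsClosedSurfaceFamily T Ω) (hd : 1 ≤ d) {t : ℝ} (ht : t ∈ Icc 0 T) :
    (frontier (Ω t)).Nonempty := by
  have : Nonempty (Fin d) := ⟨⟨0, hd⟩⟩
  by_contra h
  rw [not_nonempty_iff_eq_empty, frontier_eq_empty_iff] at h
  rcases h with h | h
  · exact (hΩ.nonempty t ht).ne_empty h
  · have := hΩ.isBounded t ht
    rw [h] at this
    exact NormedSpace.unbounded_univ ℝ (Rd d) this

/-- A bounded set lies in every ball centred at the origin that contains its frontier. -/
lemma norm_lt_of_frontier_subset {S : Set (Rd d)} (hS : Bornology.IsBounded S) {R : ℝ} (hR : 0 < R)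
    (h : ∀ x ∈ frontier S, ‖x‖ < R) : ∀ x ∈ S, ‖x‖ < R := by
  intro x hx
  by_contra! hxR
  have hx0 : 0 < ‖x‖ := hR.trans_le hxR
  obtain ⟨M, hM⟩ := hS.exists_norm_le
  -- Were `x ∈ S` outside the ball, the ray from `x` away from the origin would also stay outside
  -- and so miss the frontier. Being connected, it would remain in `S`, against boundedness.
  have hconn : IsPreconnected ((fun s : ℝ => s • x) '' Ici 1) :=
    isPreconnected_Ici.image _ (by fun_prop)
  have hne : ((fun s : ℝ => s • x) '' Ici 1 ∩ frontier S).Nonempty := by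
    by_contra hem
    have hsub : (fun s : ℝ => s • x) '' Ici 1 ⊆ S := by
      have h1 := hconn.subset_or_subset (u := interior S) (v := (closure S)ᶜ) isOpen_interior
        isClosed_closure.isOpen_compl
        (disjoint_left.2 fun y h1 h2 => h2 (subset_closure (interior_subset h1))) ?_
      · rcases h1 with h1 | h1
        · exact h1.trans interior_subset
        · exact absurd (subset_closure hx) (h1 ⟨1, le_refl (1:ℝ), one_smul ℝ x⟩)
      · intro y hy
        by_contra h3
        rw [mem_union, not_or, mem_compl_iff, not_not] at h3
        exact hem ⟨y, hy, h3.2, h3.1⟩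
    have h2 := hM (((|M| + 1) / ‖x‖ + 1) • x) (hsub ⟨_, by
      have : 0 ≤ (|M| + 1) / ‖x‖ := by positivity
      rw [mem_Ici]; linarith, rfl⟩)
    rw [norm_smul, Real.norm_of_nonneg (by positivity), add_mul, div_mul_cancel₀ _ hx0.ne'] at h2
    linarith [le_abs_self M]
  obtain ⟨y, ⟨s, hs, rfl⟩, hy⟩ := hne
  have h1 := h _ hy
  simp only at h1
  rw [norm_smul, Real.norm_of_nonneg (zero_le_one.trans hs)] at h1
  have : ‖x‖ ≤ s * ‖x‖ := le_mul_of_one_le_left (norm_nonneg _) hs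
  linarith

lemma surfDist_nonneg (Ω : ℝ → Set (Rd d)) (t : ℝ) (x : Rd d) : 0 ≤ surfDist Ω t x :=
  Metric.infDist_nonneg

lemma exists_nnreal_ge (l : List ℝ) : ∃ K : NNReal, ∀ c ∈ l, c ≤ K := by
  induction l with
  | nil => exact ⟨0, by simp⟩
  | cons a l ih =>
    obtain ⟨K, hK⟩ := ih
    refine ⟨max a.toNNReal K, fun c hc => ?_⟩
    rcases List.mem_cons.1 hc with rfl | hc
    · exact (Real.le_coe_toNNReal _).trans (NNReal.coe_le_coe.2 (le_max_left _ _))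
    · exact (hK c hc).trans (NNReal.coe_le_coe.2 (le_max_right _ _))

/-- An `O(dist)` condition combined with a uniform bound holds with the distance truncated at 1.
Unlike the distance itself, the truncated distance is comparable with the bounded weight `|θ|` in
the whole space. -/
lemma le_mul_min_one {a C M D : ℝ} (hD : 0 ≤ D) (h1 : a ≤ C * D) (h2 : a ≤ M) {K : ℝ} (hC : C ≤ K)
    (hM : M ≤ K) : a ≤ K * min D 1 := by
  rcases le_total D 1 with h | h
  · rw [min_eq_left h]; exact h1.trans (mul_le_mul_of_nonneg_right hC hD)
  · rw [min_eq_right h]; linarith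

lemma le_mul_min_one_sq {a C M D : ℝ} (h1 : a ≤ C * D ^ 2) (h2 : a ≤ M) {K : ℝ}
    (hC : C ≤ K) (hM : M ≤ K) : a ≤ K * (min D 1) ^ 2 := by
  rcases le_total D 1 with h | h
  · rw [min_eq_left h]; exact h1.trans (mul_le_mul_of_nonneg_right hC (sq_nonneg D))
  · rw [min_eq_right h]; linarith

namespace IsGradientFlowCalibration

variable {T : ℝ} {Ω : ℝ → Set (Rd d)} {ξ B : ℝ → Rd d → Rd d} {θ : ℝ → Rd d → ℝ} {lam : ℝ → ℝ}

lemma norm_xi_eq_one (h : IsGradientFlowCalibration T Ω ξ B θ lam) {t : ℝ} (ht : t ∈ Icc 0 T)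
    {x : Rd d} (hx : x ∈ frontier (Ω t)) : ‖ξ t x‖ = 1 := (h.normal t ht x hx).norm_eq_one

lemma norm_xi_le_one (h : IsGradientFlowCalibration T Ω ξ B θ lam) {t : ℝ} (ht : t ∈ Icc 0 T)
    (x : Rd d) : ‖ξ t x‖ ≤ 1 := by
  obtain ⟨c, hc, h1⟩ := h.short
  refine (h1 t ht x).trans (max_le ?_ zero_le_one)
  have : 0 ≤ c * surfDist Ω t x ^ 2 := by positivity
  linarith

/-- The comparison of `θ` with the distance is available on the support of `ξ` only; the surface
lies in it because `|ξ| = 1` there. -/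
lemma theta_frontier (h : IsGradientFlowCalibration T Ω ξ B θ lam) {t : ℝ} (ht : t ∈ Icc 0 T)
    {x : Rd d} (hx : x ∈ frontier (Ω t)) : θ t x = 0 := by
  obtain ⟨c, hc, C, h1⟩ := h.theta_dist
  have h2 : ξ t x ≠ 0 := fun h0 => by
    have := h.norm_xi_eq_one ht hx
    rw [h0, norm_zero] at this
    exact zero_ne_one this
  have h3 := (h1 t ht x (subset_tsupport _ h2)).2
  rw [surfDist, Metric.infDist_zero_of_mem hx, mul_zero] at h3
  exact abs_nonpos_iff.1 h3

/-- The region becomes a sublevel set of a Lipschitz function. This supplies its measurability and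
the smooth approximation of its characteristic function. -/
lemma mem_iff (h : IsGradientFlowCalibration T Ω ξ B θ lam)
    {t : ℝ} (ht : t ∈ Icc 0 T) (x : Rd d) : x ∈ Ω t ↔ θ t x < 0 := by
  refine ⟨h.theta_neg t ht x, fun h1 => ?_⟩
  by_contra h2
  by_cases h3 : x ∈ closure (Ω t)
  · have : x ∈ frontier (Ω t) := ⟨h3, fun h4 => h2 (interior_subset h4)⟩
    linarith [h.theta_frontier ht this]
  · linarith [h.theta_pos t ht x h3]

lemma lipschitzWith_slice {E : Type*} [NormedAddCommGroup E] {f : ℝ → Rd d → E} {L : NNReal}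
    (hf : LipschitzOnWith L (fun p : ℝ × Rd d => f p.1 p.2) (Icc 0 T ×ˢ univ)) {t : ℝ}
    (ht : t ∈ Icc 0 T) : LipschitzWith L (f t) :=
  LipschitzWith.of_dist_le_mul fun x y => by
    have := hf.dist_le_mul (t, x) ⟨ht, trivial⟩ (t, y) ⟨ht, trivial⟩
    simpa [Prod.dist_eq] using this

lemma lipschitzOnWith_time {E : Type*} [NormedAddCommGroup E] {f : ℝ → Rd d → E} {L : NNReal}
    (hf : LipschitzOnWith L (fun p : ℝ × Rd d => f p.1 p.2) (Icc 0 T ×ˢ univ)) (x : Rd d) :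
    LipschitzOnWith L (fun t => f t x) (Icc 0 T) :=
  LipschitzOnWith.of_dist_le_mul fun s hs t ht => by
    have := hf.dist_le_mul (s, x) ⟨hs, trivial⟩ (t, x) ⟨ht, trivial⟩
    simpa [Prod.dist_eq] using this

/-- The regions stay in a bounded part of space. -/
lemma exists_bound (hΩ : IsClosedSurfaceFamily T Ω) (hd : 1 ≤ d)
    (h : IsGradientFlowCalibration T Ω ξ B θ lam) :
    ∃ R : ℝ, ∀ t ∈ Icc 0 T, ∀ x ∈ Ω t, ‖x‖ < R := by
  obtain ⟨L, hL⟩ := h.lipschitz_xi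
  obtain ⟨c, hc, hs⟩ := h.short
  suffices H : ∃ R : ℝ, ∀ t ∈ Icc 0 T, t ∈ Icc 0 T → ∀ x ∈ Ω t, ‖x‖ < R by
    obtain ⟨R, hR⟩ := H
    exact ⟨R, fun t ht => hR t ht ht⟩
  -- By compactness it suffices to treat times `t` near a given `s`. If `x ∈ Σ(t)` then `|ξ(t, x)| =
  -- 1`, so `ξ(s, x) ≠ 0` once `L|t − s| < 1`, and shortness of `ξ(s, ·)` keeps `x` within a bounded
  -- distance of `Σ(s)`.
  refine (isCompact_Icc (a := (0:ℝ)) (b := T)).induction_on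
    (p := fun S => ∃ R : ℝ, ∀ t ∈ S, t ∈ Icc 0 T → ∀ x ∈ Ω t, ‖x‖ < R) ⟨0, by simp⟩
    (fun S S' hSS ⟨R, hR⟩ => ⟨R, fun t ht => hR t (hSS ht)⟩) ?_ ?_
  · rintro S S' ⟨R, hR⟩ ⟨R', hR'⟩
    refine ⟨max R R', ?_⟩
    rintro t (ht | ht) ht' x hx
    · exact (hR t ht ht' x hx).trans_le (le_max_left _ _)
    · exact (hR' t ht ht' x hx).trans_le (le_max_right _ _)
  · intro s hsT
    obtain ⟨R0, hR0⟩ := (hΩ.isBounded s hsT).closure.exists_norm_le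
    refine ⟨Icc 0 T ∩ Metric.ball s (1 / (L + 1)), inter_mem_nhdsWithin _
      (Metric.ball_mem_nhds _ (by positivity)), |R0| + (1 / c + 2), ?_⟩
    rintro t ⟨-, hts⟩ ht
    refine norm_lt_of_frontier_subset (hΩ.isBounded t ht) (by positivity) fun x hx => ?_
    have h1 : 0 < ‖ξ s x‖ := by
      have h2 := (lipschitzOnWith_time hL x).dist_le_mul t ht s hsT
      have h3 : (L:ℝ) * dist t s < 1 := by
        have h4 : dist t s < 1 / (L + 1) := hts
        rw [lt_div_iff₀ (by positivity)] at h4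
        have := dist_nonneg (x := t) (y := s)
        linarith
      have h5 := norm_sub_norm_le (ξ t x) (ξ s x)
      rw [h.norm_xi_eq_one ht hx, ← dist_eq_norm] at h5
      linarith
    have h6 := h1.trans_le (hs s hsT x)
    have h7 : c * surfDist Ω s x ^ 2 < 1 := by
      rcases lt_max_iff.1 h6 with h7 | h7
      · linarith
      · exact absurd h7 (lt_irrefl _)
    have h8 : surfDist Ω s x < 1 / c + 1 := by
      have : surfDist Ω s x ^ 2 < 1 / c := by rw [lt_div_iff₀ hc]; linarith
      nlinarith [sq_nonneg (surfDist Ω s x - 1)]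
    obtain ⟨y, hy, hxy⟩ := (Metric.infDist_lt_iff (hΩ.frontier_nonempty hd hsT)).1 h8
    have h9 := hR0 y (frontier_subset_closure hy)
    have h10 := norm_sub_norm_le x y
    rw [← dist_eq_norm] at h10
    linarith [le_abs_self R0]

end IsGradientFlowCalibration

/-! ### Differentiation of integrals depending on time -/

/-- The derivative is the almost everywhere limit of difference quotients; the steps `r/(n + 2)`
stay strictly inside the neighbourhood where measurability is known. -/
lemma aestronglyMeasurable_of_hasDerivAt {E : Type*} [NormedAddCommGroup E] [NormedSpace ℝ E]
    {F : ℝ → Rd d → E} {F' : Rd d → E} {t : ℝ}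
    (hF : ∀ᶠ s in 𝓝 t, AEStronglyMeasurable (F s))
    (hd : ∀ᵐ x, HasDerivAt (fun s => F s x) (F' x) t) : AEStronglyMeasurable F' := by
  obtain ⟨r, hr, hball⟩ := Metric.eventually_nhds_iff_ball.1 hF
  have hu : ∀ n : ℕ, 0 < r / (n + 2) ∧ r / (n + 2) < r := fun n => by
    refine ⟨by positivity, div_lt_self hr ?_⟩
    have : (0:ℝ) ≤ n := n.cast_nonneg
    linarith
  have ht : Tendsto (fun n : ℕ => r / ((n:ℝ) + 2)) atTop (𝓝 0) :=
    tendsto_const_nhds.div_atTop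
      (tendsto_atTop_add_const_right _ _ tendsto_natCast_atTop_atTop)
  have ht' : Tendsto (fun n : ℕ => t + r / ((n:ℝ) + 2)) atTop (𝓝[≠] t) := by
    refine tendsto_nhdsWithin_iff.2 ⟨by simpa using ht.const_add t, .of_forall fun n => ?_⟩
    have := (hu n).1
    simp only [mem_compl_iff, mem_singleton_iff]
    linarith
  refine aestronglyMeasurable_of_tendsto_ae atTop
    (f := fun (n : ℕ) x => (r / ((n:ℝ) + 2))⁻¹ • (F (t + r / (n + 2)) x - F t x)) (fun n => ?_) ?_
  · refine ((hball _ ?_).sub (hball _ (Metric.mem_ball_self hr))).const_smul _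
    rw [Metric.mem_ball, Real.dist_eq, add_sub_cancel_left, abs_of_pos (hu n).1]
    exact (hu n).2
  · filter_upwards [hd] with x hx
    have := (hasDerivAt_iff_tendsto_slope.1 hx).comp ht'
    refine this.congr fun n => ?_
    simp [slope_def_module]

/-- The integral of a family of functions that is Lipschitz in time with an integrable constant is
absolutely continuous. -/
lemma absolutelyContinuousOnInterval_integral {F : ℝ → Rd d → ℝ} {a b : ℝ} {L : Rd d → ℝ}
    (hab : a ≤ b) (hL : Integrable L) (hF : ∀ t ∈ Icc a b, Integrable (F t))
    (hlip : ∀ t ∈ Icc a b, ∀ s ∈ Icc a b, ∀ x, |F t x - F s x| ≤ L x * |t - s|) :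
    AbsolutelyContinuousOnInterval (fun t => ∫ x, F t x) a b := by
  refine LipschitzOnWith.absolutelyContinuousOnInterval (K := (∫ x, L x).toNNReal) ?_
  rw [uIcc_of_le hab]
  refine LipschitzOnWith.of_dist_le_mul fun t ht s hs => ?_
  rw [Real.dist_eq, Real.dist_eq, ← integral_sub (hF t ht) (hF s hs)]
  calc |∫ x, (F t x - F s x)| ≤ ∫ x, L x * |t - s| :=
        norm_integral_le_of_norm_le (f := fun x => F t x - F s x) (hL.mul_const _)
          (.of_forall (hlip t ht s hs))
    _ = (∫ x, L x) * |t - s| := integral_mul_const _ _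
    _ ≤ _ := mul_le_mul_of_nonneg_right (Real.le_coe_toNNReal _) (abs_nonneg _)

lemma hasDerivAt_integral_of_lipschitz {F : ℝ → Rd d → ℝ} {F' : Rd d → ℝ} {a b t : ℝ} {L : Rd d → ℝ}
    (ht : t ∈ Ioo a b) (hL : Integrable L) (hF : ∀ t ∈ Icc a b, Integrable (F t))
    (hlip : ∀ t ∈ Icc a b, ∀ s ∈ Icc a b, ∀ x, |F t x - F s x| ≤ L x * |t - s|)
    (hd : ∀ᵐ x, HasDerivAt (fun s => F s x) (F' x) t) :
    HasDerivAt (fun t => ∫ x, F t x) (∫ x, F' x) t := by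
  have hn := Icc_mem_nhds ht.1 ht.2
  have hm : ∀ᶠ s in 𝓝 t, AEStronglyMeasurable (F s) := by
    filter_upwards [hn] with s hs using (hF s hs).aestronglyMeasurable
  refine (hasDerivAt_integral_of_dominated_loc_of_lip hn hm (hF t (mem_of_mem_nhds hn))
    (aestronglyMeasurable_of_hasDerivAt hm hd) (.of_forall fun x => ?_) hL hd).2
  refine LipschitzOnWith.of_dist_le_mul fun s hs s' hs' => ?_
  rw [Real.dist_eq, Real.dist_eq]
  refine (hlip s hs s' hs' x).trans (mul_le_mul_of_nonneg_right ?_ (abs_nonneg _))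
  exact le_abs_self _

/-! ### Lipschitz functions of space and time -/

lemma ae_ae_of_ae_restrict {T : ℝ} {P : ℝ × Rd d → Prop}
    (h : ∀ᵐ p ∂(volume.restrict (Ioo 0 T ×ˢ (univ : Set (Rd d)))), P p) :
    ∀ᵐ t, t ∈ Ioo 0 T → ∀ᵐ x, P (t, x) := by
  rw [Measure.volume_eq_prod, ← Measure.prod_restrict, Measure.restrict_univ] at h
  exact (ae_restrict_iff' measurableSet_Ioo).1 (Measure.ae_ae_of_ae_prod h)

/-- Rademacher's theorem in space-time followed by Fubini. Time derivatives of the calibration are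
thereby controlled at almost every time only, which suffices for an integrated inequality. -/
lemma ae_differentiableAt_of_lipschitzOnWith {E : Type*} [NormedAddCommGroup E] [NormedSpace ℝ E]
    [FiniteDimensional ℝ E] {T : ℝ} {f : ℝ → Rd d → E} {L : NNReal}
    (hf : LipschitzOnWith L (fun p : ℝ × Rd d => f p.1 p.2) (Icc 0 T ×ˢ univ)) :
    ∀ᵐ t, t ∈ Ioo 0 T → ∀ᵐ x, DifferentiableAt ℝ (fun p : ℝ × Rd d => f p.1 p.2) (t, x) := by
  refine ae_ae_of_ae_restrict (P := fun p => DifferentiableAt ℝ (fun p : ℝ × Rd d => f p.1 p.2) p) ?_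
  rw [ae_restrict_iff' (measurableSet_Ioo.prod MeasurableSet.univ), Measure.volume_eq_prod]
  filter_upwards [hf.ae_differentiableWithinAt_of_mem (μ := (volume : Measure ℝ).prod volume)] with p hp hp'
  refine (hp ⟨Ioo_subset_Icc_self hp'.1, trivial⟩).differentiableAt ?_
  exact prod_mem_nhds (Icc_mem_nhds hp'.1.1 hp'.1.2) univ_mem

lemma DifferentiableAt.time {E : Type*} [NormedAddCommGroup E] [NormedSpace ℝ E] {f : ℝ → Rd d → E}
    {t : ℝ} {x : Rd d} (h : DifferentiableAt ℝ (fun p : ℝ × Rd d => f p.1 p.2) (t, x)) :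
    DifferentiableAt ℝ (fun s => f s x) t :=
  DifferentiableAt.comp (g := fun p : ℝ × Rd d => f p.1 p.2) (f := fun s : ℝ => (s, x)) t h
    (differentiableAt_id.prodMk (differentiableAt_const x))

lemma DifferentiableAt.space {E : Type*} [NormedAddCommGroup E] [NormedSpace ℝ E] {f : ℝ → Rd d → E}
    {t : ℝ} {x : Rd d} (h : DifferentiableAt ℝ (fun p : ℝ × Rd d => f p.1 p.2) (t, x)) :
    DifferentiableAt ℝ (f t) x :=
  DifferentiableAt.comp (g := fun p : ℝ × Rd d => f p.1 p.2) (f := fun y : Rd d => (t, y)) x h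
    ((differentiableAt_const t).prodMk differentiableAt_id)

/-! ### The derivative of the smooth step -/

lemma Real.smoothTransition.hasDerivAt (s : ℝ) :
    HasDerivAt Real.smoothTransition (deriv Real.smoothTransition s) s :=
  ((Real.smoothTransition.contDiff (n := 1)).differentiable (by norm_num) s).hasDerivAt

lemma Real.smoothTransition.deriv_eq_zero {s : ℝ} (h : s < 0 ∨ 1 < s) :
    deriv Real.smoothTransition s = 0 := by
  rcases h with h | h
  · have : Real.smoothTransition =ᶠ[𝓝 s] fun _ => 0 := by
      filter_upwards [Iio_mem_nhds h] with x hx using Real.smoothTransition.zero_of_nonpos (le_of_lt hx)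
    rw [this.deriv_eq, deriv_const]
  · have : Real.smoothTransition =ᶠ[𝓝 s] fun _ => 1 := by
      filter_upwards [Ioi_mem_nhds h] with x hx using Real.smoothTransition.one_of_one_le (le_of_lt hx)
    rw [this.deriv_eq, deriv_const]

lemma Real.smoothTransition.exists_abs_deriv_le : ∃ M : NNReal, ∀ s,
    |deriv Real.smoothTransition s| ≤ M := by
  obtain ⟨C, hC⟩ := (isCompact_Icc (a := (0:ℝ)) (b := 1)).exists_bound_of_continuousOn
    ((Real.smoothTransition.contDiff (n := 1)).continuous_deriv le_rfl).continuousOn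
  refine ⟨C.toNNReal, fun s => ?_⟩
  by_cases hs : s ∈ Icc (0:ℝ) 1
  · exact (hC s hs).trans (Real.le_coe_toNNReal _)
  · have : s < 0 ∨ 1 < s := by
      by_contra! h; exact hs h
    rw [Real.smoothTransition.deriv_eq_zero this, abs_zero]
    exact NNReal.coe_nonneg _

/-! ### A smooth approximation of the characteristic function of a sublevel set -/

/-- The function `x ↦ β(-kθ(x))` for the smooth step `β`. -/
def smoothSublevel (k : ℕ) (θ : Rd d → ℝ) (x : Rd d) : ℝ :=
  Real.smoothTransition (-(((k:ℝ) + 1) * θ x))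

section Sublevel

variable {R : ℝ} {θ : Rd d → ℝ} {L : NNReal}

lemma smoothSublevel_of_nonneg (k : ℕ) {x : Rd d} (h : 0 ≤ θ x) : smoothSublevel k θ x = 0 :=
  Real.smoothTransition.zero_of_nonpos (neg_nonpos.2 (by positivity))

lemma abs_smoothSublevel_le (k : ℕ) (θ : Rd d → ℝ) (x : Rd d) : |smoothSublevel k θ x| ≤ 1 := by
  rw [smoothSublevel, abs_of_nonneg (Real.smoothTransition.nonneg _)]
  exact Real.smoothTransition.le_one _

lemma abs_smoothTransition_sub_le {M : NNReal} (hM : ∀ s, |deriv Real.smoothTransition s| ≤ M)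
    (k : ℕ) (a b : ℝ) : |Real.smoothTransition (-(((k:ℝ) + 1) * a))
      - Real.smoothTransition (-(((k:ℝ) + 1) * b))| ≤ M * (((k:ℝ) + 1) * |a - b|) := by
  have hl : LipschitzWith M Real.smoothTransition :=
    lipschitzWith_of_nnnorm_deriv_le
      ((Real.smoothTransition.contDiff (n := 1)).differentiable (by norm_num)) fun s => by
        have := hM s
        exact_mod_cast this
  have h1 := hl.dist_le_mul (-(((k:ℝ) + 1) * a)) (-(((k:ℝ) + 1) * b))
  have hk : (0:ℝ) < k + 1 := by positivity
  rwa [Real.dist_eq, Real.dist_eq, show -(((k:ℝ) + 1) * a) - -((k + 1) * b) = -((k + 1) * (a - b))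
    by ring, abs_neg, abs_mul, abs_of_pos hk] at h1

lemma lipschitzWith_smoothSublevel {M : NNReal} (hM : ∀ s, |deriv Real.smoothTransition s| ≤ M)
    (hθ : LipschitzWith L θ) (k : ℕ) :
    LipschitzWith (M * ((k + 1) * L)) (smoothSublevel k θ) := by
  refine LipschitzWith.of_dist_le_mul fun x y => ?_
  have h1 := hθ.dist_le_mul x y
  rw [Real.dist_eq] at h1 ⊢
  refine (abs_smoothTransition_sub_le hM k (θ x) (θ y)).trans ?_
  push_cast
  rw [mul_assoc, mul_assoc]
  gcongr

lemma continuous_smoothSublevel (hθ : Continuous θ) (k : ℕ) : Continuous (smoothSublevel k θ) :=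
  Real.smoothTransition.continuous.comp (by fun_prop)

lemma integrable_indicator_closedBall (R c : ℝ) :
    Integrable ((Metric.closedBall (0 : Rd d) R).indicator fun _ => c) :=
  (integrable_indicator_iff measurableSet_closedBall).2
    (integrableOn_const measure_closedBall_lt_top.ne)

lemma norm_smoothSublevel_le (h0 : ∀ x ∉ Metric.closedBall (0 : Rd d) R, 0 ≤ θ x) (k : ℕ)
    (x : Rd d) :
    ‖smoothSublevel k θ x‖ ≤ (Metric.closedBall (0 : Rd d) R).indicator (fun _ => (1:ℝ)) x := by
  by_cases hx : x ∈ Metric.closedBall (0 : Rd d) R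
  · rw [indicator_of_mem hx]; exact abs_smoothSublevel_le k θ x
  · rw [indicator_of_notMem hx, smoothSublevel_of_nonneg k (h0 x hx), norm_zero]

lemma integrable_smoothSublevel (hθ : Continuous θ)
    (h0 : ∀ x ∉ Metric.closedBall (0 : Rd d) R, 0 ≤ θ x) (k : ℕ) :
    Integrable (smoothSublevel k θ) :=
  (integrable_indicator_closedBall R 1).mono'
    (continuous_smoothSublevel hθ k).aestronglyMeasurable (.of_forall (norm_smoothSublevel_le h0 k))

lemma tendsto_add_one_atTop : Tendsto (fun n : ℕ => (n:ℝ) + 1) atTop atTop :=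
  tendsto_atTop_add_const_right _ _ tendsto_natCast_atTop_atTop

lemma tendsto_smoothSublevel (θ : Rd d → ℝ) (x : Rd d) :
    Tendsto (fun k => smoothSublevel k θ x) atTop
      (𝓝 ({y | θ y < 0}.indicator (fun _ => (1:ℝ)) x)) := by
  by_cases hx : θ x < 0
  · rw [indicator_of_mem (show x ∈ {y | θ y < 0} from hx)]
    refine tendsto_const_nhds.congr' ?_
    filter_upwards [tendsto_add_one_atTop.eventually_ge_atTop (1 / -θ x)] with n hn
    rw [smoothSublevel, Real.smoothTransition.one_of_one_le]
    rw [div_le_iff₀ (by linarith)] at hn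
    linarith
  · rw [indicator_of_notMem (show x ∉ {y | θ y < 0} from hx)]
    exact tendsto_const_nhds.congr fun n => (smoothSublevel_of_nonneg n (not_lt.1 hx)).symm

lemma tendsto_integral_mul_smoothSublevel (hθ : Continuous θ)
    (h0 : ∀ x ∉ Metric.closedBall (0 : Rd d) R, 0 ≤ θ x) {b : Rd d → ℝ} (hb : Measurable b)
    {K : ℝ} (hbK : ∀ x, |b x| ≤ K) :
    Tendsto (fun k => ∫ x, b x * smoothSublevel k θ x) atTop (𝓝 (∫ x in {y | θ y < 0}, b x)) := by
  have hm : MeasurableSet {y | θ y < 0} := hθ.measurable measurableSet_Iio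
  have e : ∫ x in {y | θ y < 0}, b x
      = ∫ x, b x * {y | θ y < 0}.indicator (fun _ => (1:ℝ)) x := by
    rw [← integral_indicator hm]
    refine integral_congr_ae (.of_forall fun x => ?_)
    by_cases hx : x ∈ {y | θ y < 0} <;> simp [indicator, hx]
  rw [e]
  refine tendsto_integral_of_dominated_convergence
    (fun x => K * (Metric.closedBall (0 : Rd d) R).indicator (fun _ => (1:ℝ)) x)
    (fun k => hb.aestronglyMeasurable.mul (continuous_smoothSublevel hθ k).aestronglyMeasurable)
    ((integrable_indicator_closedBall R 1).const_mul K) (fun k => .of_forall fun x => ?_)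
    (.of_forall fun x => (tendsto_smoothSublevel θ x).const_mul _)
  rw [norm_mul]
  exact mul_le_mul (hbK x) (norm_smoothSublevel_le h0 k x) (norm_nonneg _)
    ((abs_nonneg _).trans (hbK x))

/-- The rate of change of `∫ β(-kθ)`, in terms of a velocity `B` that almost transports `θ`. -/
lemma tendsto_integral_rate_smoothSublevel (hθ : LipschitzWith L θ)
    (h0 : ∀ x ∉ Metric.closedBall (0 : Rd d) R, 0 ≤ θ x) {B : Rd d → Rd d} {LB : NNReal}
    (hB : LipschitzWith LB B) {θt : Rd d → ℝ} (hm : AEStronglyMeasurable θt) {K : ℝ} (hK : 0 ≤ K)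
    (htr : ∀ᵐ x, |θt x + fderiv ℝ θ x (B x)| ≤ K * |θ x|) {M : NNReal}
    (hM : ∀ s, |deriv Real.smoothTransition s| ≤ M) :
    (∀ k : ℕ, |∫ x, deriv Real.smoothTransition (-(((k:ℝ) + 1) * θ x)) * -((k + 1) * θt x)|
      ≤ volume.real (Metric.closedBall (0 : Rd d) R) * (M * K + d * LB)) ∧
    Tendsto (fun k : ℕ =>
        ∫ x, deriv Real.smoothTransition (-(((k:ℝ) + 1) * θ x)) * -((k + 1) * θt x))
      atTop (𝓝 (∫ x in {y | θ y < 0}, divergence B x)) := by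
  obtain ⟨S, hS⟩ : ∃ S, S = Metric.closedBall (0 : Rd d) R := ⟨_, rfl⟩
  -- `Q k` is the rate seen along `B`. The factor `β'` of the smooth step `β` lives where `(k +
  -- 1)|θ| ≤ 1`, and the transport error is at most `K|θ|`, so the large factor `k + 1` is absorbed
  -- and `Q k` stays bounded while tending to 0.
  obtain ⟨Q, hQ⟩ : ∃ Q : ℕ → Rd d → ℝ, ∀ k x, Q k x =
    deriv Real.smoothTransition (-(((k:ℝ) + 1) * θ x)) * -((k + 1) * (θt x
      + fderiv ℝ θ x (B x))) := ⟨_, fun _ _ => rfl⟩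
  have hQm : ∀ k, AEStronglyMeasurable (Q k) := fun k => by
    rw [funext (hQ k)]
    refine AEStronglyMeasurable.mul ?_ (((hm.add ?_).const_mul _).neg)
    · exact (((Real.smoothTransition.contDiff (n := 1)).continuous_deriv le_rfl).comp
        (by have := hθ.continuous; fun_prop)).aestronglyMeasurable
    · exact (isBoundedBilinearMap_apply.continuous.measurable.comp
        ((measurable_fderiv ℝ θ).prodMk hB.continuous.measurable)).aestronglyMeasurable
  have hQb : ∀ k, ∀ᵐ x, ‖Q k x‖ ≤ S.indicator (fun _ => M * K) x := by
    intro k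
    filter_upwards [htr] with x hx
    have hk : (0:ℝ) < k + 1 := by positivity
    rw [hQ, Real.norm_eq_abs, abs_mul, abs_neg, abs_mul, abs_of_pos hk]
    by_cases hz : 0 ≤ -(((k:ℝ) + 1) * θ x) ∧ -((k + 1) * θ x) ≤ 1
    · have h3 : |((k:ℝ) + 1) * θ x| ≤ 1 := by
        rw [← abs_neg, abs_of_nonneg hz.1]; exact hz.2
      rw [abs_mul, abs_of_pos hk] at h3
      by_cases hxS : x ∈ S
      · rw [indicator_of_mem hxS]
        refine mul_le_mul (hM _) ?_ (by positivity) (NNReal.coe_nonneg M)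
        calc ((k:ℝ) + 1) * |θt x + fderiv ℝ θ x (B x)|
            ≤ (k + 1) * (K * |θ x|) := mul_le_mul_of_nonneg_left hx hk.le
          _ = K * ((k + 1) * |θ x|) := by ring
          _ ≤ K * 1 := mul_le_mul_of_nonneg_left h3 hK
          _ = _ := mul_one _
      · have h4 : θ x = 0 := by
          refine le_antisymm ?_ (h0 x (hS ▸ hxS))
          by_contra! h5
          linarith [hz.1, mul_pos hk h5]
        rw [h4, abs_zero, mul_zero] at hx
        rw [le_antisymm hx (abs_nonneg _), indicator_of_notMem hxS]; simp
    · have : -(((k:ℝ) + 1) * θ x) < 0 ∨ 1 < -(((k:ℝ) + 1) * θ x) := by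
        by_contra! h'; exact hz h'
      rw [Real.smoothTransition.deriv_eq_zero this, abs_zero, zero_mul]
      exact indicator_nonneg (fun _ _ => by positivity) x
  have hQlim : ∀ᵐ x, Tendsto (fun k => Q k x) atTop (𝓝 0) := by
    filter_upwards [htr] with x hx
    refine tendsto_const_nhds.congr' ?_
    rcases lt_trichotomy (θ x) 0 with hneg | hz | hpos
    · filter_upwards [tendsto_add_one_atTop.eventually_gt_atTop (1 / -θ x)] with n hn
      rw [div_lt_iff₀ (by linarith)] at hn
      rw [hQ, Real.smoothTransition.deriv_eq_zero (Or.inr (by linarith)), zero_mul]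
    · rw [hz, abs_zero, mul_zero] at hx
      refine .of_forall fun n => ?_
      change 0 = Q n x
      rw [hQ, abs_nonpos_iff.1 hx]; simp
    · refine .of_forall fun n => ?_
      change 0 = Q n x
      rw [hQ, Real.smoothTransition.deriv_eq_zero
        (Or.inl (neg_lt_zero.2 (mul_pos (by positivity) hpos))), zero_mul]
  have hSi : ∀ c : ℝ, Integrable (S.indicator fun _ => c) := fun c => by
    rw [hS]; exact integrable_indicator_closedBall R c
  have hlip := fun k => lipschitzWith_smoothSublevel hM hθ k
  -- What is left of the rate is minus the derivative of the smooth sublevel function along `B`; by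
  -- parts it becomes `∇·B` times that function, which converges to `∫_Ω ∇·B`.
  have hval : ∀ k : ℕ, ∫ x, deriv Real.smoothTransition (-(((k:ℝ) + 1) * θ x)) * -((k + 1) * θt x)
      = (∫ x, Q k x) + ∫ x, divergence B x * smoothSublevel k θ x := by
    intro k
    have hc : HasCompactSupport (smoothSublevel k θ) :=
      HasCompactSupport.intro (isCompact_closedBall (0 : Rd d) R) fun x hx =>
        smoothSublevel_of_nonneg k (h0 x hx)
    have h5 := integral_fderiv_apply_of_compact hB (hlip k) hc
    have h6 : Integrable (Q k) := (hSi _).mono' (hQm k) (hQb k)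
    have h7 : Integrable (fun x => fderiv ℝ (smoothSublevel k θ) x (B x)) := by
      obtain ⟨C, hC⟩ := hc.isCompact.exists_bound_of_continuousOn hB.continuous.continuousOn
      refine integrable_of_bounded_of_compact hc.isCompact
        (isBoundedBilinearMap_apply.continuous.measurable.comp
          ((measurable_fderiv ℝ (smoothSublevel k θ)).prodMk
            hB.continuous.measurable)).aestronglyMeasurable
        (((M * ((k + 1) * L) : NNReal) : ℝ) * C) (.of_forall fun x hx => ?_) fun x hx => ?_
      · exact ((fderiv ℝ (smoothSublevel k θ) x).le_opNorm _).trans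
          (mul_le_mul (norm_fderiv_le_of_lipschitz ℝ (hlip k)) (hC x hx) (norm_nonneg _)
            (NNReal.coe_nonneg _))
      · rw [fderiv_eq_zero_of_notMem_tsupport hx]; rfl
    have h8 : ∫ x, deriv Real.smoothTransition (-(((k:ℝ) + 1) * θ x)) * -((k + 1) * θt x)
        = ∫ x, (Q k x - fderiv ℝ (smoothSublevel k θ) x (B x)) := by
      refine integral_congr_ae ?_
      filter_upwards [hθ.ae_differentiableAt] with x hx
      have h1 := (hx.hasFDerivAt.const_mul ((k:ℝ) + 1)).neg
      have h2 := (Real.smoothTransition.hasDerivAt (-(((k:ℝ) + 1) * θ x))).comp_hasFDerivAt x h1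
      have h3 : fderiv ℝ (smoothSublevel k θ) x = _ := h2.fderiv
      rw [h3, hQ]
      simp only [_root_.smul_apply, _root_.neg_apply, smul_eq_mul]
      ring
    rw [h8, integral_sub h6 h7, h5]; ring
  have hconst : ∀ c : ℝ, ∫ x, S.indicator (fun _ => c) x
      = volume.real (Metric.closedBall (0 : Rd d) R) * c := fun c => by
    rw [hS, integral_indicator measurableSet_closedBall, setIntegral_const, smul_eq_mul]
  refine ⟨fun k => ?_, ?_⟩
  · rw [hval, mul_add, ← hconst, ← hconst]
    refine (abs_add_le _ _).trans (add_le_add (norm_integral_le_of_norm_le (hSi _) (hQb k))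
      (norm_integral_le_of_norm_le (f := fun x => divergence B x * smoothSublevel k θ x) (hSi _)
        (.of_forall fun x => ?_)))
    by_cases hx : x ∈ S
    · rw [indicator_of_mem hx, norm_mul]
      calc _ ≤ (d * LB : ℝ) * 1 :=
            mul_le_mul (abs_divergence_le hB x) (abs_smoothSublevel_le k θ x) (abs_nonneg _)
              (by positivity)
        _ = _ := mul_one _
    · rw [indicator_of_notMem hx, smoothSublevel_of_nonneg k (h0 x (hS ▸ hx)), mul_zero, norm_zero]
  · simp only [hval]
    have e1 : Tendsto (fun k => ∫ x, Q k x) atTop (𝓝 (∫ _ : Rd d, (0:ℝ))) :=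
      tendsto_integral_of_dominated_convergence _ hQm (hSi _) hQb hQlim
    simpa using e1.add (tendsto_integral_mul_smoothSublevel hθ.continuous h0
      (measurable_divergence B) (abs_divergence_le hB))

end Sublevel

/-! ### Constant volume and the total divergence of the velocity. -/

namespace IsGradientFlowCalibration

variable {T : ℝ} {Ω : ℝ → Set (Rd d)} {ξ B : ℝ → Rd d → Rd d} {θ : ℝ → Rd d → ℝ} {lam : ℝ → ℝ}

/-- On the support of `ξ` the weight dominates the distance; off it the weight is bounded below, and
there the truncation at 1 is what makes the bound hold. -/
lemma exists_min_surfDist_le (h : IsGradientFlowCalibration T Ω ξ B θ lam) :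
    ∃ K : ℝ, 0 ≤ K ∧ ∀ t ∈ Icc 0 T, ∀ x, min (surfDist Ω t x) 1 ≤ K * |θ t x| := by
  obtain ⟨c, hc, C, h1⟩ := h.theta_dist
  obtain ⟨c', hc', h2⟩ := h.theta_far
  refine ⟨1 / c + 1 / c', by positivity, fun t ht x => ?_⟩
  have n1 : 0 ≤ 1 / c * |θ t x| := by positivity
  have n2 : 0 ≤ 1 / c' * |θ t x| := by positivity
  by_cases hx : x ∈ tsupport (ξ t)
  · have h3 : surfDist Ω t x ≤ 1 / c * |θ t x| := by
      rw [one_div, ← div_eq_inv_mul, le_div_iff₀ hc]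
      linarith [(h1 t ht x hx).1]
    linarith [min_le_left (surfDist Ω t x) 1]
  · have h3 : 1 ≤ 1 / c' * |θ t x| := by
      rw [one_div, ← div_eq_inv_mul, le_div_iff₀ hc']
      linarith [h2 t ht x hx]
    linarith [min_le_right (surfDist Ω t x) 1]

lemma exists_abs_transport_theta_le (h : IsGradientFlowCalibration T Ω ξ B θ lam) :
    ∃ K : ℝ, 0 ≤ K ∧ ∀ᵐ t, t ∈ Ioo 0 T → ∀ᵐ x,
      |deriv (fun s => θ s x) t + fderiv ℝ (θ t) x (B t x)| ≤ K * min (surfDist Ω t x) 1 := by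
  obtain ⟨C, hC⟩ := h.transport_theta
  obtain ⟨L, hL⟩ := h.lipschitz_theta
  obtain ⟨KB, hKB⟩ := h.bounded_B
  refine ⟨max (max C (L + L * KB)) 0, le_max_right _ _, ?_⟩
  filter_upwards [ae_ae_of_ae_restrict hC] with t ht htT
  filter_upwards [ht htT] with x hx
  have htc := Ioo_subset_Icc_self htT
  refine le_mul_min_one (surfDist_nonneg Ω t x) hx ((abs_add_le _ _).trans (add_le_add ?_ ?_))
    ((le_max_left _ _).trans (le_max_left _ _)) ((le_max_right _ _).trans (le_max_left _ _))
  · exact norm_deriv_le_of_lipschitzOn (Icc_mem_nhds htT.1 htT.2) (lipschitzOnWith_time hL x)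
  · refine ((fderiv ℝ (θ t) x).le_opNorm _).trans ?_
    gcongr
    · exact norm_fderiv_le_of_lipschitz ℝ (lipschitzWith_slice hL htc)
    · exact hKB t htc x

/-- The region has constant volume, so the flux of the velocity through its boundary vanishes. -/
lemma ae_integral_divergence_eq_zero (hΩ : IsClosedSurfaceFamily T Ω) (hd : 1 ≤ d)
    (hvol : ∀ t ∈ Set.Icc 0 T, volume (Ω t) = volume (Ω 0))
    (h : IsGradientFlowCalibration T Ω ξ B θ lam) :
    ∀ᵐ t, t ∈ Ioo 0 T → ∫ x in Ω t, divergence (B t) x = 0 := by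
  rcases lt_or_ge T 0 with hT | hT
  · simp [Ioo_eq_empty_of_le hT.le]
  obtain ⟨R, hR⟩ := exists_bound hΩ hd h
  obtain ⟨L, hL⟩ := h.lipschitz_theta
  obtain ⟨LB, hLB⟩ := h.lipschitz_B
  obtain ⟨K1, hK1, hdist⟩ := h.exists_min_surfDist_le
  obtain ⟨K2, hK2, htr⟩ := h.exists_abs_transport_theta_le
  obtain ⟨M, hM⟩ := Real.smoothTransition.exists_abs_deriv_le
  have hΩθ : ∀ t ∈ Icc 0 T, {y | θ t y < 0} = Ω t := fun t ht => by
    ext x; exact (h.mem_iff ht x).symm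
  have h0 : ∀ t ∈ Icc 0 T, ∀ x ∉ Metric.closedBall (0 : Rd d) R, 0 ≤ θ t x := fun t ht x hx =>
    not_lt.1 fun h' => hx (by simpa using (hR t ht x ((h.mem_iff ht x).2 h')).le)
  have hθ := fun t (ht : t ∈ Icc 0 T) => lipschitzWith_slice hL ht
  have hFi : ∀ k, ∀ t ∈ Icc 0 T, Integrable (smoothSublevel k (θ t)) := fun k t ht =>
    integrable_smoothSublevel (hθ t ht).continuous (h0 t ht) k
  have hFt : ∀ k : ℕ, ∀ t ∈ Icc 0 T, ∀ s ∈ Icc 0 T, ∀ x,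
      |smoothSublevel k (θ t) x - smoothSublevel k (θ s) x|
        ≤ (Metric.closedBall (0 : Rd d) R).indicator (fun _ => (M * ((k + 1) * L) : ℝ)) x
          * |t - s| := by
    intro k t ht s hs x
    by_cases hx : x ∈ Metric.closedBall (0 : Rd d) R
    · rw [indicator_of_mem hx, mul_assoc, mul_assoc]
      refine (abs_smoothTransition_sub_le hM k _ _).trans ?_
      have h2 := (lipschitzOnWith_time hL x).dist_le_mul t ht s hs
      rw [Real.dist_eq, Real.dist_eq] at h2
      gcongr
    · rw [indicator_of_notMem hx, smoothSublevel_of_nonneg k (h0 t ht x hx),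
        smoothSublevel_of_nonneg k (h0 s hs x hx)]
      simp
  have hd1 : ∀ᵐ t, t ∈ Ioo 0 T → ∀ k : ℕ, ∀ᵐ x, HasDerivAt (fun s => smoothSublevel k (θ s) x)
      (deriv Real.smoothTransition (-(((k:ℝ) + 1) * θ t x))
        * -((k + 1) * deriv (fun s => θ s x) t)) t := by
    filter_upwards [ae_differentiableAt_of_lipschitzOnWith hL] with t ht htT k
    filter_upwards [ht htT] with x hx
    exact (Real.smoothTransition.hasDerivAt _).comp t
      (hx.time.hasDerivAt.const_mul ((k:ℝ) + 1)).neg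
  have hrate := fun t (ht : t ∈ Icc 0 T) =>
    tendsto_integral_rate_smoothSublevel (K := K2 * K1) (hθ t ht) (h0 t ht) (hLB t ht)
      (θt := fun x => deriv (fun s => θ s x) t)
  have hrate' : ∀ᵐ t, t ∈ Ioo 0 T →
      AEStronglyMeasurable (fun x => deriv (fun s => θ s x) t) ∧
      ∀ᵐ x, |deriv (fun s => θ s x) t + fderiv ℝ (θ t) x (B t x)| ≤ K2 * K1 * |θ t x| := by
    filter_upwards [htr, ae_differentiableAt_of_lipschitzOnWith hL] with t h1 h2 htT
    constructor
    · refine aestronglyMeasurable_of_hasDerivAt (F := θ) (t := t) ?_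
        ((h2 htT).mono fun x hx => hx.time.hasDerivAt)
      filter_upwards [Icc_mem_nhds htT.1 htT.2] with s hs
        using (hθ s hs).continuous.aestronglyMeasurable
    · filter_upwards [h1 htT] with x hx
      rw [mul_assoc]
      exact hx.trans (mul_le_mul_of_nonneg_left (hdist t (Ioo_subset_Icc_self htT) x) hK2)
  -- The regularized volumes converge to `|Ω(t)|`, which does not depend on `t`; so the limiting
  -- rate has zero integral over every `[0, r]`.
  have hmain : ∀ r ∈ Icc 0 T, IntervalIntegrable (fun t => ∫ x in Ω t, divergence (B t) x) volume 0 r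
      ∧ ∫ t in (0:ℝ)..r, ∫ x in Ω t, divergence (B t) x = volume.real (Ω 0) - volume.real (Ω 0) := by
    intro r hr
    have hsub : Icc 0 r ⊆ Icc 0 T := Icc_subset_Icc_right hr.2
    have hsub' : Ioo 0 r ⊆ Ioo 0 T := Ioo_subset_Ioo_right hr.2
    refine integral_eq_sub_of_tendsto_deriv (G := fun k t => ∫ x, smoothSublevel k (θ t) x)
      (D := fun k t => ∫ x, deriv Real.smoothTransition (-(((k:ℝ) + 1) * θ t x))
        * -((k + 1) * deriv (fun s => θ s x) t)) (G' := fun _ => volume.real (Ω 0))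
      (Φ := fun _ => volume.real (Metric.closedBall (0 : Rd d) R) * (M * (K2 * K1) + d * LB))
      hr.1 (fun k => ?_) (fun k => ?_) (fun k => ?_) intervalIntegrable_const ?_ (fun t ht => ?_)
    · exact absolutelyContinuousOnInterval_integral hr.1 (integrable_indicator_closedBall _ _)
        (fun t ht => hFi k t (hsub ht)) fun t ht s hs => hFt k t (hsub ht) s (hsub hs)
    · filter_upwards [hd1] with t h1 htr
      exact hasDerivAt_integral_of_lipschitz (hsub' htr) (integrable_indicator_closedBall _ _)
        (hFi k) (hFt k) (h1 (hsub' htr) k)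
    · filter_upwards [hrate'] with t h1 htr
      have h2 := h1 (hsub' htr)
      exact (hrate t (Ioo_subset_Icc_self (hsub' htr)) h2.1 (by positivity) h2.2 hM).1 k
    · filter_upwards [hrate'] with t h1 htr
      have h2 := h1 (hsub' htr)
      have h3 := (hrate t (Ioo_subset_Icc_self (hsub' htr)) h2.1 (by positivity) h2.2 hM).2
      rwa [hΩθ t (Ioo_subset_Icc_self (hsub' htr))] at h3
    · have e1 := tendsto_integral_mul_smoothSublevel (hθ t (hsub ht)).continuous (h0 t (hsub ht))
        (b := fun _ => 1) measurable_const (K := 1) (by simp)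
      simp only [one_mul] at e1
      rwa [hΩθ t (hsub ht), setIntegral_const, smul_eq_mul, mul_one,
        measureReal_def, hvol t (hsub ht)] at e1
  refine ae_eq_zero_of_intervalIntegral_eq_zero hT (hmain T ⟨hT, le_rfl⟩).1 fun r hr => ?_
  rw [(hmain r hr).2, sub_self]

end IsGradientFlowCalibration

/-! ### Uniform constants for the calibration. -/

namespace IsGradientFlowCalibration

variable {T : ℝ} {Ω : ℝ → Set (Rd d)} {ξ B : ℝ → Rd d → Rd d} {θ : ℝ → Rd d → ℝ} {lam : ℝ → ℝ}

lemma exists_frontier_dist_eq (hΩ : IsClosedSurfaceFamily T Ω) (hd : 1 ≤ d) {t : ℝ}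
    (ht : t ∈ Icc 0 T) (x : Rd d) : ∃ y ∈ frontier (Ω t), surfDist Ω t x = dist x y :=
  (Metric.isCompact_of_isClosed_isBounded isClosed_frontier
    ((hΩ.isBounded t ht).closure.subset frontier_subset_closure)).exists_infDist_eq_dist
    (hΩ.frontier_nonempty hd ht) x

/-- Lipschitz comparison with the nearest point of the surface, where `θ` vanishes. In contrast to
the hypothesis on the weight, it is not confined to the support of `ξ`. -/
lemma abs_theta_le_mul_surfDist (hΩ : IsClosedSurfaceFamily T Ω) (hd : 1 ≤ d)
    (h : IsGradientFlowCalibration T Ω ξ B θ lam) {L : NNReal}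
    (hL : LipschitzOnWith L (fun p : ℝ × Rd d => θ p.1 p.2) (Icc 0 T ×ˢ univ)) {t : ℝ}
    (ht : t ∈ Icc 0 T) (x : Rd d) : |θ t x| ≤ L * surfDist Ω t x := by
  obtain ⟨y, hy, hxy⟩ := exists_frontier_dist_eq hΩ hd ht x
  have := (lipschitzWith_slice hL ht).dist_le_mul x y
  rwa [h.theta_frontier ht hy, Real.dist_eq, sub_zero, ← hxy] at this

/-- The evolution law holds almost everywhere only, so it is read off at some point of a unit ball
around a point of the surface. All other terms are bounded there. -/
lemma exists_abs_lam_le (hΩ : IsClosedSurfaceFamily T Ω) (hd : 1 ≤ d)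
    (h : IsGradientFlowCalibration T Ω ξ B θ lam) : ∃ K, ∀ t ∈ Icc 0 T, |lam t| ≤ K := by
  obtain ⟨C, hC⟩ := h.evolution
  obtain ⟨L, hL⟩ := h.lipschitz_xi
  obtain ⟨KB, hKB⟩ := h.bounded_B
  refine ⟨|C| + KB + d * L, fun t ht => ?_⟩
  obtain ⟨y, hy⟩ := hΩ.frontier_nonempty hd ht
  have hpos : volume (Metric.ball y 1) ≠ 0 := (Metric.measure_ball_pos _ _ one_pos).ne'
  obtain ⟨x, hxb, hx⟩ : ∃ x ∈ Metric.ball y 1,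
      |inner ℝ (B t x) (ξ t x) + divergence (ξ t) x - lam t| ≤ C * surfDist Ω t x := by
    by_contra! hcon
    refine hpos (measure_mono_null (fun x hx => ?_) (ae_iff.1 (hC t ht)))
    exact not_le.2 (hcon x hx)
  have hdist : surfDist Ω t x ≤ 1 :=
    (Metric.infDist_le_dist_of_mem hy).trans (Metric.mem_ball.1 hxb).le
  have h1 : C * surfDist Ω t x ≤ |C| := by
    calc C * surfDist Ω t x ≤ |C| * 1 :=
          mul_le_mul (le_abs_self C) hdist (surfDist_nonneg _ _ _) (abs_nonneg C)
      _ = |C| := mul_one _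
  have h2 : |inner ℝ (B t x) (ξ t x)| ≤ KB := by
    refine (abs_real_inner_le_norm _ _).trans ?_
    calc ‖B t x‖ * ‖ξ t x‖ ≤ KB * 1 := mul_le_mul (hKB t ht x) (h.norm_xi_le_one ht x)
          (norm_nonneg _) ((norm_nonneg _).trans (hKB t ht x))
      _ = KB := mul_one _
  have h3 := abs_divergence_le (lipschitzWith_slice hL ht) x
  rw [abs_le] at hx h2 h3 ⊢
  constructor <;> linarith [hx.1, hx.2, h2.1, h2.2, h3.1, h3.2]

/-- Differentiating `|ξ|²` gives twice the left-hand side. In this form the bound controls the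
component of the transport error of `ξ` along `ξ` to second order. -/
lemma exists_transport_length_le (h : IsGradientFlowCalibration T Ω ξ B θ lam) :
    ∃ K : ℝ, ∀ᵐ t, t ∈ Ioo 0 T → ∀ᵐ x,
      |inner ℝ (deriv (fun s => ξ s x) t) (ξ t x) + inner ℝ (fderiv ℝ (ξ t) x (B t x)) (ξ t x)|
        ≤ K * min (surfDist Ω t x) 1 ^ 2 := by
  obtain ⟨C, hC⟩ := h.transport_length
  obtain ⟨L, hL⟩ := h.lipschitz_xi
  obtain ⟨KB, hKB⟩ := h.bounded_B
  refine ⟨max (C / 2) (L + L * KB), ?_⟩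
  filter_upwards [ae_ae_of_ae_restrict hC, ae_differentiableAt_of_lipschitzOnWith hL]
    with t h1 h2 htT
  filter_upwards [h1 htT, h2 htT] with x hx1 hx2
  have htc := Ioo_subset_Icc_self htT
  have e1 : deriv (fun s => ‖ξ s x‖ ^ 2) t = 2 * inner ℝ (deriv (fun s => ξ s x) t) (ξ t x) := by
    rw [(hx2.time.hasDerivAt.norm_sq).deriv, real_inner_comm]
  have e2 : fderiv ℝ (fun y => ‖ξ t y‖ ^ 2) x (B t x)
      = 2 * inner ℝ (fderiv ℝ (ξ t) x (B t x)) (ξ t x) := by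
    rw [(hx2.space.hasFDerivAt.norm_sq).fderiv, real_inner_comm]
    exact (nsmul_eq_mul 2 _).trans (by norm_num)
  rw [e1, e2, ← mul_add, abs_mul, abs_two] at hx1
  refine le_mul_min_one_sq (C := C / 2) (M := L + L * KB) (by linarith)
    ((abs_add_le _ _).trans (add_le_add ?_ ?_)) (le_max_left _ _) (le_max_right _ _)
  · refine (abs_real_inner_le_norm _ _).trans ?_
    calc _ ≤ (L:ℝ) * 1 := mul_le_mul (norm_deriv_le_of_lipschitzOn (Icc_mem_nhds htT.1 htT.2)
            (lipschitzOnWith_time hL x)) (h.norm_xi_le_one htc x) (norm_nonneg _)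
            (NNReal.coe_nonneg L)
      _ = L := mul_one _
  · refine (abs_real_inner_le_norm _ _).trans ?_
    have hb : ‖fderiv ℝ (ξ t) x (B t x)‖ ≤ L * KB := by
      refine ((fderiv ℝ (ξ t) x).le_opNorm _).trans ?_
      exact mul_le_mul (norm_fderiv_le_of_lipschitz ℝ (lipschitzWith_slice hL htc))
        (hKB t htc x) (norm_nonneg _) (NNReal.coe_nonneg L)
    calc _ ≤ (L * KB : ℝ) * 1 := mul_le_mul hb (h.norm_xi_le_one htc x) (norm_nonneg _)
            ((norm_nonneg _).trans hb)
      _ = _ := mul_one _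

lemma exists_transport_xi_le (h : IsGradientFlowCalibration T Ω ξ B θ lam) :
    ∃ K : ℝ, ∀ᵐ t, t ∈ Ioo 0 T → ∀ᵐ x,
      ‖deriv (fun s => ξ s x) t + fderiv ℝ (ξ t) x (B t x)
        + ContinuousLinearMap.adjoint (fderiv ℝ (B t) x) (ξ t x)‖
        ≤ K * min (surfDist Ω t x) 1 := by
  obtain ⟨C, hC⟩ := h.transport_xi
  obtain ⟨L, hL⟩ := h.lipschitz_xi
  obtain ⟨LB, hLB⟩ := h.lipschitz_B
  obtain ⟨KB, hKB⟩ := h.bounded_B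
  refine ⟨max C (L + L * KB + LB * 1), ?_⟩
  filter_upwards [ae_ae_of_ae_restrict hC] with t h1 htT
  filter_upwards [h1 htT] with x hx1
  have htc := Ioo_subset_Icc_self htT
  refine le_mul_min_one (surfDist_nonneg _ _ _) hx1
    ((norm_add_le _ _).trans (add_le_add ((norm_add_le _ _).trans (add_le_add ?_ ?_)) ?_))
    (le_max_left _ _) (le_max_right _ _)
  · exact norm_deriv_le_of_lipschitzOn (Icc_mem_nhds htT.1 htT.2) (lipschitzOnWith_time hL x)
  · refine ((fderiv ℝ (ξ t) x).le_opNorm _).trans ?_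
    exact mul_le_mul (norm_fderiv_le_of_lipschitz ℝ (lipschitzWith_slice hL htc))
        (hKB t htc x) (norm_nonneg _) (NNReal.coe_nonneg L)
  · refine ((ContinuousLinearMap.adjoint (fderiv ℝ (B t) x)).le_opNorm _).trans ?_
    rw [LinearIsometryEquiv.norm_map]
    exact mul_le_mul (norm_fderiv_le_of_lipschitz ℝ (hLB t htc)) (h.norm_xi_le_one htc x)
      (norm_nonneg _) (NNReal.coe_nonneg LB)

lemma exists_div_B_le (h : IsGradientFlowCalibration T Ω ξ B θ lam) :
    ∃ K : ℝ, ∀ t ∈ Icc 0 T, ∃ c, ∀ᵐ x, |divergence (B t) x - c| ≤ K * min (surfDist Ω t x) 1 := by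
  obtain ⟨c, ⟨Kc, hc⟩, C, hC⟩ := h.div_B
  obtain ⟨LB, hLB⟩ := h.lipschitz_B
  refine ⟨max C (d * LB + Kc), fun t ht => ⟨c t, ?_⟩⟩
  filter_upwards [hC t ht] with x hx
  exact le_mul_min_one (surfDist_nonneg _ _ _) hx
    ((abs_sub _ _).trans (add_le_add (abs_divergence_le (hLB t ht) x) (hc t ht)))
    (le_max_left _ _) (le_max_right _ _)

lemma exists_xi_xi_B_le (h : IsGradientFlowCalibration T Ω ξ B θ lam) :
    ∃ K : ℝ, ∀ t ∈ Icc 0 T, ∀ᵐ x,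
      |inner ℝ (ξ t x) (fderiv ℝ (B t) x (ξ t x))| ≤ K * min (surfDist Ω t x) 1 := by
  obtain ⟨C, hC⟩ := h.xi_xi_B
  obtain ⟨LB, hLB⟩ := h.lipschitz_B
  refine ⟨max C (1 * (LB * 1)), fun t ht => ?_⟩
  filter_upwards [hC t ht] with x hx
  have hn := h.norm_xi_le_one ht x
  refine le_mul_min_one (surfDist_nonneg _ _ _) hx ((abs_real_inner_le_norm _ _).trans
    (mul_le_mul hn (((fderiv ℝ (B t) x).le_opNorm _).trans (mul_le_mul
      (norm_fderiv_le_of_lipschitz ℝ (hLB t ht)) hn (norm_nonneg _) (NNReal.coe_nonneg LB)))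
      (norm_nonneg _) zero_le_one)) (le_max_left _ _) (le_max_right _ _)

lemma exists_evolution_le (hΩ : IsClosedSurfaceFamily T Ω) (hd : 1 ≤ d)
    (h : IsGradientFlowCalibration T Ω ξ B θ lam) :
    ∃ K : ℝ, ∀ t ∈ Icc 0 T, ∀ᵐ x,
      |divergence (ξ t) x - lam t + inner ℝ (B t x) (ξ t x)| ≤ K * min (surfDist Ω t x) 1 := by
  obtain ⟨C, hC⟩ := h.evolution
  obtain ⟨L, hL⟩ := h.lipschitz_xi
  obtain ⟨KB, hKB⟩ := h.bounded_B
  obtain ⟨Λ, hΛ⟩ := exists_abs_lam_le hΩ hd h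
  refine ⟨max C (d * L + Λ + KB * 1), fun t ht => ?_⟩
  filter_upwards [hC t ht] with x hx
  refine le_mul_min_one (surfDist_nonneg _ _ _) ?_ ((abs_add_le _ _).trans (add_le_add
    ((abs_sub _ _).trans (add_le_add (abs_divergence_le (lipschitzWith_slice hL ht) x) (hΛ t ht)))
    ((abs_real_inner_le_norm _ _).trans (mul_le_mul (hKB t ht x) (h.norm_xi_le_one ht x)
      (norm_nonneg _) ((norm_nonneg _).trans (hKB t ht x))))))
    (le_max_left _ _) (le_max_right _ _)
  rwa [show divergence (ξ t) x - lam t + inner ℝ (B t x) (ξ t x)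
    = inner ℝ (B t x) (ξ t x) + divergence (ξ t) x - lam t by ring]

/-- Either `1 − |ξ| ≥ c dist²`, or `ξ = 0` and `1 − |ξ| = 1` dominates the square of the truncated
distance. -/
lemma exists_short (h : IsGradientFlowCalibration T Ω ξ B θ lam) :
    ∃ K : ℝ, ∀ t ∈ Icc 0 T, ∀ x, min (surfDist Ω t x) 1 ^ 2 ≤ K * (1 - ‖ξ t x‖) := by
  obtain ⟨c, hc, hs⟩ := h.short
  refine ⟨1 / min c 1, fun t ht x => ?_⟩
  have hm : 0 < min c 1 := lt_min hc one_pos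
  rw [one_div, ← div_eq_inv_mul, le_div_iff₀ hm]
  have hD := surfDist_nonneg Ω t x
  have h0 : 0 ≤ min (surfDist Ω t x) 1 := le_min hD zero_le_one
  have h1 : min (surfDist Ω t x) 1 ^ 2 ≤ 1 := pow_le_one₀ h0 (min_le_right _ _)
  have h2 : min (surfDist Ω t x) 1 ^ 2 ≤ surfDist Ω t x ^ 2 :=
    pow_le_pow_left₀ h0 (min_le_left _ _) 2
  rcases le_max_iff.1 (hs t ht x) with h3 | h3
  · have := mul_le_mul h2 (min_le_left c 1) hm.le (sq_nonneg _)
    linarith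
  · have := mul_le_mul h1 (min_le_right c 1) hm.le zero_le_one
    linarith [norm_nonneg (ξ t x)]

lemma measureReal_pos (hΩ : IsClosedSurfaceFamily T Ω) {t : ℝ} (ht : t ∈ Icc 0 T) :
    0 < volume.real (Ω t) :=
  ENNReal.toReal_pos ((hΩ.isOpen t ht).measure_pos volume (hΩ.nonempty t ht)).ne'
    (hΩ.isBounded t ht).measure_lt_top.ne

/-- At almost every time the calibration satisfies all the pointwise estimates, with one constant. -/
theorem exists_sliceControl (hd : 1 ≤ d) (hΩ : IsClosedSurfaceFamily T Ω)
    (hvol : ∀ t ∈ Set.Icc 0 T, volume (Ω t) = volume (Ω 0))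
    (h : IsGradientFlowCalibration T Ω ξ B θ lam) :
    ∃ K : NNReal, ∀ᵐ t, t ∈ Ioo 0 T → SliceControl K (volume.real (Ω 0)) (Ω t)
      (fun x => min (surfDist Ω t x) 1) (θ t) (fun x => deriv (fun s => θ s x) t) (ξ t) (B t)
      (fun x => deriv (fun s => ξ s x) t) (lam t) := by
  obtain ⟨Lξ, hLξ⟩ := h.lipschitz_xi
  obtain ⟨Lθ, hLθ⟩ := h.lipschitz_theta
  obtain ⟨LB, hLB⟩ := h.lipschitz_B
  obtain ⟨KB, hKB⟩ := h.bounded_B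
  obtain ⟨Kθ, hKθ⟩ := h.theta_bounded
  obtain ⟨R, hR⟩ := exists_bound hΩ hd h
  obtain ⟨Λ, hΛ⟩ := exists_abs_lam_le hΩ hd h
  obtain ⟨C1, hC1⟩ := h.exists_short
  obtain ⟨C2, hC2, hmin⟩ := h.exists_min_surfDist_le
  obtain ⟨C3, hC3⟩ := h.exists_div_B_le
  obtain ⟨C4, hC4⟩ := h.exists_xi_xi_B_le
  obtain ⟨C5, hC5⟩ := exists_evolution_le hΩ hd h
  obtain ⟨C6, -, hC6⟩ := h.exists_abs_transport_theta_le
  obtain ⟨C7, hC7⟩ := h.exists_transport_length_le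
  obtain ⟨C8, hC8⟩ := h.exists_transport_xi_le
  -- The entry 2 bounds `arctanField`. The entry `R + 1` makes the truncated distance equal to 1
  -- outside the ball of radius `K`, since every surface lies in the closed ball of radius `R`.
  obtain ⟨K, hK⟩ := exists_nnreal_ge [2, Lξ, Lθ, LB, KB, Kθ, R + 1, Λ, d * Lξ, d * LB, d * Lξ + Λ,
    C1, C2, C3, C4, C5, C6, C7, C8]
  simp only [List.mem_cons, List.not_mem_nil, or_false, forall_eq_or_imp, forall_eq] at hK
  obtain ⟨k2, kLξ, kLθ, kLB, kKB, kKθ, kR, kΛ, kdξ, kdB, kdξΛ, k1, kC2, k3, k4, k5, k6, k7, k8⟩ := hK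
  refine ⟨K, ?_⟩
  filter_upwards [hC6, hC7, hC8, ae_integral_divergence_eq_zero hΩ hd hvol h,
    ae_differentiableAt_of_lipschitzOnWith hLξ, ae_differentiableAt_of_lipschitzOnWith hLθ]
    with t t6 t7 t8 tdiv tξ tθ htT
  have ht := Ioo_subset_Icc_self htT
  have hnh := Icc_mem_nhds htT.1 htT.2
  have hδ : ∀ x, 0 ≤ min (surfDist Ω t x) 1 := fun x =>
    le_min (surfDist_nonneg _ _ _) zero_le_one
  have up : ∀ {C : ℝ} {x : Rd d}, C ≤ K → C * min (surfDist Ω t x) 1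
      ≤ K * min (surfDist Ω t x) 1 := fun hC => mul_le_mul_of_nonneg_right hC (hδ _)
  have hξl := lipschitzWith_slice hLξ ht
  have hdξ := fun x => abs_divergence_le hξl x
  exact
    { two_le := k2
      lip_xi := hξl.weaken (by exact_mod_cast kLξ)
      lip_B := (hLB t ht).weaken (by exact_mod_cast kLB)
      lip_theta := (lipschitzWith_slice hLθ ht).weaken (by exact_mod_cast kLθ)
      norm_xi_le := h.norm_xi_le_one ht
      norm_B_le := fun x => (hKB t ht x).trans kKB
      abs_theta_le := fun x => (hKθ t ht x).trans kKθ
      abs_div_B_le := fun x => (abs_divergence_le (hLB t ht) x).trans kdB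
      abs_div_xi_le := fun x => (hdξ x).trans kdξ
      abs_div_xi_sub_le := fun x => ((abs_sub _ _).trans (add_le_add (hdξ x) (hΛ t ht))).trans kdξΛ
      abs_l_le := (hΛ t ht).trans kΛ
      delta_nonneg := hδ
      delta_le_one := fun x => min_le_right _ _
      delta_far := fun x hx => by
        refine min_eq_right ((Metric.le_infDist (hΩ.frontier_nonempty hd ht)).2 fun y hy => ?_)
        have h1 : ‖y‖ ≤ R := by
          have h2 : closure (Ω t) ⊆ Metric.closedBall 0 R :=
            closure_minimal (fun z hz => by simpa using (hR t ht z hz).le) Metric.isClosed_closedBall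
          simpa using h2 (frontier_subset_closure hy)
        have := norm_sub_norm_le x y
        rw [dist_eq_norm]
        linarith
      short := fun x => (hC1 t ht x).trans
        (mul_le_mul_of_nonneg_right k1 (sub_nonneg.2 (h.norm_xi_le_one ht x)))
      theta_le := fun x => le_mul_min_one (surfDist_nonneg _ _ _)
        (abs_theta_le_mul_surfDist hΩ hd h hLθ ht x) (hKθ t ht x) kLθ kKθ
      le_theta := fun x => (hmin t ht x).trans (mul_le_mul_of_nonneg_right kC2 (abs_nonneg _))
      div_B := by
        obtain ⟨c, hc⟩ := hC3 t ht
        exact ⟨c, hc.mono fun x hx => hx.trans (up k3)⟩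
      xi_xi_B := (hC4 t ht).mono fun x hx => hx.trans (up k4)
      evolution := (hC5 t ht).mono fun x hx => hx.trans (up k5)
      transport_theta := (t6 htT).mono fun x hx => hx.trans (up k6)
      transport_length := (t7 htT).mono fun x hx =>
        hx.trans (mul_le_mul_of_nonneg_right k7 (sq_nonneg _))
      transport_xi := (t8 htT).mono fun x hx => hx.trans (up k8)
      meas_xit := aestronglyMeasurable_of_hasDerivAt (F := ξ) (t := t)
        (by filter_upwards [hnh] with s hs
            exact (lipschitzWith_slice hLξ hs).continuous.aestronglyMeasurable)
        ((tξ htT).mono fun x hx => hx.time.hasDerivAt)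
      meas_thetat := aestronglyMeasurable_of_hasDerivAt (F := θ) (t := t)
        (by filter_upwards [hnh] with s hs
            exact (lipschitzWith_slice hLθ hs).continuous.aestronglyMeasurable)
        ((tθ htT).mono fun x hx => hx.time.hasDerivAt)
      norm_xit_le := .of_forall fun x =>
        (norm_deriv_le_of_lipschitzOn hnh (lipschitzOnWith_time hLξ x)).trans kLξ
      abs_thetat_le := .of_forall fun x =>
        (norm_deriv_le_of_lipschitzOn hnh (lipschitzOnWith_time hLθ x)).trans kLθ
      mem_iff := h.mem_iff ht
      bounded := fun x hx => (hR t ht x hx).trans_le (by linarith)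
      volume_pos := measureReal_pos hΩ ⟨le_rfl, (htT.1.trans htT.2).le⟩
      volume_eq := by rw [measureReal_def, measureReal_def, hvol t ht]
      integral_div := tdiv htT }

end IsGradientFlowCalibration

/-! ### Quantities whose increments are integrals -/

/-- Here and in `hasDerivAt_of_sub_eq_integral` the integrand of the increment need not be a
difference of two integrands. This leaves room to integrate by parts in space before estimating in
time. -/
lemma absolutelyContinuousOnInterval_of_sub_eq_integral {H : ℝ → ℝ} {A : ℝ → ℝ → Rd d → ℝ} {a b : ℝ}
    {L : Rd d → ℝ} (hab : a ≤ b) (hL : Integrable L)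
    (hH : ∀ s ∈ Icc a b, ∀ t ∈ Icc a b, H s - H t = ∫ x, A s t x)
    (hA : ∀ s ∈ Icc a b, ∀ t ∈ Icc a b, ∀ x, |A s t x| ≤ L x * |s - t|) :
    AbsolutelyContinuousOnInterval H a b := by
  refine LipschitzOnWith.absolutelyContinuousOnInterval (K := (∫ x, L x).toNNReal) ?_
  rw [uIcc_of_le hab]
  refine LipschitzOnWith.of_dist_le_mul fun s hs t ht => ?_
  rw [Real.dist_eq, Real.dist_eq, hH s hs t ht]
  calc |∫ x, A s t x| ≤ ∫ x, L x * |s - t| :=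
        norm_integral_le_of_norm_le (f := A s t) (hL.mul_const _) (.of_forall (hA s hs t ht))
    _ = (∫ x, L x) * |s - t| := integral_mul_const _ _
    _ ≤ _ := mul_le_mul_of_nonneg_right (Real.le_coe_toNNReal _) (abs_nonneg _)

lemma hasDerivAt_of_sub_eq_integral {H : ℝ → ℝ} {A : ℝ → Rd d → ℝ} {A' : Rd d → ℝ} {a b t : ℝ}
    {L : Rd d → ℝ} (ht : t ∈ Ioo a b) (hL : Integrable L)
    (hH : ∀ s ∈ Icc a b, H s - H t = ∫ x, A s x)
    (hA : ∀ s ∈ Icc a b, ∀ x, |A s x| ≤ L x * |s - t|)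
    (hm : ∀ s ∈ Icc a b, AEStronglyMeasurable (A s))
    (hlim : ∀ᵐ x, Tendsto (fun s => (s - t)⁻¹ * A s x) (𝓝[≠] t) (𝓝 (A' x))) :
    HasDerivAt H (∫ x, A' x) t := by
  rw [hasDerivAt_iff_tendsto_slope]
  have hn : ∀ᶠ s in 𝓝[≠] t, s ∈ Icc a b := nhdsWithin_le_nhds (Icc_mem_nhds ht.1 ht.2)
  have key : Tendsto (fun s => ∫ x, (s - t)⁻¹ * A s x) (𝓝[≠] t) (𝓝 (∫ x, A' x)) := by
    refine tendsto_integral_filter_of_dominated_convergence L ?_ ?_ hL hlim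
    · filter_upwards [hn] with s hs using (hm s hs).const_mul _
    · filter_upwards [hn, self_mem_nhdsWithin] with s hs hne
      refine .of_forall fun x => ?_
      have hpos : 0 < |s - t| := abs_pos.2 (sub_ne_zero.2 hne)
      rw [norm_mul, norm_inv, Real.norm_eq_abs, Real.norm_eq_abs, inv_mul_le_iff₀ hpos, mul_comm]
      exact hA s hs x
  refine key.congr' ?_
  filter_upwards [hn] with s hs
  rw [integral_const_mul, ← hH s hs, slope_def_module, smul_eq_mul]

/-! ### Increments of the localized Dirichlet energy -/

/-- Factor `|∇v|² − |∇w|² = ∇(v − w)·∇(v + w)` and integrate by parts. With `v`, `w` two time slices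
of `u`, the increment of the Dirichlet energy is expressed by `u(s) − u(t)`, so `∇u` need not be
differentiable in time. -/
lemma integral_mul_norm_gradient_sq_sub {v w η : Rd d → ℝ} (hv : ContDiff ℝ 2 v)
    (hw : ContDiff ℝ 2 w) (hη : ContDiff ℝ 2 η) (hηc : HasCompactSupport η) :
    ∫ x, η x * (‖gradient v x‖ ^ 2 - ‖gradient w x‖ ^ 2)
      = -∫ x, (v x - w x) * ((η x * Laplacian.laplacian v x + fderiv ℝ η x (gradient v x))
          + (η x * Laplacian.laplacian w x + fderiv ℝ η x (gradient w x))) := by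
  let e : Fin d → Rd d := fun i => EuclideanSpace.single i 1
  have hη1 : ContDiff ℝ 1 η := hη.of_le (by norm_num)
  have hq : ContDiff ℝ 1 (fun x => v x - w x) := (hv.sub hw).of_le (by norm_num)
  have hp : ∀ i, ContDiff ℝ 1 (fun x => fderiv ℝ v x (e i) + fderiv ℝ w x (e i)) := fun i =>
    (contDiff_partial hv _).add (contDiff_partial hw _)
  have hg : ∀ i, ContDiff ℝ 1 (fun x => η x * (fderiv ℝ v x (e i) + fderiv ℝ w x (e i))) :=
    fun i => hη1.mul (hp i)
  have hgc : ∀ i, HasCompactSupport (fun x => η x * (fderiv ℝ v x (e i) + fderiv ℝ w x (e i))) :=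
    fun i => hηc.mul_right
  have hdq : ∀ i x, fderiv ℝ (fun x => v x - w x) x (e i) = fderiv ℝ v x (e i) - fderiv ℝ w x (e i) := by
    intro i x
    rw [fderiv_fun_sub (hv.differentiable (by norm_num) x) (hw.differentiable (by norm_num) x)]
    rfl
  have hdg : ∀ i x, fderiv ℝ (fun x => η x * (fderiv ℝ v x (e i) + fderiv ℝ w x (e i))) x (e i)
      = η x * (fderiv ℝ (fderiv ℝ v) x (e i) (e i) + fderiv ℝ (fderiv ℝ w) x (e i) (e i))
        + (fderiv ℝ v x (e i) + fderiv ℝ w x (e i)) * fderiv ℝ η x (e i) := by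
    intro i x
    rw [fderiv_fun_mul (hη1.differentiable (by norm_num) x) ((hp i).differentiable (by norm_num) x),
      fderiv_fun_add ((contDiff_partial hv _).differentiable (by norm_num) x)
        ((contDiff_partial hw _).differentiable (by norm_num) x)]
    simp only [_root_.add_apply, _root_.smul_apply, smul_eq_mul, fderiv_partial hv, fderiv_partial hw]
  have ibp : ∀ i, ∫ x, (v x - w x)
      * fderiv ℝ (fun x => η x * (fderiv ℝ v x (e i) + fderiv ℝ w x (e i))) x (e i)
      = -∫ x, fderiv ℝ (fun x => v x - w x) x (e i)
        * (η x * (fderiv ℝ v x (e i) + fderiv ℝ w x (e i))) := by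
    intro i
    obtain ⟨M, hM⟩ := (hg i).lipschitzWith_of_hasCompactSupport (hgc i) (by norm_num)
    exact integral_mul_fderiv_of_contDiff hq hM (hgc i) (e i)
  have i1 : ∀ i, Integrable fun x => (v x - w x)
      * fderiv ℝ (fun x => η x * (fderiv ℝ v x (e i) + fderiv ℝ w x (e i))) x (e i) := fun i => by
    obtain ⟨M, hM⟩ := (hg i).lipschitzWith_of_hasCompactSupport (hgc i) (by norm_num)
    exact integrable_mul_fderiv_of_compact hq.continuous hM (hgc i) (e i)
  have i2 : ∀ i, Integrable fun x => fderiv ℝ (fun x => v x - w x) x (e i)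
        * (η x * (fderiv ℝ v x (e i) + fderiv ℝ w x (e i))) := fun i =>
    integrable_mul_of_compact ((hq.continuous_fderiv (by norm_num)).clm_apply continuous_const)
      (hg i).continuous (hgc i)
  have lhs : ∫ x, η x * (‖gradient v x‖ ^ 2 - ‖gradient w x‖ ^ 2)
      = ∑ i, ∫ x, fderiv ℝ (fun x => v x - w x) x (e i)
        * (η x * (fderiv ℝ v x (e i) + fderiv ℝ w x (e i))) := by
    rw [← integral_finsetSum _ fun i _ => i2 i]
    refine integral_congr_ae (.of_forall fun x => ?_)
    simp only [norm_gradient_sq, hdq, ← Finset.sum_sub_distrib, Finset.mul_sum]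
    exact Finset.sum_congr rfl fun i _ => by simp only [e]; ring
  have rhs : ∫ x, (v x - w x) * ((η x * Laplacian.laplacian v x + fderiv ℝ η x (gradient v x))
          + (η x * Laplacian.laplacian w x + fderiv ℝ η x (gradient w x)))
      = ∑ i, ∫ x, (v x - w x)
      * fderiv ℝ (fun x => η x * (fderiv ℝ v x (e i) + fderiv ℝ w x (e i))) x (e i) := by
    rw [← integral_finsetSum _ fun i _ => i1 i]
    refine integral_congr_ae (.of_forall fun x => ?_)
    simp only [hdg]
    rw [← Finset.mul_sum]
    congr 1
    simp only [laplacian_eq_sum, clm_apply_eq_sum_mul _ (gradient _ x), gradient_coord,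
      Finset.mul_sum, ← Finset.sum_add_distrib]
    exact Finset.sum_congr rfl fun i _ => by simp only [e]; ring
  rw [lhs, rhs, ← Finset.sum_neg_distrib]
  exact Finset.sum_congr rfl fun i _ => by rw [ibp i, neg_neg]

/-! ### Solutions of the nonlocal Allen-Cahn equation -/

/-- The time derivative of a function of time and space. -/
def timeDeriv (u : ℝ → Rd d → ℝ) (t : ℝ) (x : Rd d) : ℝ := deriv (fun s => u s x) t

namespace IsNonlocalAllenCahnSolution

variable {W : ℝ → ℝ} {ε T : ℝ} {u : ℝ → Rd d → ℝ}

lemma hasDerivAt (hs : IsNonlocalAllenCahnSolution W ε T u) {t : ℝ} (ht : t ∈ Ioo 0 T) (x : Rd d) :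
    HasDerivAt (fun s => u s x) (timeDeriv u t x) t := (hs.differentiable_time t ht x).hasDerivAt

lemma contDiff_one (hs : IsNonlocalAllenCahnSolution W ε T u) {t : ℝ} (ht : t ∈ Ioo 0 T) :
    ContDiff ℝ 1 (u t) := (hs.contDiff_space t ht).of_le (by norm_num)

lemma continuousOn_timeDeriv (hs : IsNonlocalAllenCahnSolution W ε T u) :
    ContinuousOn (fun p : ℝ × Rd d => timeDeriv u p.1 p.2) (Ioo 0 T ×ˢ univ) :=
  hs.continuousOn_deriv

lemma continuousOn_interior (hs : IsNonlocalAllenCahnSolution W ε T u) :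
    ContinuousOn (fun p : ℝ × Rd d => u p.1 p.2) (Ioo 0 T ×ˢ univ) :=
  hs.continuousOn.mono (prod_mono Ioo_subset_Ico_self Subset.rfl)

lemma continuousOn_laplacian (hs : IsNonlocalAllenCahnSolution W ε T u) :
    ContinuousOn (fun p : ℝ × Rd d => Laplacian.laplacian (u p.1) p.2) (Ioo 0 T ×ˢ univ) := by
  have : (fun p : ℝ × Rd d => Laplacian.laplacian (u p.1) p.2) = fun p => ∑ i,
      iteratedFDeriv ℝ 2 (u p.1) p.2 ![EuclideanSpace.basisFun (Fin d) ℝ i,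
        EuclideanSpace.basisFun (Fin d) ℝ i] := by
    ext p
    rw [InnerProductSpace.laplacian_eq_iteratedFDeriv_orthonormalBasis (u p.1)
      (EuclideanSpace.basisFun (Fin d) ℝ)]
  rw [this]
  refine continuousOn_finsetSum _ fun i _ => ?_
  exact (ContinuousMultilinearMap.apply ℝ (fun _ : Fin 2 => Rd d) ℝ _).continuous.comp_continuousOn
    hs.continuousOn_iteratedFDeriv

lemma continuousOn_gradient (hs : IsNonlocalAllenCahnSolution W ε T u) :
    ContinuousOn (fun p : ℝ × Rd d => gradient (u p.1) p.2) (Ioo 0 T ×ˢ univ) :=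
  (InnerProductSpace.toDual ℝ (Rd d)).symm.continuous.comp_continuousOn hs.continuousOn_fderiv

/-- A function that is continuous in time and space is continuous in time at every point. -/
lemma tendsto_time {E : Type*} [TopologicalSpace E] {f : ℝ → Rd d → E} {t : ℝ}
    (hf : ContinuousOn (fun p : ℝ × Rd d => f p.1 p.2) (Ioo 0 T ×ˢ univ)) (ht : t ∈ Ioo 0 T)
    (x : Rd d) : Tendsto (fun s => f s x) (𝓝 t) (𝓝 (f t x)) := by
  have h1 : ContinuousAt (fun p : ℝ × Rd d => f p.1 p.2) (t, x) :=
    hf.continuousAt (prod_mem_nhds (Ioo_mem_nhds ht.1 ht.2) univ_mem)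
  exact h1.tendsto.comp ((continuous_id.prodMk continuous_const).tendsto' t (t, x) rfl)

lemma exists_bound_of_continuousOn {E : Type*} [NormedAddCommGroup E] {f : ℝ → Rd d → E} {a b : ℝ}
    (hf : ContinuousOn (fun p : ℝ × Rd d => f p.1 p.2) (Ioo 0 T ×ˢ univ)) (ha : 0 < a) (hb : b < T)
    {S : Set (Rd d)} (hS : IsCompact S) :
    ∃ M : ℝ, 0 ≤ M ∧ ∀ t ∈ Icc a b, ∀ x ∈ S, ‖f t x‖ ≤ M := by
  obtain ⟨M, hM⟩ := ((isCompact_Icc (a := a) (b := b)).prod hS).exists_bound_of_continuousOn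
    (hf.mono (prod_mono (fun t ht => ⟨ha.trans_le ht.1, ht.2.trans_lt hb⟩) (subset_univ S)))
  exact ⟨|M|, abs_nonneg M, fun t ht x hx => (hM (t, x) ⟨ht, hx⟩).trans (le_abs_self M)⟩

lemma hasDerivAt_comp (hs : IsNonlocalAllenCahnSolution W ε T u) {Φ : ℝ → ℝ} (hΦ : ContDiff ℝ 1 Φ)
    {t : ℝ} (ht : t ∈ Ioo 0 T) (x : Rd d) :
    HasDerivAt (fun s => Φ (u s x)) (deriv Φ (u t x) * timeDeriv u t x) t :=
  (hΦ.differentiable (by norm_num) _).hasDerivAt.comp t (hs.hasDerivAt ht x)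

lemma exists_lipschitz_comp (hs : IsNonlocalAllenCahnSolution W ε T u) {Φ : ℝ → ℝ}
    (hΦ : ContDiff ℝ 1 Φ) {a b : ℝ} (ha : 0 < a) (hb : b < T) {S : Set (Rd d)} (hS : IsCompact S) :
    ∃ M : ℝ, 0 ≤ M ∧ ∀ s ∈ Icc a b, ∀ t ∈ Icc a b, ∀ x ∈ S,
      |Φ (u s x) - Φ (u t x)| ≤ M * |s - t| := by
  obtain ⟨M, hM0, hM⟩ := exists_bound_of_continuousOn
    (f := fun t x => deriv Φ (u t x) * timeDeriv u t x)
    (((hΦ.continuous_deriv (by norm_num)).comp_continuousOn hs.continuousOn_interior).mul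
      hs.continuousOn_timeDeriv) ha hb hS
  refine ⟨M, hM0, fun s hs' t ht x hx => ?_⟩
  exact (convex_Icc a b).norm_image_sub_le_of_norm_hasDerivWithin_le (f := fun s => Φ (u s x))
    (fun r hr => (hs.hasDerivAt_comp hΦ
      ⟨ha.trans_le hr.1, hr.2.trans_lt hb⟩ x).hasDerivWithinAt) (fun r hr => hM r hr x hx) ht hs'

lemma tendsto_slope_comp (hs : IsNonlocalAllenCahnSolution W ε T u) {Φ : ℝ → ℝ}
    (hΦ : ContDiff ℝ 1 Φ) {t : ℝ} (ht : t ∈ Ioo 0 T) (x : Rd d) :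
    Tendsto (fun s => (s - t)⁻¹ * (Φ (u s x) - Φ (u t x))) (𝓝[≠] t)
      (𝓝 (deriv Φ (u t x) * timeDeriv u t x)) := by
  have := hasDerivAt_iff_tendsto_slope.1 (hs.hasDerivAt_comp hΦ ht x)
  exact this.congr fun s => by rw [slope_def_module, smul_eq_mul]

variable {η : Rd d → ℝ} {a b : ℝ}

/-- The expression `div (η ∇u)`. -/
lemma continuousOn_div_mul_gradient (hs : IsNonlocalAllenCahnSolution W ε T u)
    (hη : ContDiff ℝ 2 η) :
    ContinuousOn (fun p : ℝ × Rd d => η p.2 * Laplacian.laplacian (u p.1) p.2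
      + fderiv ℝ η p.2 (gradient (u p.1) p.2)) (Ioo 0 T ×ˢ univ) := by
  refine ((hη.continuous.comp continuous_snd).continuousOn.mul hs.continuousOn_laplacian).add ?_
  exact (((hη.continuous_fderiv (by norm_num)).comp continuous_snd).continuousOn).clm_apply
    hs.continuousOn_gradient

lemma localized_energy_sub (hs : IsNonlocalAllenCahnSolution W ε T u) (hW : ContDiff ℝ 1 W)
    (hη : ContDiff ℝ 2 η) (hηc : HasCompactSupport η) {s t : ℝ} (hsT : s ∈ Ioo 0 T)
    (htT : t ∈ Ioo 0 T) :
    (∫ x, η x * energyDensity W ε (u s) x) - ∫ x, η x * energyDensity W ε (u t) x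
      = ∫ x, (-(ε / 2) * ((u s x - u t x) * ((η x * Laplacian.laplacian (u s) x
          + fderiv ℝ η x (gradient (u s) x)) + (η x * Laplacian.laplacian (u t) x
          + fderiv ℝ η x (gradient (u t) x)))) + 1 / ε * (η x * (W (u s x) - W (u t x)))) := by
  have hcg : ∀ r ∈ Ioo 0 T, Continuous (gradient (u r)) := fun r hr =>
    continuous_gradient (hs.contDiff_one hr)
  have hcu : ∀ r ∈ Ioo 0 T, Continuous (u r) := fun r hr => (hs.contDiff_space r hr).continuous
  have hcl : ∀ r ∈ Ioo 0 T, Continuous (Laplacian.laplacian (u r)) := fun r hr =>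
    continuous_laplacian (hs.contDiff_space r hr)
  have hce : ∀ r ∈ Ioo 0 T, Continuous (energyDensity W ε (u r)) := fun r hr => by
    have h1 := hcg r hr
    have h2 := hW.continuous.comp (hcu r hr)
    unfold energyDensity
    fun_prop
  have hcη := hη.continuous
  have hcη' := hη.continuous_fderiv (by norm_num)
  have ie : ∀ r ∈ Ioo 0 T, Integrable fun x => η x * energyDensity W ε (u r) x := fun r hr =>
    (hcη.mul (hce r hr)).integrable_of_hasCompactSupport hηc.mul_right
  have i1 : Integrable fun x => η x * (‖gradient (u s) x‖ ^ 2 - ‖gradient (u t) x‖ ^ 2) :=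
    (hcη.mul (((hcg s hsT).norm.pow 2).sub ((hcg t htT).norm.pow 2))).integrable_of_hasCompactSupport
      hηc.mul_right
  have i2 : Integrable fun x => η x * (W (u s x) - W (u t x)) :=
    (hcη.mul ((hW.continuous.comp (hcu s hsT)).sub
      (hW.continuous.comp (hcu t htT)))).integrable_of_hasCompactSupport hηc.mul_right
  have i3 : Integrable fun x => (u s x - u t x) * ((η x * Laplacian.laplacian (u s) x
          + fderiv ℝ η x (gradient (u s) x)) + (η x * Laplacian.laplacian (u t) x
          + fderiv ℝ η x (gradient (u t) x))) := by
    refine Continuous.integrable_of_hasCompactSupport ?_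
      (HasCompactSupport.intro hηc.isCompact fun x hx => ?_)
    · exact ((hcu s hsT).sub (hcu t htT)).mul (((hcη.mul (hcl s hsT)).add
        (hcη'.clm_apply (hcg s hsT))).add ((hcη.mul (hcl t htT)).add (hcη'.clm_apply (hcg t htT))))
    · rw [image_eq_zero_of_notMem_tsupport hx, fderiv_eq_zero_of_notMem_tsupport hx]; simp
  rw [← integral_sub (ie s hsT) (ie t htT), integral_add (i3.const_mul _) (i2.const_mul _),
    integral_const_mul, neg_mul, ← mul_neg,
    ← integral_mul_norm_gradient_sq_sub (hs.contDiff_space s hsT) (hs.contDiff_space t htT) hη hηc,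
    ← integral_const_mul, ← integral_add (i1.const_mul _) (i2.const_mul _)]
  refine integral_congr_ae (.of_forall fun x => ?_)
  simp only [energyDensity]
  ring

lemma integrable_indicator_of_compact {S : Set (Rd d)} (hS : IsCompact S) (c : ℝ) :
    Integrable (S.indicator fun _ => c) :=
  (integrable_indicator_iff hS.measurableSet).2 (integrableOn_const hS.measure_lt_top.ne)

/-- The localized energy is absolutely continuous, with the expected derivative. -/
lemma localized_energy_deriv (hs : IsNonlocalAllenCahnSolution W ε T u) (hW : ContDiff ℝ 1 W)
    (hε : 0 < ε) (hη : ContDiff ℝ 2 η) (hηc : HasCompactSupport η) (hη1 : ∀ x, |η x| ≤ 1)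
    (ha : 0 < a) (hab : a ≤ b) (hb : b < T) :
    AbsolutelyContinuousOnInterval (fun t => ∫ x, η x * energyDensity W ε (u t) x) a b ∧
    ∀ t ∈ Ioo a b, HasDerivAt (fun t => ∫ x, η x * energyDensity W ε (u t) x)
      (∫ x, -(ε * (timeDeriv u t x * (η x * localForce W ε (u t) x
        + fderiv ℝ η x (gradient (u t) x))))) t := by
  have hsub : ∀ t ∈ Icc a b, t ∈ Ioo 0 T := fun t ht => ⟨ha.trans_le ht.1, ht.2.trans_lt hb⟩
  have hS := hηc.isCompact
  obtain ⟨M1, hM1, hu⟩ := hs.exists_lipschitz_comp (Φ := id) contDiff_id ha hb hS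
  obtain ⟨M2, hM2, hWu⟩ := hs.exists_lipschitz_comp hW ha hb hS
  have hcR := hs.continuousOn_div_mul_gradient hη
  obtain ⟨M3, hM3, hR⟩ := exists_bound_of_continuousOn
    (f := fun t x => η x * Laplacian.laplacian (u t) x + fderiv ℝ η x (gradient (u t) x))
    hcR ha hb hS
  have hbound : ∀ s ∈ Icc a b, ∀ t ∈ Icc a b, ∀ x,
      |-(ε / 2) * ((u s x - u t x) * ((η x * Laplacian.laplacian (u s) x
          + fderiv ℝ η x (gradient (u s) x)) + (η x * Laplacian.laplacian (u t) x
          + fderiv ℝ η x (gradient (u t) x)))) + 1 / ε * (η x * (W (u s x) - W (u t x)))|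
      ≤ (tsupport η).indicator (fun _ => ε / 2 * (M1 * (M3 + M3)) + 1 / ε * M2) x * |s - t| := by
    intro s hs' t ht x
    by_cases hx : x ∈ tsupport η
    · rw [indicator_of_mem hx]
      refine (abs_add_le _ _).trans ?_
      rw [add_mul]
      refine add_le_add ?_ ?_
      · rw [abs_mul, abs_neg, abs_of_pos (by positivity : 0 < ε / 2), abs_mul, mul_assoc]
        refine mul_le_mul_of_nonneg_left ?_ (by positivity)
        calc _ ≤ (M1 * |s - t|) * (M3 + M3) := mul_le_mul (hu s hs' t ht x hx)
              ((abs_add_le _ _).trans (add_le_add (hR s hs' x hx) (hR t ht x hx)))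
              (abs_nonneg _) (by positivity)
          _ = _ := by ring
      · rw [abs_mul, abs_of_pos (by positivity : 0 < 1 / ε), abs_mul, mul_assoc]
        refine mul_le_mul_of_nonneg_left ?_ (by positivity)
        calc _ ≤ 1 * (M2 * |s - t|) := mul_le_mul (hη1 x) (hWu s hs' t ht x hx)
              (abs_nonneg _) zero_le_one
          _ = _ := one_mul _
    · rw [indicator_of_notMem hx, image_eq_zero_of_notMem_tsupport hx,
        fderiv_eq_zero_of_notMem_tsupport hx]
      simp
  refine ⟨absolutelyContinuousOnInterval_of_sub_eq_integral hab
    (integrable_indicator_of_compact hS _)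
    (fun s hs' t ht => hs.localized_energy_sub hW hη hηc (hsub s hs') (hsub t ht)) hbound,
    fun t ht => ?_⟩
  have htc := Ioo_subset_Icc_self ht
  have htT := hsub t htc
  refine hasDerivAt_of_sub_eq_integral ht (integrable_indicator_of_compact hS _)
    (fun s hs' => hs.localized_energy_sub hW hη hηc (hsub s hs') htT)
    (fun s hs' => hbound s hs' t htc) (fun s hs' => ?_) (.of_forall fun x => ?_)
  · have hcη := hη.continuous
    have hcη' := hη.continuous_fderiv (by norm_num)
    have hR : ∀ r ∈ Ioo 0 T, Continuous fun x => η x * Laplacian.laplacian (u r) x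
          + fderiv ℝ η x (gradient (u r) x) := fun r hr =>
      (hcη.mul (continuous_laplacian (hs.contDiff_space r hr))).add
        (hcη'.clm_apply (continuous_gradient (hs.contDiff_one hr)))
    have hcu : ∀ r ∈ Ioo 0 T, Continuous (u r) := fun r hr => (hs.contDiff_space r hr).continuous
    exact ((continuous_const.mul (((hcu s (hsub s hs')).sub (hcu t htT)).mul
      ((hR s (hsub s hs')).add (hR t htT)))).add (continuous_const.mul (hcη.mul
        ((hW.continuous.comp (hcu s (hsub s hs'))).sub
          (hW.continuous.comp (hcu t htT)))))).aestronglyMeasurable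
  · have l1 := hs.tendsto_slope_comp (Φ := id) contDiff_id htT x
    have l2 := hs.tendsto_slope_comp hW htT x
    -- The divergences `div(η∇u)` at times `s` and `t` add up in the limit to twice the one at `t`,
    -- which cancels the factor one half of the Dirichlet energy.
    have l3 := ((tendsto_time (f := fun t x => η x * Laplacian.laplacian (u t) x
      + fderiv ℝ η x (gradient (u t) x)) hcR htT x).mono_left
        (nhdsWithin_le_nhds (s := {t}ᶜ))).add_const
        (η x * Laplacian.laplacian (u t) x + fderiv ℝ η x (gradient (u t) x))
    have l4 := ((l1.mul l3).const_mul (-(ε / 2))).add ((l2.const_mul (η x)).const_mul (1 / ε))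
    simp only [id, deriv_id', one_mul] at l4
    refine (l4.congr fun s => by ring).trans_eq ?_
    congr 1
    rw [localForce]
    field_simp
    ring

end IsNonlocalAllenCahnSolution

/-! ### Localized flux and localized volume error in time. -/

namespace IsNonlocalAllenCahnSolution

variable {W : ℝ → ℝ} {ε T : ℝ} {u : ℝ → Rd d → ℝ} {η : Rd d → ℝ} {a b : ℝ}

lemma continuousOn_fderiv_psi (hs : IsNonlocalAllenCahnSolution W ε T u) (hW : IsDoubleWell W) :
    ContinuousOn (fun p : ℝ × Rd d => fderiv ℝ (psi W (u p.1)) p.2) (Ioo 0 T ×ˢ univ) := by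
  have h1 : ContinuousOn (fun p : ℝ × Rd d => Real.sqrt (2 * W (u p.1 p.2))
      • fderiv ℝ (u p.1) p.2) (Ioo 0 T ×ˢ univ) :=
    (hW.continuous_sqrt.comp_continuousOn hs.continuousOn_interior).smul hs.continuousOn_fderiv
  exact h1.congr fun p hp => hW.fderiv_psi (hs.contDiff_one hp.1) p.2

lemma tendsto_slope_psi (hs : IsNonlocalAllenCahnSolution W ε T u) (hW : IsDoubleWell W)
    {t : ℝ} (ht : t ∈ Ioo 0 T) (x : Rd d) :
    Tendsto (fun s => (s - t)⁻¹ * (psi W (u s) x - psi W (u t) x)) (𝓝[≠] t)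
      (𝓝 (Real.sqrt (2 * W (u t x)) * timeDeriv u t x)) := by
  have := hs.tendsto_slope_comp hW.contDiff_phi ht x
  rwa [(hW.hasDerivAt_phi _).deriv] at this

lemma hasDerivAt_psi (hs : IsNonlocalAllenCahnSolution W ε T u) (hW : IsDoubleWell W)
    {t : ℝ} (ht : t ∈ Ioo 0 T) (x : Rd d) :
    HasDerivAt (fun s => psi W (u s) x) (Real.sqrt (2 * W (u t x)) * timeDeriv u t x) t := by
  have := hs.hasDerivAt_comp hW.contDiff_phi ht x
  rwa [(hW.hasDerivAt_phi _).deriv] at this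

/-- A discrete product rule: the increment of the field is paired with `∇ψ(s)`, and the gradient of
`ψ(s) − ψ(t)` is thrown onto `ηξ'`. Thus only `ψ` itself is differentiated in time. -/
lemma localized_flux_sub (hs : IsNonlocalAllenCahnSolution W ε T u) (hW : IsDoubleWell W)
    (hη : ContDiff ℝ 2 η) (hηc : HasCompactSupport η) {ξ ξ' : Rd d → Rd d} (hξ : Continuous ξ)
    {L : NNReal} (hξ' : LipschitzWith L (fun x => η x • ξ' x)) (hξ'c : Continuous ξ')
    {s t : ℝ} (hsT : s ∈ Ioo 0 T) (htT : t ∈ Ioo 0 T) :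
    (∫ x, η x * fderiv ℝ (psi W (u s)) x (ξ x)) - ∫ x, η x * fderiv ℝ (psi W (u t)) x (ξ' x)
      = ∫ x, (η x * fderiv ℝ (psi W (u s)) x (ξ x - ξ' x)
        - (psi W (u s) x - psi W (u t) x) * divergence (fun x => η x • ξ' x) x) := by
  have hψ : ∀ r ∈ Ioo 0 T, ContDiff ℝ 1 (psi W (u r)) := fun r hr =>
    hW.contDiff_psi (hs.contDiff_one hr)
  have hcψ : ∀ r ∈ Ioo 0 T, Continuous (fderiv ℝ (psi W (u r))) := fun r hr =>
    (hψ r hr).continuous_fderiv (by norm_num)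
  have hcη := hη.continuous
  have hYc : HasCompactSupport (fun x => η x • ξ' x) := hηc.smul_right
  have hib := integral_fderiv_apply_of_compact_field ((hψ s hsT).sub (hψ t htT)) hξ' hYc
  have i1 : ∀ r ∈ Ioo 0 T, ∀ Y : Rd d → Rd d, Continuous Y →
      Integrable fun x => η x * fderiv ℝ (psi W (u r)) x (Y x) := fun r hr Y hY =>
    (hcη.mul ((hcψ r hr).clm_apply hY)).integrable_of_hasCompactSupport hηc.mul_right
  have i2 : Integrable fun x => (psi W (u s) x - psi W (u t) x)
      * divergence (fun x => η x • ξ' x) x := by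
    have hc : Continuous fun x => psi W (u s) x - psi W (u t) x :=
      (hψ s hsT).continuous.sub (hψ t htT).continuous
    obtain ⟨C, hC⟩ := hYc.isCompact.exists_bound_of_continuousOn hc.continuousOn
    refine integrable_of_bounded_of_compact hYc.isCompact
      (hc.aestronglyMeasurable.mul (measurable_divergence _).aestronglyMeasurable) (C * (d * L))
      (.of_forall fun x hx => ?_) fun x hx => ?_
    · rw [norm_mul]
      exact mul_le_mul (hC x hx) (abs_divergence_le hξ' x) (norm_nonneg _)
        ((norm_nonneg _).trans (hC x hx))
    · have : fderiv ℝ (fun x => η x • ξ' x) x = 0 := by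
        by_contra h
        exact hx (support_fderiv_subset ℝ h)
      simp [divergence, this]
  have e1 : ∫ x, fderiv ℝ (fun x => psi W (u s) x - psi W (u t) x) x (η x • ξ' x)
      = (∫ x, η x * fderiv ℝ (psi W (u s)) x (ξ' x)) - ∫ x, η x * fderiv ℝ (psi W (u t)) x (ξ' x) := by
    rw [← integral_sub (i1 s hsT ξ' hξ'c) (i1 t htT ξ' hξ'c)]
    refine integral_congr_ae (.of_forall fun x => ?_)
    simp only
    rw [fderiv_fun_sub ((hψ s hsT).differentiable (by norm_num) x)
      ((hψ t htT).differentiable (by norm_num) x)]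
    simp only [map_smul, _root_.sub_apply, smul_eq_mul]
    ring
  have e2 : ∫ x, η x * fderiv ℝ (psi W (u s)) x (ξ x - ξ' x)
      = (∫ x, η x * fderiv ℝ (psi W (u s)) x (ξ x))
        - ∫ x, η x * fderiv ℝ (psi W (u s)) x (ξ' x) := by
    rw [← integral_sub (i1 s hsT ξ hξ) (i1 s hsT ξ' hξ'c)]
    refine integral_congr_ae (.of_forall fun x => ?_)
    simp only [map_sub]
    ring
  rw [integral_sub (i1 s hsT (fun x => ξ x - ξ' x) (hξ.sub hξ'c)) i2, e2]
  rw [e1] at hib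
  linarith

/-- The localized flux of the extended normal is absolutely continuous. -/
lemma localized_flux_deriv (hs : IsNonlocalAllenCahnSolution W ε T u) (hW : IsDoubleWell W)
    (hη : ContDiff ℝ 2 η) (hηc : HasCompactSupport η) (hη1 : ∀ x, |η x| ≤ 1)
    {ξ : ℝ → Rd d → Rd d} {L : NNReal}
    (hξ : LipschitzOnWith L (fun p : ℝ × Rd d => ξ p.1 p.2) (Icc 0 T ×ˢ univ))
    (hξ1 : ∀ t ∈ Icc 0 T, ∀ x, ‖ξ t x‖ ≤ 1) (ha : 0 < a) (hab : a ≤ b) (hb : b < T) :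
    AbsolutelyContinuousOnInterval (fun t => ∫ x, η x * fderiv ℝ (psi W (u t)) x (ξ t x)) a b ∧
    ∀ t ∈ Ioo a b, (∀ᵐ x, DifferentiableAt ℝ (fun s => ξ s x) t) →
      HasDerivAt (fun t => ∫ x, η x * fderiv ℝ (psi W (u t)) x (ξ t x))
        (∫ x, (η x * fderiv ℝ (psi W (u t)) x (deriv (fun s => ξ s x) t)
          - (Real.sqrt (2 * W (u t x)) * timeDeriv u t x)
            * divergence (fun x => η x • ξ t x) x)) t := by
  have hsub : ∀ t ∈ Icc a b, t ∈ Ioo 0 T := fun t ht => ⟨ha.trans_le ht.1, ht.2.trans_lt hb⟩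
  have hsub' : ∀ t ∈ Icc a b, t ∈ Icc 0 T := fun t ht => Ioo_subset_Icc_self (hsub t ht)
  have hS := hηc.isCompact
  obtain ⟨Lη, hLη⟩ := hη.lipschitzWith_of_hasCompactSupport hηc (by norm_num)
  have hξl := fun t ht => IsGradientFlowCalibration.lipschitzWith_slice hξ (t := t) ht
  have hξc := fun t ht => (hξl t ht).continuous
  have hY : ∀ t ∈ Icc 0 T, LipschitzWith (L + Lη * (1:ℝ).toNNReal) (fun x => η x • ξ t x) :=
    fun t ht => LipschitzWith.smul_of_bounded hLη (hξl t ht) hη1 (hξ1 t ht)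
  obtain ⟨L', hL'⟩ : ∃ L' : ℝ, L' = d * (L + Lη * (1:ℝ).toNNReal : NNReal) := ⟨_, rfl⟩
  have hL'0 : 0 ≤ L' := by rw [hL']; positivity
  obtain ⟨M1, hM1, hu⟩ := hs.exists_lipschitz_comp hW.contDiff_phi ha hb hS
  obtain ⟨M2, hM2, hF⟩ := exists_bound_of_continuousOn
    (f := fun t x => fderiv ℝ (psi W (u t)) x) (hs.continuousOn_fderiv_psi hW) ha hb hS
  have hbound : ∀ s ∈ Icc a b, ∀ t ∈ Icc a b, ∀ x,
      |η x * fderiv ℝ (psi W (u s)) x (ξ s x - ξ t x)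
        - (psi W (u s) x - psi W (u t) x) * divergence (fun x => η x • ξ t x) x|
      ≤ (tsupport η).indicator (fun _ => M2 * L + M1 * L') x * |s - t| := by
    intro s hs' t ht x
    by_cases hx : x ∈ tsupport η
    · rw [indicator_of_mem hx, add_mul]
      refine (abs_sub _ _).trans (add_le_add ?_ ?_)
      · rw [abs_mul]
        have h1 : ‖ξ s x - ξ t x‖ ≤ L * |s - t| := by
          have := (IsGradientFlowCalibration.lipschitzOnWith_time hξ x).dist_le_mul s (hsub' s hs')
            t (hsub' t ht)
          rwa [dist_eq_norm, Real.dist_eq] at this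
        calc _ ≤ 1 * (M2 * (L * |s - t|)) := mul_le_mul (hη1 x)
              (((fderiv ℝ (psi W (u s)) x).le_opNorm _).trans
                (mul_le_mul (hF s hs' x hx) h1 (norm_nonneg _) hM2)) (abs_nonneg _) zero_le_one
          _ = _ := by ring
      · rw [abs_mul]
        calc _ ≤ (M1 * |s - t|) * L' := mul_le_mul (hu s hs' t ht x hx)
              (hL' ▸ abs_divergence_le (hY t (hsub' t ht)) x) (abs_nonneg _) (by positivity)
          _ = _ := by ring
    · have : fderiv ℝ (fun x => η x • ξ t x) x = 0 := by
        by_contra h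
        exact hx (closure_mono (Function.support_smul_subset_left η (ξ t))
          (support_fderiv_subset ℝ h))
      rw [indicator_of_notMem hx, image_eq_zero_of_notMem_tsupport hx]
      simp [divergence, this]
  refine ⟨absolutelyContinuousOnInterval_of_sub_eq_integral hab
    (integrable_indicator_of_compact hS _)
    (fun s hs' t ht => hs.localized_flux_sub hW hη hηc (hξc s (hsub' s hs')) (hY t (hsub' t ht))
      (hξc t (hsub' t ht)) (hsub s hs') (hsub t ht)) hbound, fun t ht hdiff => ?_⟩
  have htc := Ioo_subset_Icc_self ht
  have htT := hsub t htc
  refine hasDerivAt_of_sub_eq_integral ht (integrable_indicator_of_compact hS _)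
    (fun s hs' => hs.localized_flux_sub hW hη hηc (hξc s (hsub' s hs')) (hY t (hsub' t htc))
      (hξc t (hsub' t htc)) (hsub s hs') htT)
    (fun s hs' => hbound s hs' t htc) (fun s hs' => ?_) ?_
  · have hψ : ∀ r ∈ Ioo 0 T, ContDiff ℝ 1 (psi W (u r)) := fun r hr =>
      hW.contDiff_psi (hs.contDiff_one hr)
    exact (hη.continuous.mul (((hψ s (hsub s hs')).continuous_fderiv (by norm_num)).clm_apply
      ((hξc s (hsub' s hs')).sub (hξc t (hsub' t htc))))).aestronglyMeasurable.sub
      (((hψ s (hsub s hs')).continuous.sub (hψ t htT).continuous).aestronglyMeasurable.mul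
        (measurable_divergence _).aestronglyMeasurable)
  · filter_upwards [hdiff] with x hx
    have l1 := hasDerivAt_iff_tendsto_slope.1 hx.hasDerivAt
    have l2 := (tendsto_time (f := fun t x => fderiv ℝ (psi W (u t)) x)
      (hs.continuousOn_fderiv_psi hW) htT x).mono_left (nhdsWithin_le_nhds (s := {t}ᶜ))
    have l2' := (isBoundedBilinearMap_apply (𝕜 := ℝ) (E := Rd d) (F := ℝ)).continuous.tendsto
      (fderiv ℝ (psi W (u t)) x, deriv (fun s => ξ s x) t) |>.comp (l2.prodMk_nhds l1)
    have l3 := (l2'.const_mul (η x)).sub ((hs.tendsto_slope_psi hW htT x).mul_const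
      (divergence (fun x => η x • ξ t x) x))
    refine l3.congr fun s => ?_
    simp only [Function.comp_apply]
    rw [slope_def_module, map_smul, smul_eq_mul]
    ring

/-- At a zero of `θ` the function has a minimum, so its derivative, if it exists, is 0. The strict
inequality in the case distinction then matches the indicator of `{θ < 0}`. -/
lemma hasDerivAt_max_neg {θ : ℝ → ℝ} {t θ' : ℝ} (h : HasDerivAt θ θ' t)
    (h' : DifferentiableAt ℝ (fun s => max (-θ s) 0) t) :
    HasDerivAt (fun s => max (-θ s) 0) (if θ t < 0 then -θ' else 0) t := by
  rcases lt_trichotomy (θ t) 0 with hneg | hz | hpos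
  · rw [if_pos hneg]
    refine h.neg.congr_of_eventuallyEq ?_
    filter_upwards [h.continuousAt.eventually_lt continuousAt_const hneg] with s hs
    exact max_eq_left (by linarith)
  · rw [if_neg (by linarith)]
    have hmin : IsLocalMin (fun s => max (-θ s) 0) t := .of_forall fun s => by
      simp only [hz, neg_zero, max_self]; exact le_max_right _ _
    have h0 := h'.hasDerivAt
    rwa [hmin.hasDerivAt_eq_zero h0] at h0
  · rw [if_neg (by linarith)]
    refine (hasDerivAt_const t (0:ℝ)).congr_of_eventuallyEq ?_
    filter_upwards [continuousAt_const.eventually_lt h.continuousAt hpos] with s hs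
    exact max_eq_right (by linarith)

lemma lipschitzOnWith_max_neg {θ : ℝ → Rd d → ℝ} {L : NNReal} {S : Set (ℝ × Rd d)}
    (hθ : LipschitzOnWith L (fun p : ℝ × Rd d => θ p.1 p.2) S) :
    LipschitzOnWith L (fun p : ℝ × Rd d => max (-θ p.1 p.2) 0) S :=
  LipschitzOnWith.of_dist_le_mul fun p hp q hq => by
    refine le_trans ?_ (hθ.dist_le_mul p hp q hq)
    rw [Real.dist_eq, Real.dist_eq]
    refine (abs_max_sub_max_le_abs _ _ _).trans_eq ?_
    rw [← abs_neg]; congr 1; ring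

/-- The localized volume error is absolutely continuous. -/
lemma localized_volume_deriv (hs : IsNonlocalAllenCahnSolution W ε T u) (hW : IsDoubleWell W)
    (hη : Continuous η) (hηc : HasCompactSupport η) (hη1 : ∀ x, |η x| ≤ 1)
    {θ : ℝ → Rd d → ℝ} {L : NNReal}
    (hθ : LipschitzOnWith L (fun p : ℝ × Rd d => θ p.1 p.2) (Icc 0 T ×ˢ univ))
    {K : ℝ} (hK : ∀ t ∈ Icc 0 T, ∀ x, |θ t x| ≤ K) (ha : 0 < a) (hab : a ≤ b) (hb : b < T) :
    AbsolutelyContinuousOnInterval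
      (fun t => ∫ x, η x * (psi W (u t) x * θ t x + max (-θ t x) 0)) a b ∧
    ∀ t ∈ Ioo a b, (∀ᵐ x, DifferentiableAt ℝ (fun s => θ s x) t) →
      (∀ᵐ x, DifferentiableAt ℝ (fun s => max (-θ s x) 0) t) →
      HasDerivAt (fun t => ∫ x, η x * (psi W (u t) x * θ t x + max (-θ t x) 0))
        (∫ x, η x * (θ t x * (Real.sqrt (2 * W (u t x)) * timeDeriv u t x)
          + phaseError W {y | θ t y < 0} (u t) x * deriv (fun s => θ s x) t)) t := by
  have hsub : ∀ t ∈ Icc a b, t ∈ Ioo 0 T := fun t ht => ⟨ha.trans_le ht.1, ht.2.trans_lt hb⟩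
  have hsub' : ∀ t ∈ Icc a b, t ∈ Icc 0 T := fun t ht => Ioo_subset_Icc_self (hsub t ht)
  have hS := hηc.isCompact
  obtain ⟨M1, hM1, hu⟩ := hs.exists_lipschitz_comp hW.contDiff_phi ha hb hS
  have hθc := fun t ht => (IsGradientFlowCalibration.lipschitzWith_slice hθ (t := t) ht).continuous
  have hψc : ∀ r ∈ Ioo 0 T, Continuous (psi W (u r)) := fun r hr =>
    (hW.contDiff_psi (hs.contDiff_one hr)).continuous
  have hψ1 : ∀ r ∈ Ioo 0 T, ∀ x, |psi W (u r) x| ≤ 1 := fun r hr x => by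
    have := hW.phi_mem_Icc (hs.mem_Icc r (Ioo_subset_Ico_self hr) x)
    exact abs_le.2 ⟨(by norm_num : (-1:ℝ) ≤ 0).trans this.1, this.2⟩
  have hi : ∀ t ∈ Icc a b, Integrable fun x => η x * (psi W (u t) x * θ t x + max (-θ t x) 0) :=
    fun t ht => (hη.mul (((hψc t (hsub t ht)).mul (hθc t (hsub' t ht))).add
      ((hθc t (hsub' t ht)).neg.max continuous_const))).integrable_of_hasCompactSupport hηc.mul_right
  have hbound : ∀ t ∈ Icc a b, ∀ s ∈ Icc a b, ∀ x,
      |η x * (psi W (u t) x * θ t x + max (-θ t x) 0)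
        - η x * (psi W (u s) x * θ s x + max (-θ s x) 0)|
      ≤ (tsupport η).indicator (fun _ => M1 * K + L + L) x * |t - s| := by
    intro t ht s hs' x
    by_cases hx : x ∈ tsupport η
    · rw [indicator_of_mem hx, ← mul_sub, abs_mul]
      have h1 := (IsGradientFlowCalibration.lipschitzOnWith_time hθ x).dist_le_mul t (hsub' t ht)
        s (hsub' s hs')
      have h2 := (IsGradientFlowCalibration.lipschitzOnWith_time
        (f := fun t x => max (-θ t x) 0) (lipschitzOnWith_max_neg hθ) x).dist_le_mul t (hsub' t ht)
        s (hsub' s hs')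
      rw [Real.dist_eq, Real.dist_eq] at h1 h2
      have h3 : |psi W (u t) x * θ t x - psi W (u s) x * θ s x| ≤ (M1 * K + L) * |t - s| := by
        rw [show psi W (u t) x * θ t x - psi W (u s) x * θ s x
          = (psi W (u t) x - psi W (u s) x) * θ t x + psi W (u s) x * (θ t x - θ s x) by ring]
        refine (abs_add_le _ _).trans ?_
        rw [abs_mul, abs_mul, add_mul]
        refine add_le_add ?_ ?_
        · calc _ ≤ (M1 * |t - s|) * K := mul_le_mul (hu t ht s hs' x hx) (hK t (hsub' t ht) x)
                (abs_nonneg _) (by positivity)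
            _ = _ := by ring
        · calc _ ≤ 1 * (L * |t - s|) := mul_le_mul (hψ1 s (hsub s hs') x) h1 (abs_nonneg _)
                zero_le_one
            _ = _ := one_mul _
      calc _ ≤ 1 * ((M1 * K + L) * |t - s| + L * |t - s|) := by
            refine mul_le_mul (hη1 x) ?_ (abs_nonneg _) zero_le_one
            rw [add_sub_add_comm]
            exact (abs_add_le _ _).trans (add_le_add h3 h2)
        _ = _ := by ring
    · rw [indicator_of_notMem hx, image_eq_zero_of_notMem_tsupport hx]; simp
  refine ⟨absolutelyContinuousOnInterval_integral hab (integrable_indicator_of_compact hS _) hi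
    hbound, fun t ht hd1 hd2 => ?_⟩
  have htT := hsub t (Ioo_subset_Icc_self ht)
  refine hasDerivAt_integral_of_lipschitz ht (integrable_indicator_of_compact hS _) hi hbound ?_
  filter_upwards [hd1, hd2] with x hx1 hx2
  refine HasDerivAt.congr_deriv (f := fun s => η x * (psi W (u s) x * θ s x + max (-θ s x) 0))
    ((((hs.hasDerivAt_psi hW htT x).mul hx1.hasDerivAt).add
      (hasDerivAt_max_neg hx1.hasDerivAt hx2)).const_mul (η x)) ?_
  by_cases hx : θ t x < 0
  · rw [if_pos hx, phaseError, indicator_of_mem (show x ∈ {y | θ t y < 0} from hx)]; ring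
  · rw [if_neg hx, phaseError, indicator_of_notMem (show x ∉ {y | θ t y < 0} from hx)]; ring

end IsNonlocalAllenCahnSolution

lemma divergence_smul {η : Rd d → ℝ} {Y : Rd d → Rd d} {x : Rd d} (hη : DifferentiableAt ℝ η x)
    (hY : DifferentiableAt ℝ Y x) :
    divergence (fun y => η y • Y y) x = η x * divergence Y x + fderiv ℝ η x (Y x) := by
  rw [clm_apply_eq_sum_mul _ (Y x), divergence, divergence, fderiv_fun_smul hη hY, Finset.mul_sum,
    ← Finset.sum_add_distrib]
  refine Finset.sum_congr rfl fun i _ => ?_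
  simp
  ring

/-! ### Integrable majorants and the rate localized by cut-offs. -/

namespace SolutionSlice

variable {W : ℝ → ℝ} {ε m lε : ℝ} {v V : Rd d → ℝ}

lemma energy_nonneg (h : SolutionSlice W ε m lε v V) (x : Rd d) : 0 ≤ energyDensity W ε v x := by
  have h1 := h.well.nonneg (v x)
  have h2 := h.pos
  unfold energyDensity
  positivity

/-- In polar variables this is `|by| ≤ (a² + b²)/2 + y²`. It and the two bounds below show that
energy plus dissipation dominates every product in the localized rate. -/
lemma abs_sqrt_mul_V_le (h : SolutionSlice W ε m lε v V) (x : Rd d) :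
    |Real.sqrt (2 * W (v x)) * V x| ≤ energyDensity W ε v x + ε * V x ^ 2 := by
  obtain ⟨a, b, y, n, ha, hb, hn, p1, p2, p3, p4, -⟩ := h.exists_polar x
  rw [p3, p2, p4, abs_mul]
  nlinarith [sq_nonneg (|b| - |y|), sq_abs b, sq_abs y, sq_nonneg a, sq_nonneg y]

lemma norm_fderiv_psi_le (h : SolutionSlice W ε m lε v V) (x : Rd d) :
    ‖fderiv ℝ (psi W v) x‖ ≤ energyDensity W ε v x := by
  obtain ⟨a, b, y, n, ha, hb, hn, p1, p2, -⟩ := h.exists_polar x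
  refine ContinuousLinearMap.opNorm_le_bound _ (h.energy_nonneg x) fun w => ?_
  rw [p1, p2, norm_neg, norm_mul, Real.norm_of_nonneg (mul_nonneg ha hb)]
  refine mul_le_mul (by nlinarith [sq_nonneg (a - b)]) ?_ (norm_nonneg _) (by positivity)
  exact (norm_inner_le_norm _ _).trans (mul_le_of_le_one_left (norm_nonneg _) hn)

lemma norm_V_smul_gradient_le (h : SolutionSlice W ε m lε v V) (x : Rd d) :
    ‖(ε * V x) • gradient v x‖ ≤ energyDensity W ε v x + ε * V x ^ 2 := by
  have h1 := h.pos
  have h2 : 0 ≤ 1 / ε * W (v x) := by have := h.well.nonneg (v x); positivity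
  rw [norm_smul, norm_mul, Real.norm_of_nonneg h1.le, Real.norm_eq_abs, energyDensity]
  nlinarith [mul_nonneg h1.le (sq_nonneg (|V x| - ‖gradient v x‖)), sq_abs (V x),
    mul_nonneg h1.le (sq_nonneg (V x))]

end SolutionSlice

namespace SliceControl

variable {K : NNReal} {m : ℝ} {Ω : Set (Rd d)} {δ θ θt : Rd d → ℝ} {ξ B ξt : Rd d → Rd d} {l : ℝ}
  {W : ℝ → ℝ} {ε lε : ℝ} {v V : Rd d → ℝ}

/-- The boundary field that appears when the rate is localized by a cut-off function. -/
def boundaryField (W : ℝ → ℝ) (ε : ℝ) (v V : Rd d → ℝ) (ξ : Rd d → Rd d) (x : Rd d) : Rd d :=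
  (ε * V x) • gradient v x + (Real.sqrt (2 * W (v x)) * V x) • ξ x

/-- An integrable majorant of all the terms in the localized rate. -/
def majorant (W : ℝ → ℝ) (ε : ℝ) (Ω : Set (Rd d)) (v V : Rd d → ℝ) (x : Rd d) : ℝ :=
  energyDensity W ε v x + ε * V x ^ 2 + (psi W v x + Ω.indicator (fun _ => (1:ℝ)) x)

lemma integrable_majorant (h : SliceControl K m Ω δ θ θt ξ B ξt l)
    (hv : SolutionSlice W ε m lε v V) : Integrable (majorant W ε Ω v V) :=
  (hv.int_energy.add (hv.int_V_sq.const_mul ε)).add (hv.int_psi.add h.int_indicator)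

lemma integral_majorant (h : SliceControl K m Ω δ θ θt ξ B ξt l)
    (hv : SolutionSlice W ε m lε v V) :
    ∫ x, majorant W ε Ω v V x = (∫ x, energyDensity W ε v x) + ε * (∫ x, V x ^ 2) + (m + m) := by
  have i1 : Integrable (fun x => energyDensity W ε v x + ε * V x ^ 2) :=
    hv.int_energy.add (hv.int_V_sq.const_mul ε)
  have i2 : Integrable (fun x => psi W v x + Ω.indicator (fun _ => (1:ℝ)) x) :=
    hv.int_psi.add h.int_indicator
  unfold majorant
  rw [integral_add i1 i2, integral_add hv.int_energy (hv.int_V_sq.const_mul ε), integral_const_mul,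
    integral_add hv.int_psi h.int_indicator, hv.mass, h.integral_indicator_one]

lemma sqrt_mul_V_le_majorant (hv : SolutionSlice W ε m lε v V) (x : Rd d) :
    |Real.sqrt (2 * W (v x)) * V x| ≤ majorant W ε Ω v V x := by
  have h1 := hv.abs_sqrt_mul_V_le x
  have h2 := (hv.psi_mem x).1
  have h3 : 0 ≤ Ω.indicator (fun _ => (1:ℝ)) x := indicator_nonneg (fun _ _ => zero_le_one) x
  unfold majorant
  linarith

lemma norm_boundaryField_le (h : SliceControl K m Ω δ θ θt ξ B ξt l)
    (hv : SolutionSlice W ε m lε v V) (x : Rd d) :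
    ‖boundaryField W ε v V ξ x‖ ≤ 2 * majorant W ε Ω v V x := by
  have h1 := hv.norm_V_smul_gradient_le x
  have h2 := (hv.psi_mem x).1
  have h3 : 0 ≤ Ω.indicator (fun _ => (1:ℝ)) x := indicator_nonneg (fun _ _ => zero_le_one) x
  have h4 := sqrt_mul_V_le_majorant (Ω := Ω) hv x
  have h5 : ‖(Real.sqrt (2 * W (v x)) * V x) • ξ x‖ ≤ majorant W ε Ω v V x := by
    rw [norm_smul]
    exact (mul_le_of_le_one_right (norm_nonneg _) (h.norm_xi_le x)).trans h4
  refine (norm_add_le _ _).trans ?_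
  unfold majorant at h5 ⊢
  linarith

lemma abs_rateDensity_le (h : SliceControl K m Ω δ θ θt ξ B ξt l)
    (hv : SolutionSlice W ε m lε v V) :
    ∀ᵐ x, |rateDensity W ε Ω θ θt ξ ξt v V x| ≤ (1 + 4 * K) * majorant W ε Ω v V x := by
  filter_upwards [h.norm_xit_le, h.abs_thetat_le] with x hx1 hx2
  have hK := NNReal.coe_nonneg K
  have he := hv.energy_nonneg x
  have hε := mul_nonneg hv.pos.le (sq_nonneg (V x))
  have hp := (hv.psi_mem x).1
  have hi : 0 ≤ Ω.indicator (fun _ => (1:ℝ)) x := indicator_nonneg (fun _ _ => zero_le_one) x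
  have hs := sqrt_mul_V_le_majorant (Ω := Ω) hv x
  obtain ⟨q, hq⟩ : ∃ q, q = majorant W ε Ω v V x := ⟨_, rfl⟩
  have hq' : q = energyDensity W ε v x + ε * V x ^ 2
    + (psi W v x + Ω.indicator (fun _ => (1:ℝ)) x) := hq
  rw [← hq] at hs ⊢
  have t1 : |-(ε * V x ^ 2)| ≤ q := by rw [abs_neg, abs_of_nonneg hε]; linarith
  have t2 : |fderiv ℝ (psi W v) x (ξt x)| ≤ q * K :=
    ((fderiv ℝ (psi W v) x).le_opNorm _).trans (mul_le_mul
      ((hv.norm_fderiv_psi_le x).trans (by linarith)) hx1 (norm_nonneg _) (by linarith))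
  have t3 : |divergence ξ x * (Real.sqrt (2 * W (v x)) * V x)| ≤ K * q := by
    rw [abs_mul]; exact mul_le_mul (h.abs_div_xi_le x) hs (abs_nonneg _) hK
  have t4 : |θ x * (Real.sqrt (2 * W (v x)) * V x)| ≤ K * q := by
    rw [abs_mul]; exact mul_le_mul (h.abs_theta_le x) hs (abs_nonneg _) hK
  have t5 : |phaseError W Ω v x * θt x| ≤ q * K := by
    rw [abs_mul]
    refine mul_le_mul ?_ hx2 (abs_nonneg _) (by linarith)
    unfold phaseError
    rw [abs_le]; constructor <;> linarith
  rw [abs_le] at t1 t2 t3 t4 t5 ⊢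
  unfold rateDensity
  constructor <;> linarith [t1.1, t1.2, t2.1, t2.2, t3.1, t3.2, t4.1, t4.2, t5.1, t5.2]

lemma integrable_boundaryField (h : SliceControl K m Ω δ θ θt ξ B ξt l)
    (hv : SolutionSlice W ε m lε v V) : Integrable (boundaryField W ε v V ξ) := by
  refine ((h.integrable_majorant hv).const_mul 2).mono' ?_
    (.of_forall (h.norm_boundaryField_le hv))
  have h1 := hv.continuous_V
  have h2 := continuous_gradient hv.contDiff_one
  have h3 := hv.well.continuous_sqrt.comp hv.contDiff.continuous
  have h4 := h.lip_xi.continuous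
  exact (((continuous_const.mul h1).smul h2).add ((h3.mul h1).smul h4)).aestronglyMeasurable

/-- The rate localized by a cut-off function. -/
def localizedRate (W : ℝ → ℝ) (ε : ℝ) (Ω : Set (Rd d)) (θ θt : Rd d → ℝ) (ξ ξt : Rd d → Rd d)
    (v V η : Rd d → ℝ) : ℝ :=
  (∫ x, -(ε * (V x * (η x * localForce W ε v x + fderiv ℝ η x (gradient v x)))))
    + (∫ x, (η x * fderiv ℝ (psi W v) x (ξt x)
      - (Real.sqrt (2 * W (v x)) * V x) * divergence (fun x => η x • ξ x) x))
    + ∫ x, η x * (θ x * (Real.sqrt (2 * W (v x)) * V x) + phaseError W Ω v x * θt x)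

variable {η : ℕ → Rd d → ℝ} {C : ℝ}

lemma localizedRate_eq (h : SliceControl K m Ω δ θ θt ξ B ξt l)
    (hv : SolutionSlice W ε m lε v V) (hη : IsCutoffSeq η C) (n : ℕ) :
    localizedRate W ε Ω θ θt ξ ξt v V (η n)
      = (∫ x, η n x * (rateDensity W ε Ω θ θt ξ ξt v V x
          + ε * lε * (Real.sqrt (2 * W (v x)) * V x)))
        - ∫ x, fderiv ℝ (η n) x (boundaryField W ε v V ξ x) := by
  have hηm : AEStronglyMeasurable (η n) := (hη.continuous n).aestronglyMeasurable
  have hη1 : ∀ᵐ x, ‖η n x‖ ≤ 1 := .of_forall (hη.abs_le_one n)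
  have hcV := hv.continuous_V
  have hcg := continuous_gradient hv.contDiff_one
  have hcη' := hη.continuous_fderiv n
  have hcf := continuous_localForce (ε := ε) hv.well.contDiff hv.contDiff
  have i1 : Integrable fun x => -(ε * (V x * (η n x * localForce W ε v x
      + fderiv ℝ (η n) x (gradient v x)))) := by
    refine Continuous.integrable_of_hasCompactSupport ?_
      (HasCompactSupport.intro (hη.compact n).isCompact fun x hx => ?_)
    · exact (continuous_const.mul (hcV.mul (((hη.continuous n).mul hcf).add
        (hcη'.clm_apply hcg)))).neg
    · rw [image_eq_zero_of_notMem_tsupport hx, fderiv_eq_zero_of_notMem_tsupport hx]; simp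
  obtain ⟨L, hL⟩ := hη.lipschitz n
  have hY := LipschitzWith.smul_of_bounded hL h.lip_xi (hη.abs_le_one n) h.norm_xi_le
  have i2a := (integrable_clm_apply_of_bounded hv.int_fderiv_psi h.meas_xit h.norm_xit_le).bdd_mul
    hηm hη1
  have i2b : Integrable fun x => (Real.sqrt (2 * W (v x)) * V x)
      * divergence (fun x => η n x • ξ x) x :=
    hv.int_sqrt_mul_V.mul_bdd (measurable_divergence _).aestronglyMeasurable
      (.of_forall (abs_divergence_le hY))
  have i3 : Integrable fun x => η n x * (θ x * (Real.sqrt (2 * W (v x)) * V x)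
      + phaseError W Ω v x * θt x) := by
    have j1 : Integrable (fun x => θ x * (Real.sqrt (2 * W (v x)) * V x)) :=
      hv.int_sqrt_mul_V.bdd_mul h.lip_theta.continuous.aestronglyMeasurable
        (.of_forall h.abs_theta_le)
    have j2 : Integrable (fun x => phaseError W Ω v x * θt x) :=
      (h.int_phaseError hv).mul_bdd h.meas_thetat h.abs_thetat_le
    exact (j1.add j2).bdd_mul hηm hη1
  have i2 : Integrable fun x => η n x * fderiv ℝ (psi W v) x (ξt x)
      - (Real.sqrt (2 * W (v x)) * V x) * divergence (fun x => η n x • ξ x) x := i2a.sub i2b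
  have i12 : Integrable fun x => -(ε * (V x * (η n x * localForce W ε v x
      + fderiv ℝ (η n) x (gradient v x)))) + (η n x * fderiv ℝ (psi W v) x (ξt x)
      - (Real.sqrt (2 * W (v x)) * V x) * divergence (fun x => η n x • ξ x) x) := i1.add i2
  have i4 : Integrable fun x => η n x * (rateDensity W ε Ω θ θt ξ ξt v V x
          + ε * lε * (Real.sqrt (2 * W (v x)) * V x)) :=
    ((h.integrable_rateDensity hv).add (hv.int_sqrt_mul_V.const_mul (ε * lε))).bdd_mul hηm hη1
  have i5 : Integrable fun x => fderiv ℝ (η n) x (boundaryField W ε v V ξ x) := by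
    refine ((h.integrable_boundaryField hv).norm.const_mul C).mono'
      (isBoundedBilinearMap_apply.continuous.comp_aestronglyMeasurable₂
        hcη'.aestronglyMeasurable (h.integrable_boundaryField hv).aestronglyMeasurable)
      (.of_forall fun x => ?_)
    exact ((fderiv ℝ (η n) x).le_opNorm _).trans
      (mul_le_mul_of_nonneg_right (hη.norm_fderiv_le n x) (norm_nonneg _))
  -- Pulling `η` out leaves one `∇η` term from the energy and one from `∇·(ηξ)`; together they form
  -- the boundary field. Replacing the force by `V − lε √(2W)` creates the term with `ε lε`, which
  -- disappears in the limit by orthogonality.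
  unfold localizedRate
  rw [← integral_add i1 i2, ← integral_add i12 i3, ← integral_sub i4 i5]
  refine integral_congr_ae ?_
  filter_upwards [h.lip_xi.ae_differentiableAt] with x hx
  rw [divergence_smul (hη.differentiable n x) hx, boundaryField, map_add, map_smul, map_smul]
  simp only [rateDensity, smul_eq_mul]
  rw [hv.equation x]
  ring

lemma tendsto_localizedRate (h : SliceControl K m Ω δ θ θt ξ B ξt l)
    (hv : SolutionSlice W ε m lε v V) (hη : IsCutoffSeq η C) :
    Tendsto (fun n => localizedRate W ε Ω θ θt ξ ξt v V (η n)) atTop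
      (𝓝 (∫ x, rateDensity W ε Ω θ θt ξ ξt v V x)) := by
  simp only [h.localizedRate_eq hv hη]
  have i1 : Integrable fun x => rateDensity W ε Ω θ θt ξ ξt v V x
      + ε * lε * (Real.sqrt (2 * W (v x)) * V x) :=
    (h.integrable_rateDensity hv).add (hv.int_sqrt_mul_V.const_mul (ε * lε))
  have h1 := (hη.tendsto_integral_mul i1).sub
    (hη.tendsto_integral_fderiv (h.integrable_boundaryField hv))
  rwa [integral_add (h.integrable_rateDensity hv) (hv.int_sqrt_mul_V.const_mul (ε * lε)),
    integral_const_mul, hv.orthogonal, mul_zero, add_zero, sub_zero] at h1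

/-- The bound is uniform in `n` but involves the multiplier and the dissipation. It serves dominated
convergence only and does not enter the constant of the theorem. -/
lemma abs_localizedRate_le (h : SliceControl K m Ω δ θ θt ξ B ξt l)
    (hv : SolutionSlice W ε m lε v V) (hη : IsCutoffSeq η C) (n : ℕ) :
    |localizedRate W ε Ω θ θt ξ ξt v V (η n)|
      ≤ (1 + 4 * K + |ε * lε| + C * 2) * ∫ x, majorant W ε Ω v V x := by
  have iq := h.integrable_majorant hv
  rw [h.localizedRate_eq hv hη, add_mul, ← integral_const_mul, ← integral_const_mul]
  refine (abs_sub _ _).trans (add_le_add ?_ ?_)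
  · refine norm_integral_le_of_norm_le (f := fun x => η n x * (rateDensity W ε Ω θ θt ξ ξt v V x
          + ε * lε * (Real.sqrt (2 * W (v x)) * V x))) (iq.const_mul _) ?_
    filter_upwards [h.abs_rateDensity_le hv] with x hx
    rw [norm_mul, Real.norm_eq_abs, Real.norm_eq_abs]
    refine (mul_le_of_le_one_left (abs_nonneg _) (hη.abs_le_one n x)).trans
      ((abs_add_le _ _).trans ?_)
    rw [add_mul]
    refine add_le_add hx ?_
    rw [abs_mul]
    exact mul_le_mul_of_nonneg_left (sqrt_mul_V_le_majorant hv x) (abs_nonneg _)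
  · refine norm_integral_le_of_norm_le (f := fun x => fderiv ℝ (η n) x (boundaryField W ε v V ξ x))
      (iq.const_mul _) (.of_forall fun x => ?_)
    refine ((fderiv ℝ (η n) x).le_opNorm _).trans ?_
    rw [mul_assoc]
    exact mul_le_mul (hη.norm_fderiv_le n x) (h.norm_boundaryField_le hv x) (norm_nonneg _)
      hη.C_nonneg

end SliceControl

namespace IsNonlocalAllenCahnSolution

variable {W : ℝ → ℝ} {ε T : ℝ} {u : ℝ → Rd d → ℝ}

/-! ### Properties of a solution at a fixed time -/

/-- The multiplier is defined to make this vanish. If `∫ 2W(u) = 0`, the quotient is zero by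
convention, but then `W(u) = 0` almost everywhere and the force integral vanishes as well. -/
lemma integral_sqrt_mul_timeDeriv (hs : IsNonlocalAllenCahnSolution W ε T u) (hW : IsDoubleWell W)
    {t : ℝ} (ht : t ∈ Ioo 0 T) :
    ∫ x, Real.sqrt (2 * W (u t x)) * timeDeriv u t x = 0 := by
  have hsq := hW.memLp_sqrt (hs.contDiff_space t ht).continuous (hs.integrable_potential t ht)
  have i1 : Integrable fun x => localForce W ε (u t) x * Real.sqrt (2 * W (u t x)) :=
    (hs.memLp_force t ht).integrable_mul hsq
  have i2 : Integrable fun x => 2 * W (u t x) := (hs.integrable_potential t ht).const_mul 2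
  have h1 : ∀ x, Real.sqrt (2 * W (u t x)) * timeDeriv u t x
      = localForce W ε (u t) x * Real.sqrt (2 * W (u t x))
        + lagrangeMultiplier W ε (u t) * (2 * W (u t x)) := fun x => by
    have h2 : timeDeriv u t x = localForce W ε (u t) x
      + lagrangeMultiplier W ε (u t) * Real.sqrt (2 * W (u t x)) := hs.equation t ht x
    rw [h2]
    linear_combination lagrangeMultiplier W ε (u t) * hW.sqrt_sq (u t x)
  simp only [h1]
  rw [integral_add i1 (i2.const_mul _), integral_const_mul, lagrangeMultiplier]
  by_cases h0 : ∫ x, 2 * W (u t x) = 0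
  · have h3 : (fun x => 2 * W (u t x)) =ᵐ[volume] 0 :=
      (integral_eq_zero_iff_of_nonneg (fun x => by have := hW.nonneg (u t x); positivity) i2).1 h0
    have h4 : ∫ x, localForce W ε (u t) x * Real.sqrt (2 * W (u t x)) = 0 := by
      rw [← integral_zero (Rd d) ℝ]
      refine integral_congr_ae ?_
      filter_upwards [h3] with x hx
      have hx' : 2 * W (u t x) = 0 := hx
      rw [hx', Real.sqrt_zero, mul_zero]
    rw [h0, h4]; simp
  · field_simp
    ring

lemma solutionSlice (hs : IsNonlocalAllenCahnSolution W ε T u) (hW : IsDoubleWell W) (hε : 0 < ε)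
    {t : ℝ} (ht : t ∈ Ioo 0 T) :
    SolutionSlice W ε (∫ x, psi W (u t) x) (lagrangeMultiplier W ε (u t)) (u t)
      (timeDeriv u t) where
  well := hW
  pos := hε
  contDiff := hs.contDiff_space t ht
  mem_Icc := hs.mem_Icc t (Ioo_subset_Ico_self ht)
  int_psi := hs.integrable_psi t (Ioo_subset_Ico_self ht)
  int_grad := hs.integrable_gradient t ht
  int_pot := hs.integrable_potential t ht
  memLp_force := hs.memLp_force t ht
  equation := hs.equation t ht
  orthogonal := hs.integral_sqrt_mul_timeDeriv hW ht
  mass := rfl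

lemma integrableOn_integral_timeDeriv_sq (hs : IsNonlocalAllenCahnSolution W ε T u) :
    IntegrableOn (fun t => ∫ x, timeDeriv u t x ^ 2) (Ioo 0 T) := by
  have h := hs.integrable_dissipation
  rw [IntegrableOn, Measure.volume_eq_prod, ← Measure.prod_restrict, Measure.restrict_univ] at h
  exact h.integral_prod_left

/-! ### Conservation of mass -/

lemma continuousOn_psi (hs : IsNonlocalAllenCahnSolution W ε T u) (hW : IsDoubleWell W) :
    ContinuousOn (fun p : ℝ × Rd d => psi W (u p.1) p.2) (Ico 0 T ×ˢ univ) :=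
  hW.contDiff_phi.continuous.comp_continuousOn hs.continuousOn

lemma hasDerivAt_localized_mass (hs : IsNonlocalAllenCahnSolution W ε T u) (hW : IsDoubleWell W)
    {η : Rd d → ℝ} (hη : Continuous η) (hηc : HasCompactSupport η) (hη1 : ∀ x, |η x| ≤ 1) {t : ℝ}
    (ht : t ∈ Ioo 0 T) : HasDerivAt (fun t => ∫ x, η x * psi W (u t) x)
      (∫ x, η x * (Real.sqrt (2 * W (u t x)) * timeDeriv u t x)) t := by
  obtain ⟨a, ha, hat⟩ := exists_between ht.1
  obtain ⟨b, htb, hb⟩ := exists_between ht.2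
  -- With the constant weight 1 the negative part is zero, and the localized volume error is the
  -- localized mass.
  have h := (hs.localized_volume_deriv hW hη hηc hη1 (θ := fun _ _ => 1) (L := 0) (K := 1)
    (LipschitzWith.const (1:ℝ)).lipschitzOnWith (by simp) ha (hat.trans htb).le hb).2 t ⟨hat, htb⟩
    (by simp) (by simp)
  simpa using h

/-- The localized mass changes at the rate `∫ η √(2W) V`, which tends to 0 as the cut-offs exhaust
space. Energy and dissipation dominate it up to the initial time, where continuity of `u` is all
that is needed. -/
theorem integral_psi_eq (hs : IsNonlocalAllenCahnSolution W ε T u) (hW : IsDoubleWell W)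
    (hε : 0 < ε) {t : ℝ} (ht : t ∈ Ioo 0 T) : ∫ x, psi W (u t) x = ∫ x, psi W (u 0) x := by
  obtain ⟨η, C, hη⟩ := exists_cutoffSeq d
  obtain ⟨M, hM⟩ := hs.energy_bounded
  have hsub : ∀ s ∈ Icc 0 t, s ∈ Ico 0 T := fun s h => ⟨h.1, h.2.trans_lt ht.2⟩
  have hsub' : ∀ s ∈ Ioo 0 t, s ∈ Ioo 0 T := fun s h => ⟨h.1, h.2.trans ht.2⟩
  have hne : ∀ᵐ s : ℝ, s ≠ t := by simp [ae_iff, measure_singleton]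
  let D : ℕ → ℝ → ℝ := fun n s => ∫ x, η n x * (Real.sqrt (2 * W (u s x)) * timeDeriv u s x)
  let Φ : ℝ → ℝ := fun s => M + ε * ∫ x, timeDeriv u s x ^ 2
  have hd : ∀ n, ∀ s ∈ Ioo 0 T, HasDerivAt (fun t => ∫ x, η n x * psi W (u t) x) (D n s) s :=
    fun n s h => hs.hasDerivAt_localized_mass hW (hη.continuous n) (hη.compact n)
      (hη.abs_le_one n) h
  have hb : ∀ n, ∀ s ∈ Ioo 0 T, ‖D n s‖ ≤ Φ s := by
    intro n s h
    have hv := hs.solutionSlice hW hε h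
    have i : Integrable fun x => energyDensity W ε (u s) x + ε * timeDeriv u s x ^ 2 :=
      hv.int_energy.add (hv.int_V_sq.const_mul ε)
    refine (norm_integral_le_of_norm_le
      (f := fun x => η n x * (Real.sqrt (2 * W (u s x)) * timeDeriv u s x)) i
      (.of_forall fun x => ?_)).trans ?_
    · rw [norm_mul]
      exact (mul_le_of_le_one_left (norm_nonneg _) (hη.abs_le_one n x)).trans
        (hv.abs_sqrt_mul_V_le x)
    · rw [integral_add hv.int_energy (hv.int_V_sq.const_mul ε), integral_const_mul]
      exact add_le_add (hM s h) le_rfl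
  have hΦ : IntervalIntegrable Φ volume 0 t := by
    rw [intervalIntegrable_iff_integrableOn_Ioo_of_le ht.1.le]
    exact (integrableOn_const (by simp)).add
      ((hs.integrableOn_integral_timeDeriv_sq.mono_set (Ioo_subset_Ioo_right ht.2.le)).const_mul ε)
  have hmem : ∀ {P : ℝ → Prop}, (∀ s ∈ Ioo 0 T, P s) → ∀ᵐ s, s ∈ uIoc 0 t → P s := by
    intro P hP
    filter_upwards [hne] with s h1 h2
    rw [uIoc_of_le ht.1.le] at h2
    exact hP s ⟨h2.1, h2.2.trans_lt ht.2⟩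
  have hm : ∀ n, AEStronglyMeasurable (D n) (volume.restrict (uIoc 0 t)) := fun n => by
    refine (measurable_deriv fun t => ∫ x, η n x * psi W (u t) x).aestronglyMeasurable.congr ?_
    rw [Filter.EventuallyEq, ae_restrict_iff' measurableSet_uIoc]
    exact hmem fun s h => (hd n s h).deriv
  have hval : ∀ n, ∫ s in (0:ℝ)..t, D n s
      = (∫ x, η n x * psi W (u t) x) - ∫ x, η n x * psi W (u 0) x := by
    intro n
    refine intervalIntegral.integral_eq_sub_of_hasDerivAt_of_le ht.1.le ?_
      (fun s h => hd n s (hsub' s h)) ?_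
    · refine continuousOn_integral_of_compact_support (f := fun t x => η n x * psi W (u t) x)
        (hη.compact n).isCompact ?_ fun s x _ hx => by
          simp only [image_eq_zero_of_notMem_tsupport hx, zero_mul]
      exact ((hη.continuous n).comp continuous_snd).continuousOn.mul ((hs.continuousOn_psi hW).mono
        (prod_mono hsub Subset.rfl))
    · refine hΦ.mono_fun' (hm n) ?_
      rw [Filter.EventuallyLE, ae_restrict_iff' measurableSet_uIoc]
      exact hmem (hb n)
  have hlim : Tendsto (fun n => ∫ s in (0:ℝ)..t, D n s) atTop (𝓝 (∫ s in (0:ℝ)..t, (0:ℝ))) := by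
    refine intervalIntegral.tendsto_integral_filter_of_dominated_convergence Φ (.of_forall hm)
      (.of_forall fun n => hmem (hb n)) hΦ (hmem fun s h => ?_)
    rw [← hs.integral_sqrt_mul_timeDeriv hW h]
    exact hη.tendsto_integral_mul (hs.solutionSlice hW hε h).int_sqrt_mul_V
  simp only [hval, intervalIntegral.integral_zero] at hlim
  have h0 := ht.1.trans ht.2
  exact sub_eq_zero.1 (tendsto_nhds_unique
    ((hη.tendsto_integral_mul (hs.integrable_psi t (Ioo_subset_Ico_self ht))).sub
      (hη.tendsto_integral_mul (hs.integrable_psi 0 ⟨le_rfl, h0⟩))) hlim)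

/-! ### Continuity of the Lagrange multiplier -/

/-- A solution of positive mass is somewhere in between the two wells. -/
lemma exists_potential_ne_zero (hs : IsNonlocalAllenCahnSolution W ε T u) (hW : IsDoubleWell W)
    (hd : 1 ≤ d) {t : ℝ} (ht : t ∈ Ioo 0 T) (hm : 0 < ∫ x, psi W (u t) x) :
    ∃ x, W (u t x) ≠ 0 := by
  -- Otherwise `u` takes only the values 0 and 1. Positive mass excludes `u ≡ 0`, finite mass
  -- excludes `u ≡ 1`, and the intermediate value theorem excludes that both occur.
  by_contra! H
  have hi := hs.integrable_psi t (Ioo_subset_Ico_self ht)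
  have h01 : ∀ x, u t x = 0 ∨ u t x = 1 := fun x => (hW.zero_iff _).1 (H x)
  have hc := (hs.contDiff_space t ht).continuous
  obtain ⟨x1, hx1⟩ : ∃ x, u t x = 1 := by
    by_contra! h
    have : ∀ x, psi W (u t) x = 0 := fun x => by
      rw [psi, (h01 x).resolve_right (h x), IsDoubleWell.phi_zero]
    simp [this] at hm
  obtain ⟨x0, hx0⟩ : ∃ x, u t x = 0 := by
    by_contra! h
    have : psi W (u t) = fun _ => 1 := funext fun x => by
      rw [psi, (h01 x).resolve_left (h x), hW.phi_one]
    rw [this, integrable_const_iff] at hi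
    have : Nonempty (Fin d) := ⟨⟨0, hd⟩⟩
    rcases hi with hi | hi
    · exact one_ne_zero hi
    · exact (measure_lt_top (volume : Measure (Rd d)) univ).ne 
        (measure_univ_of_isAddLeftInvariant _)
  obtain ⟨y, hy⟩ := mem_range_of_exists_le_of_exists_ge hc (c := 1 / 2) ⟨x0, by rw [hx0]; norm_num⟩
    ⟨x1, by rw [hx1]; norm_num⟩
  rcases h01 y with h | h <;> · rw [h] at hy; norm_num at hy

lemma continuousOn_localForce (hs : IsNonlocalAllenCahnSolution W ε T u) (hW : IsDoubleWell W) :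
    ContinuousOn (fun p : ℝ × Rd d => localForce W ε (u p.1) p.2) (Ioo 0 T ×ˢ univ) :=
  hs.continuousOn_laplacian.sub (continuousOn_const.mul
    ((hW.contDiff.continuous_deriv (by norm_num)).comp_continuousOn hs.continuousOn_interior))

/-- The defining integrals need not be examined in time: at a single point where `W(u) ≠ 0` the
equation can be solved for the multiplier, also at nearby times. It provides local boundedness of
the multiplier for dominated convergence. -/
lemma continuousOn_lagrangeMultiplier (hs : IsNonlocalAllenCahnSolution W ε T u)
    (hW : IsDoubleWell W) (hd : 1 ≤ d) (hm : ∀ t ∈ Ioo 0 T, 0 < ∫ x, psi W (u t) x) :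
    ContinuousOn (fun t => lagrangeMultiplier W ε (u t)) (Ioo 0 T) := by
  intro t ht
  obtain ⟨x, hx⟩ := hs.exists_potential_ne_zero hW hd ht (hm t ht)
  have hw : Tendsto (fun s => Real.sqrt (2 * W (u s x))) (𝓝 t) (𝓝 (Real.sqrt (2 * W (u t x)))) :=
    tendsto_time (f := fun s x => Real.sqrt (2 * W (u s x)))
      (hW.continuous_sqrt.comp_continuousOn hs.continuousOn_interior) ht x
  have hw0 : Real.sqrt (2 * W (u t x)) ≠ 0 := by
    rw [Real.sqrt_ne_zero']
    have := lt_of_le_of_ne (hW.nonneg (u t x)) hx.symm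
    positivity
  have key : ∀ s ∈ Ioo 0 T, Real.sqrt (2 * W (u s x)) ≠ 0 → lagrangeMultiplier W ε (u s)
      = (timeDeriv u s x - localForce W ε (u s) x) / Real.sqrt (2 * W (u s x)) := by
    intro s h h0
    have h2 : timeDeriv u s x = localForce W ε (u s) x
      + lagrangeMultiplier W ε (u s) * Real.sqrt (2 * W (u s x)) := hs.equation s h x
    rw [h2]; field_simp; ring
  refine ContinuousAt.continuousWithinAt ?_
  rw [ContinuousAt, key t ht hw0]
  refine Tendsto.congr' ?_ (((tendsto_time (f := timeDeriv u) hs.continuousOn_timeDeriv ht x).sub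
    (tendsto_time (f := fun s => localForce W ε (u s)) (hs.continuousOn_localForce hW) ht x)).div hw hw0)
  filter_upwards [Ioo_mem_nhds ht.1 ht.2, hw.eventually_ne hw0] with s h1 h2 using (key s h1 h2).symm

end IsNonlocalAllenCahnSolution

namespace IsNonlocalAllenCahnSolution

variable {W : ℝ → ℝ} {ε T : ℝ} {u : ℝ → Rd d → ℝ} {Ω : ℝ → Set (Rd d)} {ξ B : ℝ → Rd d → Rd d}
  {θ : ℝ → Rd d → ℝ} {lam : ℝ → ℝ}

/-! ### The relative energy and the volume error at a fixed time -/

lemma integrable_fderiv_psi_apply (hs : IsNonlocalAllenCahnSolution W ε T u) (hW : IsDoubleWell W)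
    (hcal : IsGradientFlowCalibration T Ω ξ B θ lam) {t : ℝ} (ht : t ∈ Ioo 0 T) :
    Integrable fun x => fderiv ℝ (psi W (u t)) x (ξ t x) := by
  obtain ⟨L, hL⟩ := hcal.lipschitz_xi
  have ht' := Ioo_subset_Icc_self ht
  exact integrable_clm_apply_of_bounded (hW.integrable_fderiv_psi (hs.contDiff_one ht)
    (hs.integrable_gradient t ht) (hs.integrable_potential t ht))
    (IsGradientFlowCalibration.lipschitzWith_slice hL ht').continuous.aestronglyMeasurable
    (.of_forall (hcal.norm_xi_le_one ht'))

lemma relativeEnergy_eq (t : ℝ) : relativeEnergy W ε ξ u t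
    = (∫ x, energyDensity W ε (u t) x) + ∫ x, fderiv ℝ (psi W (u t)) x (ξ t x) := by
  unfold relativeEnergy cahnHilliard
  congr 2
  ext x
  rw [real_inner_comm, inner_gradient_left]

/-- The right-hand side contains no indicator function. The jump of `χ` in time is thus hidden in
the Lipschitz function `max(−θ, 0)`. -/
lemma abs_phaseError_mul_abs (hs : IsNonlocalAllenCahnSolution W ε T u) (hW : IsDoubleWell W)
    (hcal : IsGradientFlowCalibration T Ω ξ B θ lam) {t : ℝ} (ht : t ∈ Ioo 0 T) (x : Rd d) :
    |phaseError W (Ω t) (u t) x| * |θ t x| = psi W (u t) x * θ t x + max (-θ t x) 0 := by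
  have hp : psi W (u t) x ∈ Icc (0:ℝ) 1 := hW.phi_mem_Icc (hs.mem_Icc t (Ioo_subset_Ico_self ht) x)
  have hx' := hcal.mem_iff (Ioo_subset_Icc_self ht) x
  unfold phaseError
  by_cases hx : x ∈ Ω t
  · have := hx'.1 hx
    rw [indicator_of_mem hx, abs_of_nonpos (by linarith [hp.2]), abs_of_neg this,
      max_eq_left (by linarith)]
    ring
  · have : 0 ≤ θ t x := not_lt.1 fun h' => hx (hx'.2 h')
    rw [indicator_of_notMem hx, abs_of_nonneg (by linarith [hp.1]), abs_of_nonneg this,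
      max_eq_right (by linarith)]
    ring

lemma volumeError_eq (hs : IsNonlocalAllenCahnSolution W ε T u) (hW : IsDoubleWell W)
    (hcal : IsGradientFlowCalibration T Ω ξ B θ lam) {t : ℝ} (ht : t ∈ Ioo 0 T) :
    volumeError W Ω θ u t = ∫ x, (psi W (u t) x * θ t x + max (-θ t x) 0) :=
  integral_congr_ae (.of_forall fun x => hs.abs_phaseError_mul_abs hW hcal ht x)

lemma integrable_volumeError (hs : IsNonlocalAllenCahnSolution W ε T u) (hd : 1 ≤ d)
    (hΩ : IsClosedSurfaceFamily T Ω) (hcal : IsGradientFlowCalibration T Ω ξ B θ lam) {t : ℝ}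
    (ht : t ∈ Ioo 0 T) : Integrable fun x => psi W (u t) x * θ t x + max (-θ t x) 0 := by
  obtain ⟨L, hL⟩ := hcal.lipschitz_theta
  obtain ⟨K, hK⟩ := hcal.theta_bounded
  obtain ⟨R, hR⟩ := hcal.exists_bound hΩ hd
  have ht' := Ioo_subset_Icc_self ht
  have hc := (IsGradientFlowCalibration.lipschitzWith_slice hL ht').continuous
  refine ((hs.integrable_psi t (Ioo_subset_Ico_self ht)).mul_bdd hc.aestronglyMeasurable
    (.of_forall (hK t ht'))).add ((hc.neg.max continuous_const).integrable_of_hasCompactSupport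
      (HasCompactSupport.intro (isCompact_closedBall 0 R) fun x hx => max_eq_right ?_))
  refine neg_nonpos.2 (not_lt.1 fun h => hx ?_)
  simpa using (hR t ht' x ((hcal.mem_iff ht' x).2 h)).le

/-! ### The rate of change of the total error -/

/-- The rate of change of the relative energy plus the volume error. -/
def totalRate (W : ℝ → ℝ) (ε : ℝ) (Ω : ℝ → Set (Rd d)) (θ : ℝ → Rd d → ℝ) (ξ : ℝ → Rd d → Rd d)
    (u : ℝ → Rd d → ℝ) (t : ℝ) : ℝ :=
  ∫ x, rateDensity W ε (Ω t) (θ t) (fun x => deriv (fun s => θ s x) t) (ξ t)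
    (fun x => deriv (fun s => ξ s x) t) (u t) (timeDeriv u t) x

/-- The localized total error is absolutely continuous. -/
lemma localized_total_deriv (hs : IsNonlocalAllenCahnSolution W ε T u) (hW : IsDoubleWell W)
    (hε : 0 < ε) (hcal : IsGradientFlowCalibration T Ω ξ B θ lam) {η : Rd d → ℝ}
    (hη : ContDiff ℝ 2 η) (hηc : HasCompactSupport η) (hη1 : ∀ x, |η x| ≤ 1) {a b : ℝ}
    (ha : 0 < a) (hab : a ≤ b) (hb : b < T) :
    AbsolutelyContinuousOnInterval (fun t => (∫ x, η x * energyDensity W ε (u t) x)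
      + (∫ x, η x * fderiv ℝ (psi W (u t)) x (ξ t x))
      + ∫ x, η x * (psi W (u t) x * θ t x + max (-θ t x) 0)) a b ∧
    ∀ᵐ t, t ∈ Ioo a b → HasDerivAt (fun t => (∫ x, η x * energyDensity W ε (u t) x)
      + (∫ x, η x * fderiv ℝ (psi W (u t)) x (ξ t x))
      + ∫ x, η x * (psi W (u t) x * θ t x + max (-θ t x) 0))
      (SliceControl.localizedRate W ε (Ω t) (θ t) (fun x => deriv (fun s => θ s x) t) (ξ t)
        (fun x => deriv (fun s => ξ s x) t) (u t) (timeDeriv u t) η) t := by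
  obtain ⟨Lξ, hLξ⟩ := hcal.lipschitz_xi
  obtain ⟨Lθ, hLθ⟩ := hcal.lipschitz_theta
  obtain ⟨K, hK⟩ := hcal.theta_bounded
  have h1 := hs.localized_energy_deriv hW.contDiff hε hη hηc hη1 ha hab hb
  have h2 := hs.localized_flux_deriv hW hη hηc hη1 hLξ (fun t ht => hcal.norm_xi_le_one ht) ha hab hb
  have h3 := hs.localized_volume_deriv hW hη.continuous hηc hη1 hLθ hK ha hab hb
  refine ⟨(h1.1.fun_add h2.1).fun_add h3.1, ?_⟩
  filter_upwards [ae_differentiableAt_of_lipschitzOnWith hLξ,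
    ae_differentiableAt_of_lipschitzOnWith hLθ,
    ae_differentiableAt_of_lipschitzOnWith (f := fun t x => max (-θ t x) 0)
      (lipschitzOnWith_max_neg hLθ)] with t d1 d2 d3 ht
  have htT : t ∈ Ioo 0 T := ⟨ha.trans ht.1, ht.2.trans hb⟩
  have hset : {y | θ t y < 0} = Ω t :=
    Set.ext fun y => (hcal.mem_iff (Ioo_subset_Icc_self htT) y).symm
  have h3' := h3.2 t ht ((d2 htT).mono fun x hx => hx.time)
    ((d3 htT).mono fun x hx => DifferentiableAt.time (f := fun t x => max (-θ t x) 0) hx)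
  rw [hset] at h3'
  exact ((h1.2 t ht).fun_add (h2.2 t ht ((d1 htT).mono fun x hx => hx.time))).fun_add h3'

/-- The fundamental theorem of calculus for the total error. -/
theorem integral_totalRate (hs : IsNonlocalAllenCahnSolution W ε T u) (hW : IsDoubleWell W)
    (hε : 0 < ε) (hd : 1 ≤ d) (hΩ : IsClosedSurfaceFamily T Ω)
    (hcal : IsGradientFlowCalibration T Ω ξ B θ lam) {K : NNReal} {m : ℝ} {δ : ℝ → Rd d → ℝ}
    (hK : ∀ᵐ t, t ∈ Ioo 0 T → SliceControl K m (Ω t) (δ t) (θ t)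
      (fun x => deriv (fun s => θ s x) t) (ξ t) (B t) (fun x => deriv (fun s => ξ s x) t) (lam t))
    (hm0 : 0 < m) (hm : ∫ x, psi W (u 0) x = m) {a b : ℝ} (ha : 0 < a) (hab : a ≤ b) (hb : b < T) :
    IntervalIntegrable (totalRate W ε Ω θ ξ u) volume a b ∧
      ∫ t in a..b, totalRate W ε Ω θ ξ u t
        = (relativeEnergy W ε ξ u b + volumeError W Ω θ u b)
          - (relativeEnergy W ε ξ u a + volumeError W Ω θ u a) := by
  obtain ⟨η, C, hη⟩ := exists_cutoffSeq d
  obtain ⟨M, hM⟩ := hs.energy_bounded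
  have hsub : ∀ t ∈ Icc a b, t ∈ Ioo 0 T := fun t ht => ⟨ha.trans_le ht.1, ht.2.trans_lt hb⟩
  have hmass : ∀ t ∈ Ioo 0 T, ∫ x, psi W (u t) x = m := fun t ht =>
    (hs.integral_psi_eq hW hε ht).trans hm
  have hslice : ∀ t ∈ Ioo 0 T,
      SolutionSlice W ε m (lagrangeMultiplier W ε (u t)) (u t) (timeDeriv u t) := fun t ht =>
    hmass t ht ▸ hs.solutionSlice hW hε ht
  -- A bound for the multiplier on a compact time interval; it may depend on the solution, since
  -- only an integrable majorant is sought.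
  obtain ⟨Λ, hΛ⟩ := (isCompact_Icc (a := a) (b := b)).exists_bound_of_continuousOn
    ((hs.continuousOn_lagrangeMultiplier hW hd fun t ht => (hmass t ht).symm ▸ hm0).mono hsub)
  have hΛ0 : 0 ≤ Λ := (norm_nonneg _).trans (hΛ a (left_mem_Icc.2 hab))
  have hC0 := hη.C_nonneg
  refine integral_eq_sub_of_tendsto_deriv (D' := totalRate W ε Ω θ ξ u)
    (G' := fun t => relativeEnergy W ε ξ u t + volumeError W Ω θ u t) hab
    (fun n => (hs.localized_total_deriv hW hε hcal (hη.contDiff n) (hη.compact n)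
      (hη.abs_le_one n) ha hab hb).1)
    (fun n => (hs.localized_total_deriv hW hε hcal (hη.contDiff n) (hη.compact n)
      (hη.abs_le_one n) ha hab hb).2)
    (Φ := fun t => (1 + 4 * K + ε * Λ + C * 2) * (M + ε * (∫ x, timeDeriv u t x ^ 2) + (m + m)))
    (fun n => ?_) ?_ ?_ ?_
  · filter_upwards [hK] with t ht htab
    have htT := hsub t (Ioo_subset_Icc_self htab)
    have h := ht htT
    have hv := hslice t htT
    refine (h.abs_localizedRate_le hv hη n).trans ?_
    have h1 : ∫ x, SliceControl.majorant W ε (Ω t) (u t) (timeDeriv u t) x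
        ≤ M + ε * (∫ x, timeDeriv u t x ^ 2) + (m + m) := by
      rw [h.integral_majorant hv]
      have := hM t htT
      unfold cahnHilliard at this
      linarith
    have h2 : 0 ≤ ∫ x, SliceControl.majorant W ε (Ω t) (u t) (timeDeriv u t) x :=
      integral_nonneg fun x => (abs_nonneg _).trans (SliceControl.sqrt_mul_V_le_majorant hv x)
    have h3 : |ε * lagrangeMultiplier W ε (u t)| ≤ ε * Λ := by
      rw [abs_mul, abs_of_pos hε]
      exact mul_le_mul_of_nonneg_left (hΛ t (Ioo_subset_Icc_self htab)) hε.le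
    exact mul_le_mul (by linarith) h1 h2 (by positivity)
  · rw [intervalIntegrable_iff_integrableOn_Ioo_of_le hab]
    have h1 := (hs.integrableOn_integral_timeDeriv_sq.mono_set
      (Ioo_subset_Ioo ha.le hb.le)).const_mul ε
    exact (((integrableOn_const (by simp)).add h1).add (integrableOn_const (by simp))).const_mul _
  · filter_upwards [hK] with t ht htab
    have htT := hsub t (Ioo_subset_Icc_self htab)
    exact (ht htT).tendsto_localizedRate (hslice t htT) hη
  · intro t ht
    have htT := hsub t ht
    simp only [relativeEnergy_eq]
    rw [hs.volumeError_eq hW hcal htT]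
    exact ((hη.tendsto_integral_mul (hslice t htT).int_energy).add
      (hη.tendsto_integral_mul (hs.integrable_fderiv_psi_apply hW hcal htT))).add
      (hη.tendsto_integral_mul (hs.integrable_volumeError hd hΩ hcal htT))

end IsNonlocalAllenCahnSolution

/-! ### From an integral inequality to Dini derivatives -/

lemma absolutelyContinuousOnInterval_of_integral_eq {G D : ℝ → ℝ} {a b : ℝ} (hab : a ≤ b)
    (hD : IntervalIntegrable D volume a b) (hG : ∀ t ∈ Icc a b, ∫ s in a..t, D s = G t - G a) :
    AbsolutelyContinuousOnInterval G a b := by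
  have h := hD.absolutelyContinuousOnInterval_intervalIntegral left_mem_uIcc
  rw [absolutelyContinuousOnInterval_iff] at h ⊢
  intro ε hε
  obtain ⟨r, hr, h1⟩ := h ε hε
  refine ⟨r, hr, fun E hE hEr => lt_of_eq_of_lt (Finset.sum_congr rfl fun i hi => ?_) (h1 E hE hEr)⟩
  have h2 := hE.1 i hi
  rw [uIcc_of_le hab] at h2
  simp only [hG _ h2.1, hG _ h2.2, Real.dist_eq, sub_sub_sub_cancel_right]

/-- Near `t` the continuous function `C G` stays below some `K' < K`, hence so does the rate almost
everywhere. Integration over short intervals ending or starting at `t` bounds the difference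
quotients from both sides. -/
lemma eventually_slope_lt_of_integral {G D : ℝ → ℝ} {T C : ℝ}
    (hG : ∀ a b, 0 < a → a ≤ b → b < T →
      IntervalIntegrable D volume a b ∧ ∫ t in a..b, D t = G b - G a)
    (hc : ContinuousOn G (Ioo 0 T)) (hD : ∀ᵐ t, t ∈ Ioo 0 T → D t ≤ C * G t) {t K : ℝ}
    (ht : t ∈ Ioo 0 T) (hK : C * G t < K) : ∀ᶠ s in 𝓝[≠] t, slope G t s < K := by
  obtain ⟨K', h1, h2⟩ := exists_between hK
  have hcont : ContinuousAt (fun s => C * G s) t :=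
    continuousAt_const.mul (hc.continuousAt (Ioo_mem_nhds ht.1 ht.2))
  obtain ⟨r, hr, hr'⟩ := Metric.eventually_nhds_iff_ball.1
    ((hcont.eventually_lt continuousAt_const h1).and (Ioo_mem_nhds ht.1 ht.2))
  have key : ∀ p q, p ∈ Metric.ball t r → q ∈ Metric.ball t r → p ≤ q → G q - G p ≤ K' * (q - p) := by
    intro p q hp hq hpq
    have h3 := hG p q (hr' p hp).2.1 hpq (hr' q hq).2.2
    rw [← h3.2]
    have h4 : ∫ s in p..q, K' = K' * (q - p) := by simp [mul_comm]
    rw [← h4]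
    refine intervalIntegral.integral_mono_ae_restrict hpq h3.1 intervalIntegrable_const ?_
    rw [Filter.EventuallyLE, ae_restrict_iff' measurableSet_Icc]
    filter_upwards [hD] with s hs hspq
    rw [Real.ball_eq_Ioo] at hp hq
    have h5 := hr' s (by rw [Real.ball_eq_Ioo]; exact ⟨hp.1.trans_le hspq.1, hspq.2.trans_lt hq.2⟩)
    exact (hs h5.2).trans h5.1.le
  filter_upwards [nhdsWithin_le_nhds (Metric.ball_mem_nhds t hr), self_mem_nhdsWithin] with s hs hne
  refine lt_of_le_of_lt ?_ h2
  rw [slope_def_field]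
  rcases lt_or_gt_of_ne hne with h | h
  · have := key s t hs (Metric.mem_ball_self hr) h.le
    rw [← neg_div_neg_eq, div_le_iff₀ (by linarith)]
    linarith
  · have := key t s (Metric.mem_ball_self hr) hs h.le
    rwa [div_le_iff₀ (by linarith)]

lemma deriv_le_of_eventually_slope_lt {G : ℝ → ℝ} {t c : ℝ} (hG : DifferentiableAt ℝ G t)
    (h : ∀ K, c < K → ∀ᶠ s in 𝓝[≠] t, slope G t s < K) : deriv G t ≤ c :=
  le_of_forall_gt_imp_ge_of_dense fun K hK =>
    le_of_tendsto (hasDerivAt_iff_tendsto_slope.1 hG.hasDerivAt) ((h K hK).mono fun _ hs => hs.le)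

/-- Exhaust `(0, T)` by countably many compact intervals. -/
lemma ae_differentiableAt_of_absolutelyContinuousOnInterval {G : ℝ → ℝ} {T : ℝ}
    (hG : ∀ a b, 0 < a → a ≤ b → b < T → AbsolutelyContinuousOnInterval G a b) :
    ∀ᵐ t, t ∈ Ioo 0 T → DifferentiableAt ℝ G t := by
  have h : ∀ n : ℕ, ∀ᵐ t, t ∈ Ioo (1 / ((n:ℝ) + 1)) (T - 1 / ((n:ℝ) + 1)) →
      DifferentiableAt ℝ G t := by
    intro n
    by_cases hn : 1 / ((n:ℝ) + 1) ≤ T - 1 / ((n:ℝ) + 1)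
    · have hp : 0 < 1 / ((n:ℝ) + 1) := by positivity
      filter_upwards [(hG _ _ hp hn (by linarith)).ae_differentiableAt] with t h1 h2
      exact h1 (by rw [uIcc_of_le hn]; exact Ioo_subset_Icc_self h2)
    · rw [Ioo_eq_empty (fun h => hn h.le)]; simp
  filter_upwards [ae_all_iff.2 h] with t h1 h2
  obtain ⟨n, hn⟩ := exists_nat_one_div_lt (lt_min h2.1 (sub_pos.2 h2.2))
  exact h1 n ⟨hn.trans_le (min_le_left _ _), by linarith [hn.trans_le (min_le_right _ _)]⟩

end

/-! ### The relative energy inequality. -/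

theorem proposition3 (d : ℕ) (hd : 1 ≤ d) (T : ℝ) (hT : 0 < T)
    (Ω : ℝ → Set (Rd d)) (hΩ : IsClosedSurfaceFamily T Ω)
    (hvol : ∀ t ∈ Set.Icc 0 T, volume (Ω t) = volume (Ω 0))
    (ξ B : ℝ → Rd d → Rd d) (θ : ℝ → Rd d → ℝ) (lam : ℝ → ℝ)
    (hcal : IsGradientFlowCalibration T Ω ξ B θ lam) :
    ∃ C : ℝ, ∀ (W : ℝ → ℝ), IsDoubleWell W → ∀ ε : ℝ, 0 < ε → ∀ u : ℝ → Rd d → ℝ,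
      IsNonlocalAllenCahnSolution W ε T u →
      ∫ x, psi W (u 0) x = volume.real (Ω 0) →
      ∀ G : ℝ → ℝ, (∀ t, G t = relativeEnergy W ε ξ u t + volumeError W Ω θ u t) →
        -- `G` is locally absolutely continuous
        (∀ a b, 0 < a → a ≤ b → b < T → AbsolutelyContinuousOnInterval G a b) ∧
        -- `G` has a derivative almost everywhere, and it satisfies the inequality wherever it exists
        (∀ᵐ t, t ∈ Set.Ioo 0 T → DifferentiableAt ℝ G t) ∧
        (∀ t ∈ Set.Ioo 0 T, DifferentiableAt ℝ G t → deriv G t ≤ C * G t) ∧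
        -- at every time, all four Dini derivatives satisfy the inequality
        (∀ t ∈ Set.Ioo 0 T, ∀ K, C * G t < K → ∀ᶠ s in 𝓝[≠] t, slope G t s < K) := by
  obtain ⟨K, hK⟩ := hcal.exists_sliceControl hd hΩ hvol
  -- `K` and `C` are fixed before `W`, `ε` and `u` are introduced, so they depend only on the
  -- dimension, `T` and the calibrated flow.
  obtain ⟨C, hC⟩ := exists_integral_rate_le hd K (volume.real (Ω 0))
  have hm0 : 0 < volume.real (Ω 0) :=
    IsGradientFlowCalibration.measureReal_pos hΩ (left_mem_Icc.2 hT.le)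
  refine ⟨C, fun W hW ε hε u hs hm G hG => ?_⟩
  have hint : ∀ a b, 0 < a → a ≤ b → b < T →
      IntervalIntegrable (IsNonlocalAllenCahnSolution.totalRate W ε Ω θ ξ u) volume a b ∧
      ∫ t in a..b, IsNonlocalAllenCahnSolution.totalRate W ε Ω θ ξ u t = G b - G a := by
    intro a b ha hab hb
    rw [hG, hG]
    exact hs.integral_totalRate hW hε hd hΩ hcal hK hm0 hm ha hab hb
  have hAC : ∀ a b, 0 < a → a ≤ b → b < T → AbsolutelyContinuousOnInterval G a b := by
    intro a b ha hab hb
    refine absolutelyContinuousOnInterval_of_integral_eq hab (hint a b ha hab hb).1 fun t ht => ?_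
    exact (hint a t ha ht.1 (ht.2.trans_lt hb)).2
  have hcont : ContinuousOn G (Ioo 0 T) := by
    intro t ht
    obtain ⟨a, ha, hat⟩ := exists_between ht.1
    obtain ⟨b, htb, hb⟩ := exists_between ht.2
    have h1 := (hAC a b ha (hat.trans htb).le hb).continuousOn
    rw [uIcc_of_le (hat.trans htb).le] at h1
    exact (h1.continuousAt (Icc_mem_nhds hat htb)).continuousWithinAt
  have hrate : ∀ᵐ t, t ∈ Ioo 0 T →
      IsNonlocalAllenCahnSolution.totalRate W ε Ω θ ξ u t ≤ C * G t := by
    filter_upwards [hK] with t h1 ht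
    have h := h1 ht
    have hv : SolutionSlice W ε (volume.real (Ω 0)) (lagrangeMultiplier W ε (u t)) (u t)
        (timeDeriv u t) := by
      rw [← hm, ← hs.integral_psi_eq hW hε ht]
      exact hs.solutionSlice hW hε ht
    have h2 := hC _ _ _ _ _ _ _ _ h W ε _ _ _ hv
    have h3 : volumeError W Ω θ u t = ∫ x, phaseError W (Ω t) (u t) x * θ t x :=
      integral_congr_ae (.of_forall fun x => h.abs_mul_abs hv x)
    rwa [integral_add hv.int_energy (hs.integrable_fderiv_psi_apply hW hcal ht),
      ← IsNonlocalAllenCahnSolution.relativeEnergy_eq, ← h3, ← hG] at h2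
  have hslope : ∀ t ∈ Set.Ioo 0 T, ∀ K, C * G t < K → ∀ᶠ s in 𝓝[≠] t, slope G t s < K :=
    fun t ht K hK => eventually_slope_lt_of_integral hint hcont hrate ht hK
  exact ⟨hAC, ae_differentiableAt_of_absolutelyContinuousOnInterval hAC,
    fun t ht hd => deriv_le_of_eventually_slope_lt hd (hslope t ht), hslope⟩
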